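/- Let $\mathcal C$ be one of the following two categories. * $\mathcal{LRF}$: finite rooted forests labeled injectively by a fixed infinite set (isomorphisms ignore labels). The subobjects of $F$ are the forests $P_c(F)$ of branches severed by an admissible cut $c$ (a cut meeting every path to a root at most once; cutting off whole trees is allowed), with quotient $F/P_c(F)=R_c(F)$, the part containing the roots. * $\mathcal{LFG}$: (labeled) Feynman graphs of $\phi^3$ theory: finite graphs with half-edges, trivalent vertices, such that each connected component is one-particle irreducible, has a loop, and has $2$ or $3$ external edges. A subobject of $\Gamma$ is a Feynman subgraph $\gamma$ (some vertices, all half-edges at them, and some of the adjacencies between these half-edges). The quotient $\Gamma/\gamma$ is the contraction: components of $\gamma$ with $3$ external edges become vertices, those with $2$ external edges become edges, and those that are whole components of $\Gamma$ disappear. Quotients of Feynman graphs are again Feynman graphs. Let $H_{\mathcal C}$ be the space of finitely supported functions $\mathrm{Iso}(\mathcal C)\to\mathbb Q$, with basis $\delta_A$ and product $(f\times g)(M)=\sum_{N\subset M}f(N)\,g(M/N)$; it is an associative algebra with unit $\delta_\emptyset$. The space $\mathfrak n_{\mathcal C}$ of its primitive elements for $\Delta(f)(M,N)=f(M\oplus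 N)$ is a Lie algebra under the commutator; put $X^t=-X$ for $X\in\mathfrak n_{\mathcal C}$. The form $\kappa(f,g)=\sum_A f(A)g(A)$ identifies $H_{\mathcal C}$ with its restricted dual $H^*_{\mathcal C}=\mathrm{span}\{\phi_A\}$, $\delta_A\mapsto\phi_A$. Consider the following actions: insertion $X\cdot h=X\times h$ (left) and top insertion $h\cdot X=h\times X$ (right) on $H_{\mathcal C}$; elimination $(X\cdot\phi)(h)=-\phi(X\times h)$ (left) and top elimination $(\phi\cdot X)(h)=-\phi(h\times X)$ (right) on $H^*_{\mathcal C}$. Let $\mathcal H=\{(A\subset B)\}$ be the set of pairs of an isomorphism class $B$ and a subobject $A$ of $B$, with maps $\pi_1(A\subset B)=A$, $\pi_2(A\subset B)=B$, $\pi_q(A\subset B)=B/A$ to $\mathrm{Iso}(\mathcal C)$. Let $\pi^*$ denote pull-back of functions and $\pi_*$ summation along fibres. In each of the following convolutions of $f,g\in H_{\mathcal C}$ the function on $\mathcal H$ that is pushed forward has finite support, and the result is in $H_{\mathcal C}$. 1. $g\bullet f=\pi_{q*}(\pi_1^*(f)\,\pi_2^*(g))$ is a right action of the algebra $H_{\mathcal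 C}$ on $H_{\mathcal C}$, and $\delta_B\bullet\delta_A=\sum_{N\subset B,\,N\simeq A}\delta_{B/N}$. For $X\in\mathfrak n_{\mathcal C}$, $\kappa(g\bullet X^t,-)=X\cdot\kappa(g,-)$, the elimination representation. 2. $g\,\Box\,f=\pi_{2*}(\pi_q^*(f)\,\pi_1^*(g))$ is a right action of $H_{\mathcal C}$ on $H_{\mathcal C}$ (with $f$ acting on $g$), and $(\delta_B\,\Box\,\delta_A)(E)=\#\{N\subset E: N\simeq B,\ E/N\simeq A\}$. It is the top insertion action; viewed as a left action of $g$ on $f$, it is the insertion action. 3. $f\star g=\pi_{1*}(\pi_q^*(f)\,\pi_2^*(g))$ is a left action of $H_{\mathcal C}$ on $H_{\mathcal C}$, and $\delta_A\star\delta_B=\sum_{N\subset B,\,B/N\simeq A}\delta_N$. For $X\in\mathfrak n_{\mathcal C}$, $\kappa(X\star g,-)=\kappa(g,-)\cdot X^t$, the top elimination representation switched from right to left. Let $M\in\mathrm{Iso}(\mathcal C)$, let $\mathcal H_{\le M}\subset\mathcal H$ consist of the pairs $(A\subset B)$ with $B$ isomorphic to a subobject of $M$, and let $H_{\le M}$ be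 the space of functions supported on isomorphism classes of subobjects of $M$. It is finite-dimensional, $\kappa$ identifies it with $\mathrm{span}\{\phi_A: A\text{ a subobject of }M\}\subset H^*_{\mathcal C}$, and $\kappa$ restricted to $H_{\le M}$ identifies $H_{\le M}$ with its dual. For $f\in H_{\mathcal C}$ and $g\in H_{\le M}$ define $f\star g=\pi_{1*}(\pi_q^*(f)\,\pi_2^*(g))$ and $g\,\Box\,f=\pi_{2*}(\pi_q^*(f)\,\pi_1^*(g))$ through $\mathcal H_{\le M}$. These are a left and a right action of $H_{\mathcal C}$ on $H_{\le M}$. For $X\in\mathfrak n_{\mathcal C}$, $\kappa(X\star g,-)=\kappa(g,-)\cdot X^t$, i.e. $\star$ is the opposite (through ${}^t:\mathfrak n_{\mathcal C}\simeq\mathfrak n_{\mathcal C}^{op}$) of the top elimination representation on $H_{\le M}$; and $\kappa(g\,\Box\,X^t,v)=-\kappa(g,X\star v)$ for all $v\in H_{\le M}$, i.e. $\Box$ is the opposite of the dual representation. -/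

import Mathlib

universe u v

noncomputable section

namespace CK

/-! ### Finite-support bookkeeping: pull-back and integration along fibres -/

/-- Pull-back of a function along `p`. -/
def pull {X : Type u} {Y : Type v} (p : X → Y) (f : Y → ℚ) : X → ℚ := fun x => f (p x)

/-- Integration along the fibres of `p`. The sum is a `finsum`; every use below comes with the claim
that the integrand has finite support. -/
def push {X : Type u} {Y : Type v} (p : X → Y) (F : X → ℚ) : Y → ℚ :=
  fun y => ∑ᶠ x : p ⁻¹' {y}, F x

/-! ### What is used of a category: objects, isomorphism, disjoint unions, subobjects, quotients -/

/-- The data of a category that enter its Hall algebra. It carries no laws: it is only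
instantiated at labeled rooted forests and at labeled Feynman graphs. -/
structure HallData where
  /-- the objects -/
  Obj : Type (u + 1)
  /-- isomorphism of objects -/
  iso : Setoid Obj
  /-- the null object -/
  zero : Obj
  /-- `IsSum M N B`: the object `B` is isomorphic to the disjoint union `M ⊕ N` -/
  IsSum : Obj → Obj → Obj → Prop
  /-- the subobjects `A ⊂ B` of `B` -/
  Sub : Obj → Type u
  finite_sub : ∀ B, Finite (Sub B)
  /-- the object underlying a subobject `A ⊂ B` -/
  sub : ∀ {B : Obj}, Sub B → Obj
  /-- the quotient `B / A` -/
  quo : ∀ {B : Obj}, Sub B → Obj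

/-! ### Labeled rooted forests -/

/-- A rooted forest labeled by `S`: a finite vertex set with an injective labeling by `S` and an
acyclic parent function. The roots are the vertices without parent; the trees of the forest are
the sets of descendants of the roots. The empty forest is allowed. -/
structure Forest (S : Type u) where
  V : Type u
  fin : Finite V
  label : V ↪ S
  parent : V → Option V
  wf : WellFounded fun a b => parent b = some a

namespace Forest

variable {S : Type u}

/-- `F.Anc a b`: the vertex `a` lies on the path from `b` to the root (possibly `a = b`). -/
def Anc (F : Forest S) : F.V → F.V → Prop :=
  Relation.ReflTransGen fun a b => F.parent b = some a

/-- Isomorphism of forests: a bijection of the vertices that respects roots and parents. Labels are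
not respected. -/
def Iso (F G : Forest S) : Prop :=
  ∃ e : F.V ≃ G.V, ∀ v, G.parent (e v) = (F.parent v).map e

theorem iso_equivalence : Equivalence (Iso (S := S)) where
  refl F := ⟨Equiv.refl _, fun v => by simp⟩
  symm := by
    rintro F G ⟨e, he⟩
    refine ⟨e.symm, fun v => ?_⟩
    have h := he (e.symm v)
    rw [Equiv.apply_symm_apply] at h
    rw [h, Option.map_map]
    simp
  trans := by
    rintro F G K ⟨e, he⟩ ⟨e', he'⟩
    exact ⟨e.trans e', fun v => by simp [he', he]⟩

/-- The forest induced on a set `U` of vertices: the edges between `U` and its complement are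
removed. -/
def restrict (F : Forest S) (U : Set F.V) : Forest S where
  V := U
  fin := haveI := F.fin; inferInstance
  label := ⟨fun x => F.label x.1, fun _ _ h => Subtype.ext (F.label.injective h)⟩
  parent x := by
    classical
    exact (F.parent x.1).bind fun w => if h : w ∈ U then some ⟨w, h⟩ else none
  wf := by
    refine Subrelation.wf ?_ (InvImage.wf (fun x : U => x.1) F.wf)
    intro a b h
    rcases Option.bind_eq_some_iff.mp h with ⟨w, hw, h'⟩
    by_cases hU : w ∈ U
    · rw [dif_pos hU] at h'
      cases h'
      exact hw
    · rw [dif_neg hU] at h'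
      cases h'

/-- The empty forest. -/
def empty (S : Type u) : Forest S where
  V := PEmpty
  fin := inferInstance
  label := ⟨fun x => x.elim, fun x => x.elim⟩
  parent x := x.elim
  wf := ⟨fun x => x.elim⟩

/-- `B` is isomorphic to the disjoint union of `M` and `N`. -/
def IsSum (M N B : Forest S) : Prop :=
  ∃ e : M.V ⊕ N.V ≃ B.V,
    (∀ v, B.parent (e (Sum.inl v)) = (M.parent v).map fun w => e (Sum.inl w)) ∧
    (∀ v, B.parent (e (Sum.inr v)) = (N.parent v).map fun w => e (Sum.inr w))

/-- Admissible cuts of `F`. An edge is recorded by its endpoint away from the root, and the full cut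
of a tree by the root of that tree; so a cut is a set of vertices, and it is admissible if no path
from a vertex to the root meets it more than once. -/
def Cut (F : Forest S) : Type u :=
  {c : Set F.V // ∀ a ∈ c, ∀ b ∈ c, F.Anc a b → a = b}

/-- The vertices of the branches that the cut `c` severs. -/
def Cut.below {F : Forest S} (c : F.Cut) : Set F.V := {v | ∃ a ∈ c.1, F.Anc a v}

/-- The forest `P_c(F)` of the severed branches, the subobject that `c` determines. -/
def Cut.P {F : Forest S} (c : F.Cut) : Forest S := F.restrict c.below

/-- The forest `R_c(F)` of what remains at the roots, the quotient `F / P_c(F)`. -/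
def Cut.R {F : Forest S} (c : F.Cut) : Forest S := F.restrict c.belowᶜ

theorem finite_cut (F : Forest S) : Finite F.Cut :=
  haveI := F.fin
  inferInstanceAs (Finite {c : Set F.V // ∀ a ∈ c, ∀ b ∈ c, F.Anc a b → a = b})

end Forest

/-- The category of rooted forests labeled by `S`. -/
def forestData (S : Type u) : HallData.{u} where
  Obj := Forest S
  iso := ⟨Forest.Iso, Forest.iso_equivalence⟩
  zero := Forest.empty S
  IsSum := Forest.IsSum
  Sub := Forest.Cut
  finite_sub := Forest.finite_cut
  sub := Forest.Cut.P
  quo := Forest.Cut.R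

/-! ### Labeled Feynman graphs -/

/-- The incidence data of a graph with half-edges: each half-edge is incident to one vertex,
and `adj` is the adjacency of half-edges. The half-edges are their own labels. -/
structure HGraph where
  V : Type u
  H : Type u
  finV : Finite V
  finH : Finite H
  vert : H → V
  adj : H → H → Prop

namespace HGraph

/-- `v` and `w` are joined by a path that does not use the half-edges in `X`. -/
def ConnAvoiding (G : HGraph.{u}) (X : Set G.H) : G.V → G.V → Prop :=
  Relation.ReflTransGen fun a b =>
    ∃ h k, h ∉ X ∧ k ∉ X ∧ G.adj h k ∧ G.vert h = a ∧ G.vert k = b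

/-- The connected component of `v`. -/
def comp (G : HGraph.{u}) (v : G.V) : Set G.V := {w | G.ConnAvoiding ∅ v w}

/-- A half-edge is external if it is adjacent to no half-edge. -/
def External (G : HGraph.{u}) (h : G.H) : Prop := ∀ k, ¬ G.adj h k

/-- Feynman graphs of the `φ³` theory, not necessarily connected. -/
structure IsFeynman (G : HGraph.{u}) : Prop where
  symm : ∀ h k, G.adj h k → G.adj k h
  irrefl : ∀ h, ¬ G.adj h h
  unique : ∀ h k k', G.adj h k → G.adj h k' → k = k'
  /-- every vertex is incident to three half-edges -/
  trivalent : ∀ v, {h | G.vert h = v}.ncard = 3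
  /-- every component has two or three external edges -/
  external : ∀ v, {h | G.External h ∧ G.vert h ∈ G.comp v}.ncard = 2 ∨
    {h | G.External h ∧ G.vert h ∈ G.comp v}.ncard = 3
  /-- every component has a loop: its first Betti number `#edges - #vertices + 1` is at least `1`,
  where an internal edge consists of two half-edges -/
  loop : ∀ v, 2 * (G.comp v).ncard ≤ {h | ¬ G.External h ∧ G.vert h ∈ G.comp v}.ncard
  /-- every component is one-particle irreducible: it remains connected when an internal edge is
  removed -/
  onePI : ∀ h k, G.adj h k → G.ConnAvoiding {h, k} (G.vert h) (G.vert k)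

/-- Isomorphism of graphs. -/
def Iso (G K : HGraph.{u}) : Prop :=
  ∃ (eV : G.V ≃ K.V) (eH : G.H ≃ K.H), (∀ h, K.vert (eH h) = eV (G.vert h)) ∧
    ∀ h k, K.adj (eH h) (eH k) ↔ G.adj h k

theorem iso_equivalence : Equivalence Iso.{u} where
  refl G := ⟨Equiv.refl _, Equiv.refl _, fun _ => rfl, fun _ _ => Iff.rfl⟩
  symm := by
    rintro G K ⟨eV, eH, h1, h2⟩
    refine ⟨eV.symm, eH.symm, fun h => ?_, fun h k => ?_⟩
    · rw [Equiv.eq_symm_apply, ← h1, Equiv.apply_symm_apply]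
    · rw [← h2, Equiv.apply_symm_apply, Equiv.apply_symm_apply]
  trans := by
    rintro G K L ⟨eV, eH, h1, h2⟩ ⟨eV', eH', h1', h2'⟩
    refine ⟨eV.trans eV', eH.trans eH', fun h => ?_, fun h k => ?_⟩
    · simp [h1', h1]
    · simp [h2', h2]

/-- The disjoint union of two graphs. -/
def disjUnion (G K : HGraph.{u}) : HGraph.{u} where
  V := G.V ⊕ K.V
  H := G.H ⊕ K.H
  finV := haveI := G.finV; haveI := K.finV; inferInstance
  finH := haveI := G.finH; haveI := K.finH; inferInstance
  vert := Sum.map G.vert K.vert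
  adj := Sum.LiftRel G.adj K.adj

/-- The empty graph. -/
def empty : HGraph.{u} where
  V := PEmpty
  H := PEmpty
  finV := inferInstance
  finH := inferInstance
  vert := id
  adj _ _ := False

theorem isFeynman_empty : IsFeynman empty.{u} where
  symm h := h.elim
  irrefl h := h.elim
  unique h := h.elim
  trivalent v := v.elim
  external v := v.elim
  loop v := v.elim
  onePI h := h.elim

/-- The graph with vertex set `W`, all half-edges of `G` at these vertices, and those
adjacencies of `G` that relate half-edges in `J`. -/
def part (G : HGraph.{u}) (W : Set G.V) (J : Set G.H) : HGraph.{u} where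
  V := W
  H := {h : G.H // G.vert h ∈ W}
  finV := haveI := G.finV; inferInstance
  finH := haveI := G.finH; inferInstance
  vert h := ⟨G.vert h.1, h.2⟩
  adj h k := G.adj h.1 k.1 ∧ h.1 ∈ J ∧ k.1 ∈ J

/-- Feynman subgraphs `γ = (W, J)` of `G`: `W` is the set of vertices of `γ`, and `J` is the set of
half-edges that belong to internal edges of `γ`. An edge of `G` between two components of
`γ` need not be an edge of `γ`. -/
def Subgraph (G : HGraph.{u}) : Type u :=
  {γ : Set G.V × Set G.H // (∀ h ∈ γ.2, G.vert h ∈ γ.1 ∧ ∃ k ∈ γ.2, G.adj h k) ∧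
    (G.part γ.1 γ.2).IsFeynman}

theorem finite_subgraph (G : HGraph.{u}) : Finite G.Subgraph :=
  haveI := G.finV
  haveI := G.finH
  inferInstanceAs (Finite {γ : Set G.V × Set G.H //
    (∀ h ∈ γ.2, G.vert h ∈ γ.1 ∧ ∃ k ∈ γ.2, G.adj h k) ∧ (G.part γ.1 γ.2).IsFeynman})

namespace Subgraph

variable {G : HGraph.{u}} (γ : G.Subgraph)

/-- The vertices of `γ`. -/
def W : Set G.V := γ.1.1

/-- The half-edges in internal edges of `γ`. -/
def J : Set G.H := γ.1.2

/-- The connected component of `v` in `γ`, for a vertex `v` of `γ`. -/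
def comp (v : G.V) : Set G.V :=
  {w | Relation.ReflTransGen
    (fun a b => ∃ h ∈ γ.J, ∃ k ∈ γ.J, G.adj h k ∧ G.vert h = a ∧ G.vert k = b) v w}

/-- The external half-edges of the component of `v` in `γ`. -/
def ext (v : G.V) : Set G.H := {h | G.vert h ∈ γ.comp v ∧ h ∉ γ.J}

/-- The component of `v` in `γ` is a whole connected component of `G`. -/
def Full (v : G.V) : Prop := ∀ h ∈ γ.ext v, G.External h

/-- The component of `v` in `γ` is contracted to a vertex: it has three external edges, and it
is not a whole component of `G` (whole components are contracted to the empty graph). -/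
def ToVertex (v : G.V) : Prop := v ∈ γ.W ∧ (γ.ext v).ncard = 3 ∧ ¬ γ.Full v

/-- The half-edges of the quotient graph. -/
def Kept (h : G.H) : Prop := G.vert h ∉ γ.W ∨ (h ∉ γ.J ∧ γ.ToVertex (G.vert h))

/-- `a` and `b` are the two external half-edges of a component of `γ` with two external edges. -/
def Through (a b : G.H) : Prop :=
  G.vert a ∈ γ.W ∧ γ.ext (G.vert a) = {a, b} ∧ a ≠ b

/-- `h` and `k` become adjacent when the components of `γ` with two external edges are contracted:
there is a sequence of adjacencies from `h` to `k` that traverses such components only. -/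
inductive Link : G.H → G.H → Prop
  | adj {h k : G.H} : G.adj h k → Link h k
  | through {h a b k : G.H} : Link h a → γ.Through a b → G.adj b k → Link h k

/-- The quotient graph `G / γ`: every component of `γ` with three external edges becomes a
trivalent vertex, every component with two external edges becomes an edge, and components of `G` that
are components of `γ` disappear. -/
def contract : HGraph.{u} where
  V := {v : G.V // v ∉ γ.W} ⊕ {c : Set G.V // ∃ v, γ.ToVertex v ∧ c = γ.comp v}
  H := {h : G.H // γ.Kept h}
  finV := haveI := G.finV; inferInstance
  finH := haveI := G.finH; inferInstance
  vert h := by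
    classical
    exact if h' : G.vert h.1 ∈ γ.W then
      Sum.inr ⟨γ.comp (G.vert h.1), G.vert h.1, (h.2.resolve_left (not_not.mpr h')).2, rfl⟩
    else Sum.inl ⟨G.vert h.1, h'⟩
  adj h k := γ.Link h.1 k.1

end Subgraph

end HGraph

/-- Labeled Feynman graphs. -/
def FeynmanGraph : Type (u + 1) := {G : HGraph.{u} // G.IsFeynman}

/-- A graph as an object. The default value for graphs that are not Feynman graphs is never taken
below: that quotients of Feynman graphs are Feynman graphs is part of the theorem. -/
def FeynmanGraph.mk (G : HGraph.{u}) : FeynmanGraph.{u} := by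
  classical
  exact if h : G.IsFeynman then ⟨G, h⟩ else ⟨HGraph.empty, HGraph.isFeynman_empty⟩

/-- The category of labeled Feynman graphs. -/
def graphData : HallData.{u} where
  Obj := FeynmanGraph.{u}
  iso := ⟨fun Γ Δ => Γ.1.Iso Δ.1, fun Γ => HGraph.iso_equivalence.refl Γ.1,
    HGraph.iso_equivalence.symm, HGraph.iso_equivalence.trans⟩
  zero := ⟨HGraph.empty, HGraph.isFeynman_empty⟩
  IsSum M N B := (M.1.disjUnion N.1).Iso B.1
  Sub Γ := Γ.1.Subgraph
  finite_sub Γ := Γ.1.finite_subgraph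
  sub {Γ} γ := ⟨Γ.1.part γ.W γ.J, γ.2.2⟩
  quo γ := FeynmanGraph.mk γ.contract

/-- The two kinds of categories: rooted forests labeled by an infinite set `S`, and labeled Feynman
graphs. -/
inductive CKCategory : Type (u + 1)
  | LRF (S : Type u) (hS : Infinite S)
  | LFG

/-- The data of the categories. -/
def CKCategory.data : CKCategory.{u} → HallData.{u}
  | LRF S _ => forestData S
  | LFG => graphData

/-! ### Hall algebra, primitive elements, representations -/

namespace HallData

variable (C : HallData.{u})

/-- Isomorphism classes of objects. -/
def Cls : Type (u + 1) := Quotient C.iso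

/-- The class of an object. -/
def cls (X : C.Obj) : C.Cls := Quotient.mk C.iso X

/-- An object in a given class. -/
def rep (B : C.Cls) : C.Obj := Quotient.out B

/-- `H_C`: finitely supported rational functions on the isomorphism classes. -/
abbrev Hall : Type (u + 1) := C.Cls →₀ ℚ

/-- The delta function `δ_A`. As an element of the algebra that acts, it is also written `X_A`. -/
def delta (A : C.Cls) : C.Hall := Finsupp.single A 1

/-- The unit of `H_C`. -/
def one : C.Hall := C.delta (C.cls C.zero)

/-- The Hall product: `(f × g)(M) = ∑_{N ⊂ M} f(N) g(M / N)`. -/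
def hallProduct (f g : C.Hall) (M : C.Cls) : ℚ :=
  ∑ᶠ N : C.Sub (C.rep M), f (C.cls (C.sub N)) * g (C.cls (C.quo N))

/-- The primitive elements `n_C` of `H_C` for the coproduct `Δ(f)(M, N) = f(M ⊕ N)`: those `f` with
`Δ(f) = f ⊗ 1 + 1 ⊗ f`. -/
def primitives : Submodule ℚ C.Hall where
  carrier := {f | ∀ M N B, C.IsSum M N B →
    f (C.cls B) = f (C.cls M) * C.one (C.cls N) + C.one (C.cls M) * f (C.cls N)}
  zero_mem' := fun M N B _ => by simp
  add_mem' := fun {f g} hf hg M N B h => by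
    rw [Finsupp.add_apply, hf M N B h, hg M N B h, Finsupp.add_apply, Finsupp.add_apply]
    ring
  smul_mem' := fun c f hf M N B h => by
    rw [Finsupp.smul_apply, hf M N B h, Finsupp.smul_apply, Finsupp.smul_apply]
    simp only [smul_eq_mul]
    ring

/-- The functional `φ_A` dual to `δ_A`. -/
def phi (A : C.Cls) : Module.Dual ℚ C.Hall := Finsupp.lapply A

/-- The restricted dual of `H_C`. -/
def restrictedDual : Submodule ℚ (Module.Dual ℚ C.Hall) := Submodule.span ℚ (Set.range C.phi)

/-- The form `κ(f, g) = ∑_A f(A) g(A)`, as the map from `H_C` to its dual with `δ_A ↦ φ_A`. -/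
def kappa : C.Hall →ₗ[ℚ] Module.Dual ℚ C.Hall := Finsupp.linearCombination ℚ C.phi

variable {C}

/-- `act` is a left action on `U` of the algebra `H_C` with product `mul`. -/
def IsLeftAction (mul : C.Hall →ₗ[ℚ] C.Hall →ₗ[ℚ] C.Hall) {U : Type (u + 1)} [AddCommGroup U]
    [Module ℚ U] (act : C.Hall →ₗ[ℚ] U →ₗ[ℚ] U) : Prop :=
  (∀ x, act C.one x = x) ∧ ∀ f g x, act (mul f g) x = act f (act g x)

/-- `act` is a right action on `U` of the algebra `H_C` with product `mul`. -/
def IsRightAction (mul : C.Hall →ₗ[ℚ] C.Hall →ₗ[ℚ] C.Hall) {U : Type (u + 1)} [AddCommGroup U]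
    [Module ℚ U] (act : U →ₗ[ℚ] C.Hall →ₗ[ℚ] U) : Prop :=
  (∀ x, act x C.one = x) ∧ ∀ f g x, act x (mul f g) = act (act x f) g

/-- Insertion: the left action `X · h = X × h`. -/
def insertion (mul : C.Hall →ₗ[ℚ] C.Hall →ₗ[ℚ] C.Hall) (X h : C.Hall) : C.Hall := mul X h

/-- Top insertion: the right action `h · X = h × X`. -/
def topInsertion (mul : C.Hall →ₗ[ℚ] C.Hall →ₗ[ℚ] C.Hall) (h X : C.Hall) : C.Hall := mul h X

/-- Elimination: the dual of insertion, `(X · φ)(h) = - φ(X × h)`. -/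
def elimination (mul : C.Hall →ₗ[ℚ] C.Hall →ₗ[ℚ] C.Hall) (X : C.Hall)
    (φ : Module.Dual ℚ C.Hall) : Module.Dual ℚ C.Hall := -(φ ∘ₗ mul X)

/-- Top elimination: the dual of top insertion, the right action `(φ · X)(h) = - φ(h × X)`. -/
def topElimination (mul : C.Hall →ₗ[ℚ] C.Hall →ₗ[ℚ] C.Hall) (φ : Module.Dual ℚ C.Hall)
    (X : C.Hall) : Module.Dual ℚ C.Hall := -(φ ∘ₗ mul.flip X)

variable (C)

/-! ### Hecke correspondences -/

/-- The Hecke correspondence: pairs of an isomorphism class `B` and a subobject `A ⊂ B`. -/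
def Heck : Type (u + 1) := Σ B : C.Cls, C.Sub (C.rep B)

variable {C} in
/-- `π₁(A ⊂ B) = A`. -/
def pi1 (x : C.Heck) : C.Cls := C.cls (C.sub x.2)

variable {C} in
/-- `π₂(A ⊂ B) = B`. -/
def pi2 (x : C.Heck) : C.Cls := x.1

variable {C} in
/-- `π_q(A ⊂ B) = B / A`. -/
def piq (x : C.Heck) : C.Cls := C.cls (C.quo x.2)

/-- The isomorphism classes of the subobjects of `M`. -/
def leSet (M : C.Cls) : Set C.Cls := {E | ∃ N : C.Sub (C.rep M), C.cls (C.sub N) = E}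

/-- The truncated Hecke correspondence: pairs `A ⊂ B` where `B` is a subobject of `M`. -/
def HeckLe (M : C.Cls) : Type (u + 1) := {x : C.Heck // pi2 x ∈ C.leSet M}

/-- The functions supported on the isomorphism classes of subobjects of `M`. -/
def HallLe (M : C.Cls) : Submodule ℚ C.Hall := Finsupp.supported ℚ ℚ (C.leSet M)

/-- `H_{≤ M}` inside the restricted dual: the span of the `φ_A` for the subobjects `A` of `M`. -/
def dualLe (M : C.Cls) : Submodule ℚ (Module.Dual ℚ C.Hall) :=
  Submodule.span ℚ (C.phi '' C.leSet M)

/-- The form `κ` on the functions supported on subobjects of `M`. -/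
def kappaLe (M : C.Cls) : C.HallLe M →ₗ[ℚ] Module.Dual ℚ (C.HallLe M) :=
  (C.HallLe M).dualRestrict ∘ₗ C.kappa ∘ₗ (C.HallLe M).subtype

end HallData

end CK

end

/-! All the convolutions come from one trilinear sum over the pairs `(A ⊂ B)`, in which three
functions are evaluated at `A`, `B` and `B/A`. The Hall product pairs its factors at `A` and `B/A`
with a test function at `B`. Hence `convQuo f` and `convSub f` are the `κ`-adjoints of left and
right Hall multiplication by `f` (`kappa_convQuo`, `kappa_convSub`), and `□` is the Hall product
with its arguments exchanged. Since `κ` is nondegenerate, the action laws reduce to associativity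
and the unit laws, and the sign in `Xᵗ = -X` cancels the one in elimination. For the truncations,
the subobjects of `M` are closed under passing to subobjects (`sub_mem_leSet`). So `⋆` preserves the
functions supported on them, and right multiplication preserves the functions vanishing on them.

The two categories enter only through `Laws`: extensions are finite in number, subobjects of a sum
are pairs, and flags `K ⊂ N ⊂ X` are the same as pairs of `K ⊂ X` and a subobject `N/K` of `X/K`.
The last law, `chain`, gives associativity; the law for sums makes commutators of primitive elements
primitive.

For forests, a cut amounts to a vertex set closed under children (`range_below`), and flags are
nested pairs of such sets.

For graphs, a Feynman subgraph is determined by its set `J` of half-edges in internal edges, and the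
sets that occur are those with `IsGood`. Irreducibility is read as a statement on cuts: no vertex
set is left by exactly one edge. An edge of `G/γ` is a `Link`, a chain of edges of `G` that runs
through components of `γ` with two legs. Irreducibility of `G` shows that such a chain neither
closes up nor ends outside the quotient (`exists_link_of_link_through`). Vertex sets of `G/γ` lift
to `G` with the same crossing half-edges (`exists_boundary_eq`). Therefore the good sets of `G/γ`
are the good sets of `G` that contain `γ` (`isGood_contract`, `isGood_of_contract`,
`lift_preimage`). For the set of all internal half-edges this says that quotients are Feynman
graphs, and in general it turns flags into nested pairs of good sets. -/

noncomputable section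

namespace CK

/-! ### Correspondences acting on finitely supported functions -/

section Correspondence

variable {X : Type u} {I : Type v} (p q r : X → I)

/-- The bilinear map `(f, g) ↦ r_*(p^* f · q^* g)` on finitely supported functions. -/
def corr (hF : ∀ a b, {x | p x = a ∧ q x = b}.Finite) :
    (I →₀ ℚ) →ₗ[ℚ] (I →₀ ℚ) →ₗ[ℚ] (I →₀ ℚ) :=
  Finsupp.linearCombination ℚ fun a => Finsupp.linearCombination ℚ fun b =>
    ∑ x ∈ (hF a b).toFinset, Finsupp.single (r x) 1

variable {p q} (hF : ∀ a b, {x | p x = a ∧ q x = b}.Finite)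

include hF in
-- The support is covered by the joint fibres of `p` and `q` over the finitely many pairs in the two
-- supports.
theorem finite_support_pull_mul_pull (f g : I →₀ ℚ) :
    (pull p f * pull q g).support.Finite := by
  refine ((f.support ×ˢ g.support).finite_toSet.biUnion fun ab _ => hF ab.1 ab.2).subset ?_
  intro x hx
  rw [Function.mem_support, Pi.mul_apply] at hx
  simp only [Set.mem_iUnion]
  refine ⟨(p x, q x), ?_, rfl, rfl⟩
  simpa using ⟨left_ne_zero_of_mul hx, right_ne_zero_of_mul hx⟩

/-- The functional is arbitrary so that one reduction to delta functions serves twice: evaluation at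
a class gives `corr_apply`, pairing under `κ` gives `kappa_corr`. -/
theorem apply_corr (φ : (I →₀ ℚ) →ₗ[ℚ] ℚ) (f g : I →₀ ℚ) :
    φ (corr p q r hF f g) = ∑ᶠ x, f (p x) * g (q x) * φ (Finsupp.single (r x) 1) := by
  have hs : ∀ f g : I →₀ ℚ,
      (Function.support fun x => f (p x) * g (q x) * φ (Finsupp.single (r x) 1)).Finite :=
    fun f g => (finite_support_pull_mul_pull hF f g).subset fun x hx => left_ne_zero_of_mul hx
  induction f using Finsupp.induction_linear with
  | zero => simp
  | add f f' hf hf' =>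
    rw [map_add, LinearMap.add_apply, map_add, hf, hf', ← finsum_add_distrib (hs f g) (hs f' g)]
    simp [add_mul]
  | single a c =>
    induction g using Finsupp.induction_linear with
    | zero => simp
    | add g g' hg hg' =>
      rw [map_add, map_add, hg, hg', ← finsum_add_distrib (hs _ g) (hs _ g')]
      simp [mul_add, add_mul]
    | single b d =>
      classical
      have h1 : ∀ x, Finsupp.single a c (p x) * Finsupp.single b d (q x) *
          φ (Finsupp.single (r x) 1) = if x ∈ (hF a b).toFinset then
            c * d * φ (Finsupp.single (r x) 1) else 0 := by
        intro x
        simp only [Finsupp.single_apply, Set.Finite.mem_toFinset, Set.mem_ofPred_eq,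
          @eq_comm _ (p x), @eq_comm _ (q x)]
        by_cases h : a = p x <;> by_cases h' : b = q x <;> simp [h, h']
      rw [finsum_congr h1]
      rw [finsum_eq_sum_of_support_subset (s := (hF a b).toFinset) _ (by
        intro x hx; by_contra h; exact hx (if_neg h))]
      simp only [corr, Finsupp.linearCombination_single, LinearMap.smul_apply, map_smul, map_sum,
        smul_eq_mul]
      rw [← mul_assoc, Finset.mul_sum]
      exact Finset.sum_congr rfl fun x hx => (if_pos hx).symm

theorem corr_apply (f g : I →₀ ℚ) :
    ⇑(corr p q r hF f g) = push r (pull p f * pull q g) := by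
  classical
  ext y
  have h := apply_corr r hF (Finsupp.lapply y) f g
  rw [Finsupp.lapply_apply] at h
  rw [h, push, finsum_set_coe_eq_finsum_mem (r ⁻¹' {y}) (f := fun x => (pull p f * pull q g) x),
    finsum_mem_def]
  refine finsum_congr fun x => ?_
  rw [Finsupp.lapply_apply, Finsupp.single_apply]
  by_cases hx : r x = y <;> simp [Set.indicator, hx, pull]

end Correspondence

namespace HallData

variable {C : HallData.{u}}

theorem cls_eq {X Y : C.Obj} : C.cls X = C.cls Y ↔ C.iso.r X Y :=
  ⟨fun h => Quotient.exact h, fun h => Quotient.sound h⟩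

@[simp] theorem cls_rep (E : C.Cls) : C.cls (C.rep E) = E := Quotient.out_eq E

instance instFiniteSub (B : C.Obj) : Finite (C.Sub B) := C.finite_sub B

/-! ### The form `κ` -/

theorem kappa_single (a : C.Cls) (c : ℚ) (h : C.Hall) :
    C.kappa (Finsupp.single a c) h = c * h a := by
  simp [kappa, phi]

theorem kappa_apply_single (f : C.Hall) (a : C.Cls) (c : ℚ) :
    C.kappa f (Finsupp.single a c) = c * f a := by
  classical
  induction f using Finsupp.induction_linear with
  | zero => simp
  | add f g hf hg => rw [map_add, LinearMap.add_apply, hf, hg, Finsupp.add_apply, mul_add]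
  | single b d =>
    rw [kappa_single]
    by_cases h : a = b
    · subst h; simp [mul_comm]
    · simp [h, Ne.symm h]

theorem kappa_comm (f g : C.Hall) : C.kappa f g = C.kappa g f := by
  induction f using Finsupp.induction_linear with
  | zero => simp
  | add f f' hf hf' => rw [map_add, LinearMap.add_apply, hf, hf', map_add]
  | single a c => rw [kappa_single, kappa_apply_single]

theorem kappa_ext {f g : C.Hall} (h : ∀ a, C.kappa f (Finsupp.single a 1) =
    C.kappa g (Finsupp.single a 1)) : f = g := by
  ext a
  simpa [kappa_apply_single] using h a

theorem kappa_injective : Function.Injective C.kappa := fun f g h =>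
  kappa_ext fun a => by rw [h]

theorem range_kappa : LinearMap.range C.kappa = C.restrictedDual :=
  Finsupp.range_linearCombination ℚ

/-- After pairing with `h` the map `r` stands on the same footing as `p` and `q`. Permuting the
three maps is what makes the convolutions adjoint to the Hall product. -/
theorem kappa_corr {X : Type v} {p q r : X → C.Cls}
    (hF : ∀ a b, {x | p x = a ∧ q x = b}.Finite) (f g h : C.Hall) :
    C.kappa (corr p q r hF f g) h = ∑ᶠ x, f (p x) * g (q x) * h (r x) := by
  rw [kappa_comm, apply_corr]
  simp [kappa_apply_single]

/-! ### The laws behind the Hall algebra -/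

variable (C) in
/-- The properties of subobjects and quotients that make the Hall product an associative unital
product of finitely supported functions whose primitive elements form a Lie algebra. -/
structure Laws : Prop where
  finite_ext : ∀ A B : C.Cls,
    {E : C.Cls | ∃ N : C.Sub (C.rep E), C.cls (C.sub N) = A ∧ C.cls (C.quo N) = B}.Finite
  transport : ∀ X Y : C.Obj, C.cls X = C.cls Y → ∃ e : C.Sub X ≃ C.Sub Y, ∀ N,
    C.cls (C.sub (e N)) = C.cls (C.sub N) ∧ C.cls (C.quo (e N)) = C.cls (C.quo N)
  sum : ∀ M N B : C.Obj, C.IsSum M N B → ∃ e : C.Sub M × C.Sub N ≃ C.Sub B, ∀ x,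
    C.IsSum (C.sub x.1) (C.sub x.2) (C.sub (e x)) ∧ C.IsSum (C.quo x.1) (C.quo x.2) (C.quo (e x))
  chain : ∀ X : C.Obj, ∃ e : (Σ N : C.Sub X, C.Sub (C.sub N)) ≃ Σ K : C.Sub X, C.Sub (C.quo K),
    ∀ x, C.cls (C.sub (e x).1) = C.cls (C.sub x.2) ∧
      C.cls (C.sub (e x).2) = C.cls (C.quo x.2) ∧ C.cls (C.quo (e x).2) = C.cls (C.quo x.1)
  bot : ∀ X : C.Obj, ∃ N : C.Sub X, C.cls (C.quo N) = C.cls X ∧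
    ∀ N' : C.Sub X, C.cls (C.sub N') = C.cls C.zero ↔ N' = N
  top : ∀ X : C.Obj, ∃ N : C.Sub X, C.cls (C.sub N) = C.cls X ∧
    ∀ N' : C.Sub X, C.cls (C.quo N') = C.cls C.zero ↔ N' = N

namespace Laws

theorem finite_pi2 {p : C.Heck → C.Cls} (a b : C.Cls) :
    {x : C.Heck | p x = a ∧ pi2 x = b}.Finite := by
  refine (Set.finite_range fun N : C.Sub (C.rep b) => (⟨b, N⟩ : C.Heck)).subset ?_
  rintro ⟨E, N⟩ ⟨-, h⟩
  obtain rfl : E = b := h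
  exact ⟨N, rfl⟩

variable (hC : C.Laws)
include hC

theorem finite_pi1_piq (a b : C.Cls) : {x : C.Heck | pi1 x = a ∧ piq x = b}.Finite := by
  refine ((hC.finite_ext a b).biUnion fun E _ =>
    Set.finite_range fun N : C.Sub (C.rep E) => (⟨E, N⟩ : C.Heck)).subset ?_
  rintro ⟨E, N⟩ h
  simp only [Set.mem_iUnion]
  exact ⟨E, ⟨N, h⟩, N, rfl⟩

/-- The Hall product as a bilinear map. -/
def mul : C.Hall →ₗ[ℚ] C.Hall →ₗ[ℚ] C.Hall := corr pi1 piq pi2 hC.finite_pi1_piq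

theorem mul_apply_eq_push (f g : C.Hall) :
    ⇑(hC.mul f g) = push pi2 (pull pi1 f * pull piq g) := corr_apply _ _ f g

omit hC in
theorem push_pi2 (F : C.Heck → ℚ) (M : C.Cls) :
    push pi2 F M = ∑ᶠ N : C.Sub (C.rep M), F ⟨M, N⟩ := by
  refine (finsum_eq_of_bijective (fun N : C.Sub (C.rep M) =>
    (⟨⟨M, N⟩, rfl⟩ : pi2 ⁻¹' {M})) ⟨?_, ?_⟩ fun N => rfl).symm
  · intro N N' h
    exact eq_of_heq (Sigma.mk.inj (congrArg Subtype.val h)).2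
  · rintro ⟨⟨E, N⟩, h⟩
    obtain rfl : E = M := h
    exact ⟨N, rfl⟩

theorem mul_apply (f g : C.Hall) (M : C.Cls) : hC.mul f g M = C.hallProduct f g M := by
  rw [mul_apply_eq_push, push_pi2]
  rfl

/-- The Hall product is defined with the chosen representative of a class. Iterated products need
its value at a given subobject or quotient, and `transport` allows any representative. -/
theorem mul_apply_cls (f g : C.Hall) (X : C.Obj) :
    hC.mul f g (C.cls X) = ∑ᶠ N : C.Sub X, f (C.cls (C.sub N)) * g (C.cls (C.quo N)) := by
  rw [mul_apply, hallProduct]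
  obtain ⟨e, he⟩ := hC.transport (C.rep (C.cls X)) X (cls_rep _)
  exact finsum_eq_of_bijective e e.bijective fun N => by rw [(he N).1, (he N).2]

/-- Both sides are the sum of `f(K) g(N/K) h(X/N)` over flags `K ⊂ N ⊂ X`, indexed on the left by
`(N, K ⊂ N)` and on the right by `(K, N/K ⊂ X/K)`. -/
theorem mul_assoc (f g h : C.Hall) : hC.mul (hC.mul f g) h = hC.mul f (hC.mul g h) := by
  ext M
  rw [← cls_rep M, mul_apply_cls, mul_apply_cls]
  simp only [mul_apply_cls]
  obtain ⟨e, he⟩ := hC.chain (C.rep M)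
  let _ := fun B : C.Obj => Fintype.ofFinite (C.Sub B)
  simp only [finsum_eq_sum_of_fintype, Finset.sum_mul, Finset.mul_sum]
  rw [← Fintype.sum_sigma' (fun N (K : C.Sub (C.sub N)) => f (C.cls (C.sub K)) *
      g (C.cls (C.quo K)) * h (C.cls (C.quo N))),
    ← Fintype.sum_sigma' (fun K (L : C.Sub (C.quo K)) => f (C.cls (C.sub K)) *
      (g (C.cls (C.sub L)) * h (C.cls (C.quo L))))]
  refine Fintype.sum_equiv e _ _ fun x => ?_
  rw [(he x).1, (he x).2.1, (he x).2.2, _root_.mul_assoc]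

omit hC in
theorem one_apply (A : C.Cls) [Decidable (A = C.cls C.zero)] :
    C.one A = if A = C.cls C.zero then 1 else 0 := by
  classical
  rw [one, delta, Finsupp.single_apply]
  by_cases h : A = C.cls C.zero
  · simp [h]
  · simp [h, Ne.symm h]

theorem one_mul (f : C.Hall) : hC.mul C.one f = f := by
  classical
  ext M
  rw [← cls_rep M, mul_apply_cls]
  obtain ⟨N, h1, h2⟩ := hC.bot (C.rep M)
  rw [finsum_eq_single _ N]
  · rw [h1, one_apply, if_pos ((h2 N).2 rfl), _root_.one_mul]
  · intro N' h
    rw [one_apply, if_neg (fun h' => h ((h2 N').1 h')), zero_mul]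

theorem mul_one (f : C.Hall) : hC.mul f C.one = f := by
  classical
  ext M
  rw [← cls_rep M, mul_apply_cls]
  obtain ⟨N, h1, h2⟩ := hC.top (C.rep M)
  rw [finsum_eq_single _ N]
  · rw [h1, one_apply, if_pos ((h2 N).2 rfl), _root_.mul_one]
  · intro N' h
    rw [one_apply, if_neg (fun h' => h ((h2 N').1 h')), mul_zero]

/-- This is the expansion of `(f ⊗ 1 + 1 ⊗ f)(g ⊗ 1 + 1 ⊗ g)`, valid because subobjects and
quotients of a sum are taken summand by summand. -/
theorem mul_sum_apply {f g : C.Hall} (hf : f ∈ C.primitives) (hg : g ∈ C.primitives)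
    {M N B : C.Obj} (h : C.IsSum M N B) :
    hC.mul f g (C.cls B) = hC.mul f g (C.cls M) * C.one (C.cls N) +
      f (C.cls M) * g (C.cls N) + g (C.cls M) * f (C.cls N) +
      C.one (C.cls M) * hC.mul f g (C.cls N) := by
  obtain ⟨e, he⟩ := hC.sum M N B h
  -- A sum over pairs of subobjects factors. With units in suitable slots it yields each of the four
  -- terms of the expansion.
  have key : ∀ a b c d : C.Hall,
      ∑ᶠ x : C.Sub M × C.Sub N, (a (C.cls (C.sub x.1)) * b (C.cls (C.quo x.1))) *
        (c (C.cls (C.sub x.2)) * d (C.cls (C.quo x.2))) =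
      hC.mul a b (C.cls M) * hC.mul c d (C.cls N) := by
    intro a b c d
    let _ := fun B : C.Obj => Fintype.ofFinite (C.Sub B)
    rw [mul_apply_cls, mul_apply_cls]
    simp only [finsum_eq_sum_of_fintype]
    rw [Fintype.sum_prod_type, Fintype.sum_mul_sum]
  have h0 : hC.mul f g (C.cls B) = ∑ᶠ x : C.Sub M × C.Sub N,
      f (C.cls (C.sub (e x))) * g (C.cls (C.quo (e x))) := by
    rw [mul_apply_cls]
    exact (finsum_eq_of_bijective e e.bijective fun x => rfl).symm
  have h1 := key f g C.one C.one
  have h2 := key f C.one C.one g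
  have h3 := key C.one g f C.one
  have h4 := key C.one C.one f g
  simp only [one_mul, mul_one] at h1 h2 h3 h4
  rw [← h1, ← h2, ← h3, ← h4, h0, ← finsum_add_distrib (Set.toFinite _) (Set.toFinite _),
    ← finsum_add_distrib (Set.toFinite _) (Set.toFinite _),
    ← finsum_add_distrib (Set.toFinite _) (Set.toFinite _)]
  refine finsum_congr fun x => ?_
  rw [hf _ _ _ (he x).1, hg _ _ _ (he x).2]
  ring

/-- The mixed terms `f ⊗ g + g ⊗ f` are symmetric in `f` and `g`, so they cancel. -/
theorem commutator_mem {f g : C.Hall} (hf : f ∈ C.primitives) (hg : g ∈ C.primitives) :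
    hC.mul f g - hC.mul g f ∈ C.primitives := by
  intro M N B h
  simp only [Finsupp.sub_apply]
  rw [hC.mul_sum_apply hf hg h, hC.mul_sum_apply hg hf h]
  ring

/-! ### The Hecke convolutions -/

omit hC in
variable (C) in
/-- The convolution `π_q⁎ (π₁^* f · π₂^* g)`. -/
def convQuo : C.Hall →ₗ[ℚ] C.Hall →ₗ[ℚ] C.Hall := corr pi1 pi2 piq finite_pi2

omit hC in
variable (C) in
/-- The convolution `π₁⁎ (π_q^* f · π₂^* g)`. -/
def convSub : C.Hall →ₗ[ℚ] C.Hall →ₗ[ℚ] C.Hall := corr piq pi2 pi1 finite_pi2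

/-- Both sides are the sum of `f(A) g(B) h(B/A)` over the Hecke correspondence. -/
theorem kappa_convQuo (f g h : C.Hall) :
    C.kappa (convQuo C f g) h = C.kappa g (hC.mul f h) := by
  rw [kappa_comm g, convQuo, mul, kappa_corr, kappa_corr]
  exact finsum_congr fun x => by ring

theorem kappa_convSub (f g h : C.Hall) :
    C.kappa (convSub C f g) h = C.kappa g (hC.mul h f) := by
  rw [kappa_comm g, convSub, mul, kappa_corr, kappa_corr]
  exact finsum_congr fun x => by ring

omit hC in
theorem corr_delta {X : Type v} {p q r : X → C.Cls}
    (hF : ∀ a b, {x | p x = a ∧ q x = b}.Finite) (A B : C.Cls) :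
    corr p q r hF (C.delta A) (C.delta B) = ∑ x ∈ (hF A B).toFinset, C.delta (r x) := by
  simp [corr, delta]

omit hC in
theorem corr_pi2_delta {p r : C.Heck → C.Cls} (A B : C.Cls) :
    corr p pi2 r finite_pi2 (C.delta A) (C.delta B) =
      ∑ᶠ N : {N : C.Sub (C.rep B) // p ⟨B, N⟩ = A}, C.delta (r ⟨B, N.1⟩) := by
  rw [corr_delta, ← finsum_mem_coe_finset, ← finsum_set_coe_eq_finsum_mem
    (↑(finite_pi2 (p := p) A B).toFinset) (f := fun x => C.delta (r x))]
  refine (finsum_eq_of_bijective (fun N : {N : C.Sub (C.rep B) // p ⟨B, N⟩ = A} =>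
    (⟨⟨B, N.1⟩, by simpa using ⟨N.2, rfl⟩⟩ : (↑(finite_pi2 (p := p) A B).toFinset : Set C.Heck)))
    ⟨?_, ?_⟩ fun N => rfl).symm
  · intro N N' h
    exact Subtype.ext (eq_of_heq (Sigma.mk.inj (congrArg Subtype.val h)).2)
  · rintro ⟨⟨E, N⟩, h⟩
    have h' : p ⟨E, N⟩ = A ∧ E = B :=
      (Set.Finite.mem_toFinset (finite_pi2 (p := p) A B)).1 h
    obtain ⟨h1, rfl⟩ := h'
    exact ⟨⟨N, h1⟩, rfl⟩

theorem mul_delta_apply (A B E : C.Cls) : hC.mul (C.delta A) (C.delta B) E =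
    (Nat.card {N : C.Sub (C.rep E) // C.cls (C.sub N) = A ∧ C.cls (C.quo N) = B} : ℚ) := by
  classical
  let _ := Fintype.ofFinite (C.Sub (C.rep E))
  rw [mul_apply, hallProduct, finsum_eq_sum_of_fintype, Nat.card_eq_fintype_card,
    Fintype.card_subtype, Finset.card_filter]
  push_cast
  refine Finset.sum_congr rfl fun N _ => ?_
  rw [delta, delta, Finsupp.single_apply, Finsupp.single_apply]
  simp only [@eq_comm _ (C.cls (C.sub N)), @eq_comm _ (C.cls (C.quo N))]
  by_cases h : A = C.cls (C.sub N) <;> by_cases h' : B = C.cls (C.quo N) <;> simp [h, h']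

/-- Taking adjoints reverses composition, so left multiplication turns into a right action. -/
theorem isRightAction_convQuo : IsRightAction hC.mul (convQuo C).flip := by
  refine ⟨fun x => kappa_ext fun a => ?_, fun f g x => kappa_ext fun a => ?_⟩
  · rw [LinearMap.flip_apply, hC.kappa_convQuo, hC.one_mul]
  · simp only [LinearMap.flip_apply]
    rw [hC.kappa_convQuo, hC.kappa_convQuo, hC.kappa_convQuo, hC.mul_assoc]

theorem isLeftAction_convSub : IsLeftAction hC.mul (convSub C) := by
  refine ⟨fun x => kappa_ext fun a => ?_, fun f g x => kappa_ext fun a => ?_⟩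
  · rw [hC.kappa_convSub, hC.mul_one]
  · rw [hC.kappa_convSub, hC.kappa_convSub, hC.kappa_convSub, hC.mul_assoc]

/-! ### Truncation -/

/-- A subobject of a subobject is a subobject: `chain` provides it inside `M`, once `N` has been
transported from the chosen representative to an actual subobject of `M`. -/
theorem sub_mem_leSet {M E : C.Cls} (hE : E ∈ C.leSet M) (N : C.Sub (C.rep E)) :
    C.cls (C.sub N) ∈ C.leSet M := by
  obtain ⟨K, rfl⟩ := hE
  obtain ⟨e, he⟩ := hC.transport (C.rep (C.cls (C.sub K))) (C.sub K) (cls_rep _)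
  obtain ⟨e', he'⟩ := hC.chain (C.rep M)
  exact ⟨(e' ⟨K, e N⟩).1, by rw [(he' ⟨K, e N⟩).1, (he N).1]⟩

omit hC in
theorem finite_leSet (M : C.Cls) : (C.leSet M).Finite :=
  Set.finite_range fun N : C.Sub (C.rep M) => C.cls (C.sub N)

omit hC in
theorem finiteDimensional_hallLe (M : C.Cls) : FiniteDimensional ℚ (C.HallLe M) := by
  have := (finite_leSet M).to_subtype
  exact Module.Finite.equiv (Finsupp.supportedEquivFinsupp (C.leSet M)).symm

omit hC in
theorem map_kappa_hallLe (M : C.Cls) : (C.HallLe M).map C.kappa = C.dualLe M := by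
  rw [HallLe, Finsupp.supported_eq_span_single, Submodule.map_span, dualLe, Set.image_image]
  simp [kappa]

omit hC in
theorem kappaLe_apply (M : C.Cls) (f g : C.HallLe M) : C.kappaLe M f g = C.kappa f.1 g.1 := rfl

omit hC in
theorem kappaLe_bijective (M : C.Cls) : Function.Bijective (C.kappaLe M) := by
  have := finiteDimensional_hallLe M
  have hinj : Function.Injective (C.kappaLe M) := by
    rw [injective_iff_map_eq_zero]
    intro f hf
    ext a
    by_cases ha : a ∈ C.leSet M
    · have h := LinearMap.congr_fun hf ⟨Finsupp.single a 1, Finsupp.single_mem_supported ℚ 1 ha⟩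
      rw [kappaLe_apply, kappa_apply_single] at h
      simpa using h
    · exact (Finsupp.mem_supported' ℚ _).1 f.2 a ha
  exact ⟨hinj, (LinearMap.injective_iff_surjective_of_finrank_eq_finrank
    Subspace.dual_finrank_eq.symm).1 hinj⟩

/-- A nonzero term at `A` needs some `E ⊃ A` with `g(E) ≠ 0`; then `E`, and with it `A`, is a
subobject of `M`. -/
theorem convSub_mem (M : C.Cls) (f : C.Hall) {g : C.Hall} (hg : g ∈ C.HallLe M) :
    convSub C f g ∈ C.HallLe M := by
  rw [HallLe, Finsupp.mem_supported'] at hg ⊢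
  intro A hA
  rw [convSub, corr_apply, push]
  refine finsum_eq_zero_of_forall_eq_zero ?_
  rintro ⟨⟨E, N⟩, hx⟩
  have hx' : C.cls (C.sub N) = A := hx
  have : g E = 0 := hg E fun hE => hA (hx' ▸ hC.sub_mem_leSet hE N)
  exact mul_eq_zero_of_right _ this

/-- The action `⋆` on `H_{≤ M}`. -/
def star (M : C.Cls) : C.Hall →ₗ[ℚ] C.HallLe M →ₗ[ℚ] C.HallLe M :=
  LinearMap.mk₂ ℚ (fun f g => ⟨convSub C f g.1, hC.convSub_mem M f g.2⟩)
    (fun f f' g => Subtype.ext (by simp)) (fun c f g => Subtype.ext (by simp))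
    (fun f g g' => Subtype.ext (by simp)) (fun c f g => Subtype.ext (by simp))

theorem star_coe (M : C.Cls) (f : C.Hall) (g : C.HallLe M) :
    (hC.star M f g).1 = convSub C f g.1 := rfl

omit hC in
variable (C) in
/-- The projection of `H_C` to the functions supported on subobjects of `M`. -/
def truncate (M : C.Cls) : C.Hall →ₗ[ℚ] C.HallLe M := by
  classical exact Finsupp.restrictDom ℚ ℚ (C.leSet M)

omit hC in
theorem truncate_apply (M : C.Cls) (f : C.Hall) (E : C.Cls) [Decidable (E ∈ C.leSet M)] :
    (truncate C M f).1 E = if E ∈ C.leSet M then f E else 0 := by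
  classical
  refine (DFunLike.congr_fun (Finsupp.restrictDom_apply (C.leSet M) f) E).trans ?_
  rw [Finsupp.filter_apply]
  congr

/-- The action `□` on `H_{≤ M}`. -/
def box (M : C.Cls) : C.HallLe M →ₗ[ℚ] C.Hall →ₗ[ℚ] C.HallLe M :=
  (hC.mul.domRestrict (C.HallLe M)).compr₂ (truncate C M)

theorem box_eq (M : C.Cls) (g : C.HallLe M) (f : C.Hall) :
    hC.box M g f = truncate C M (hC.mul g.1 f) := rfl

/-- On subobjects of `M` the product sees only the values of its left factor there. Truncating after
every multiplication therefore loses nothing, and `box` is an action. -/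
theorem mul_congr_of_leSet {M : C.Cls} {f f' : C.Hall} (h : ∀ E ∈ C.leSet M, f E = f' E)
    (g : C.Hall) {E : C.Cls} (hE : E ∈ C.leSet M) : hC.mul f g E = hC.mul f' g E := by
  rw [mul_apply, mul_apply, hallProduct, hallProduct]
  exact finsum_congr fun N => by rw [h _ (hC.sub_mem_leSet hE N)]

theorem isLeftAction_star (M : C.Cls) : IsLeftAction hC.mul (hC.star M) := by
  refine ⟨fun x => Subtype.ext ?_, fun f g x => Subtype.ext ?_⟩
  · exact hC.isLeftAction_convSub.1 x.1
  · exact hC.isLeftAction_convSub.2 f g x.1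

omit hC in
theorem hallLe_ext {M : C.Cls} {f g : C.HallLe M} (h : ∀ E ∈ C.leSet M, f.1 E = g.1 E) :
    f = g := by
  ext E
  by_cases hE : E ∈ C.leSet M
  · exact h E hE
  · rw [(Finsupp.mem_supported' ℚ _).1 f.2 E hE, (Finsupp.mem_supported' ℚ _).1 g.2 E hE]

theorem isRightAction_box (M : C.Cls) : IsRightAction hC.mul (hC.box M) := by
  classical
  refine ⟨fun x => hallLe_ext fun E hE => ?_, fun f g x => hallLe_ext fun E hE => ?_⟩
  · rw [box_eq, truncate_apply, if_pos hE, hC.mul_one]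
  · rw [box_eq, box_eq, truncate_apply, truncate_apply, if_pos hE, if_pos hE, ← hC.mul_assoc]
    refine hC.mul_congr_of_leSet (fun E' hE' => ?_) g hE
    rw [box_eq, truncate_apply, if_pos hE']

omit hC in
theorem finite_support_heckLe {M : C.Cls} {F : C.Heck → ℚ} (hF : F.support.Finite) :
    (Function.support fun x : C.HeckLe M => F x.1).Finite :=
  hF.preimage (f := Subtype.val) Subtype.val_injective.injOn

omit hC in
-- The truncated integral agrees with the full one when the integrand vanishes on the discarded part
-- of the fibre. For `⋆` this comes from the support of `g`, for `□` from the fibre lying over a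
-- subobject of `M`.
theorem push_heckLe {M : C.Cls} (p : C.Heck → C.Cls) (F : C.Heck → ℚ) (A : C.Cls)
    (h : ∀ x, p x = A → F x ≠ 0 → pi2 x ∈ C.leSet M) :
    push (fun x : C.HeckLe M => p x.1) (fun x => F x.1) A = push p F A := by
  have h1 : ∀ G : C.Heck → ℚ, (∀ x, G x ≠ 0 → pi2 x ∈ C.leSet M) →
      ∑ᶠ x : C.HeckLe M, G x.1 = ∑ᶠ x, G x := by
    intro G hG
    refine (finsum_set_coe_eq_finsum_mem {x : C.Heck | pi2 x ∈ C.leSet M}).trans ?_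
    rw [finsum_mem_def,
      Set.indicator_eq_self (s := {x : C.Heck | pi2 x ∈ C.leSet M}).2 fun x hx => hG x hx]
  have h2 : ∀ (Y : Type (u + 1)) (q : Y → C.Cls) (G : Y → ℚ),
      push q G A = ∑ᶠ x, (q ⁻¹' {A}).indicator G x := by
    intro Y q G
    rw [push, finsum_set_coe_eq_finsum_mem (q ⁻¹' {A}) (f := G), finsum_mem_def]
  rw [h2, h2, ← h1]
  · rfl
  · intro x hx
    have := Set.mem_of_indicator_ne_zero hx
    exact h x this (by rwa [Set.indicator_of_mem this] at hx)

theorem star_eq_push (M : C.Cls) (f : C.Hall) (g : C.HallLe M) :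
    ⇑(hC.star M f g).1 = push (fun x : C.HeckLe M => pi1 x.1)
      (pull (fun x : C.HeckLe M => piq x.1) f * pull (fun x : C.HeckLe M => pi2 x.1) g.1) := by
  ext A
  rw [star_coe, convSub, corr_apply]
  refine (push_heckLe pi1 (pull piq f * pull pi2 g.1) A ?_).symm
  intro x _ hx
  by_contra h
  refine hx ?_
  exact mul_eq_zero_of_right _ ((Finsupp.mem_supported' ℚ _).1 g.2 _ h)

theorem box_eq_push (M : C.Cls) (g : C.HallLe M) (f : C.Hall) :
    ⇑(hC.box M g f).1 = push (fun x : C.HeckLe M => pi2 x.1)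
      (pull (fun x : C.HeckLe M => piq x.1) f * pull (fun x : C.HeckLe M => pi1 x.1) g.1) := by
  classical
  ext E
  rw [box_eq, truncate_apply]
  split_ifs with hE
  · rw [mul_apply_eq_push, mul_comm (pull pi1 _)]
    refine (push_heckLe pi2 (pull piq f * pull pi1 g.1) E ?_).symm
    rintro x rfl _
    exact hE
  · refine (finsum_eq_zero_of_forall_eq_zero ?_).symm
    rintro ⟨x, hx⟩
    exact absurd (hx ▸ x.2) hE

/-- Pairing with a function supported on subobjects of `M` ignores the truncation; what remains is
the adjunction `kappa_convSub`. -/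
theorem kappaLe_box (M : C.Cls) (X : C.Hall) (g : C.HallLe M) :
    C.kappaLe M (hC.box M g (-X)) = -(C.kappaLe M g ∘ₗ hC.star M X) := by
  classical
  ext v
  have htr : ∀ f : C.Hall, C.kappa (truncate C M f).1 v.1 = C.kappa v.1 f := by
    intro f
    rw [kappa_comm, kappa, Finsupp.linearCombination_apply, Finsupp.sum, LinearMap.sum_apply,
      LinearMap.sum_apply]
    refine Finset.sum_congr rfl fun E hE => ?_
    have hE' : E ∈ C.leSet M := by
      by_contra h
      exact (Finsupp.mem_support_iff.1 hE) ((Finsupp.mem_supported' ℚ _).1 v.2 E h)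
    simp [phi, truncate_apply, hE']
  rw [LinearMap.neg_apply, LinearMap.comp_apply, kappaLe_apply, kappaLe_apply, box_eq, htr,
    kappa_comm g.1, star_coe, hC.kappa_convSub, map_neg, map_neg]

end Laws

end HallData

/-- The bijections between sets of subobjects below are mostly obtained in this way: both sides are
encoded injectively in a common type, and the images are compared. -/
theorem exists_equiv_of_range_eq {A B Z : Type*} {φ : A → Z} {ψ : B → Z}
    (hφ : Function.Injective φ) (hψ : Function.Injective ψ) (h : Set.range φ = Set.range ψ) :
    ∃ e : A ≃ B, ∀ x, ψ (e x) = φ x := by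
  refine ⟨(Equiv.ofInjective φ hφ).trans ((Equiv.setCongr h).trans (Equiv.ofInjective ψ hψ).symm),
    fun x => ?_⟩
  exact congrArg Subtype.val ((Equiv.ofInjective ψ hψ).apply_symm_apply
    (Equiv.setCongr h (Equiv.ofInjective φ hφ x)))

/-! ### The category of rooted forests -/

namespace Forest

variable {S : Type u}

/-- Sets of vertices that contain the children of their elements. -/
def IsLower (F : Forest S) (D : Set F.V) : Prop :=
  ∀ v w, F.parent v = some w → w ∈ D → v ∈ D

theorem not_anc_parent (F : Forest S) {v w : F.V} (h : F.parent v = some w) : ¬ F.Anc v w := by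
  intro hvw
  have hT : Relation.TransGen (fun a b => F.parent b = some a) v v :=
    Relation.TransGen.tail' hvw h
  exact (WellFounded.transGen F.wf).irrefl.irrefl v hT

theorem Cut.isLower_below {F : Forest S} (c : F.Cut) : F.IsLower c.below := by
  rintro v w h ⟨a, ha, haw⟩
  exact ⟨a, ha, haw.tail h⟩

/-- The cut can be recovered from the severed vertices: it consists of those nearest to the root.
Hence `below_injective`. -/
theorem Cut.mem_iff {F : Forest S} (c : F.Cut) (v : F.V) :
    v ∈ c.1 ↔ v ∈ c.below ∧ ∀ w, F.parent v = some w → w ∉ c.below := by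
  constructor
  · intro hv
    refine ⟨⟨v, hv, .refl⟩, ?_⟩
    rintro w hw ⟨a, ha, haw⟩
    obtain rfl := c.2 a ha v hv (haw.tail hw)
    exact F.not_anc_parent hw haw
  · rintro ⟨⟨a, ha, hav⟩, h⟩
    rcases hav.cases_tail with rfl | ⟨w, haw, hw⟩
    · exact ha
    · exact absurd ⟨a, ha, haw⟩ (h w hw)

theorem Cut.below_injective (F : Forest S) : Function.Injective (Cut.below (F := F)) := by
  intro c d h
  refine Subtype.ext (Set.ext fun v => ?_)
  rw [c.mem_iff, d.mem_iff, h]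

/-- A set closed under children is severed by the cut at its topmost vertices, those whose parent is
missing or lies outside the set. No two of them lie on one path to a root, since below the upper one
all parents are in the set. -/
theorem range_below (F : Forest S) : Set.range (Cut.below (F := F)) = {D | F.IsLower D} := by
  ext D
  refine ⟨?_, fun hD => ?_⟩
  · rintro ⟨c, rfl⟩
    exact c.isLower_below
  have hanc : ∀ {a v}, F.Anc a v → a ∈ D → v ∈ D := by
    intro a v h ha
    induction h with
    | refl => exact ha
    | tail _ h ih => exact hD _ _ h ih
  refine ⟨⟨{v | v ∈ D ∧ ∀ w, F.parent v = some w → w ∉ D}, ?_⟩, ?_⟩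
  · rintro a ⟨ha, -⟩ b ⟨-, hb⟩ hab
    rcases hab.cases_tail with rfl | ⟨w, haw, hw⟩
    · rfl
    · exact absurd (hanc haw ha) (hb w hw)
  · ext v
    constructor
    · rintro ⟨a, ha, hav⟩
      exact hanc hav ha.1
    · intro hv
      -- Climb from `v` towards the root until the parent leaves `D`; well-foundedness ends the
      -- climb.
      induction v using F.wf.induction with
      | _ v ih =>
        by_cases h : ∃ w, F.parent v = some w ∧ w ∈ D
        · obtain ⟨w, hw, hwD⟩ := h
          obtain ⟨a, ha, haw⟩ := ih w hw hwD
          exact ⟨a, ha, haw.tail hw⟩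
        · exact ⟨v, ⟨hv, fun w hw hwD => h ⟨w, hw, hwD⟩⟩, .refl⟩

/-! ### Induced forests, isomorphisms and sums. -/

theorem restrict_parent_eq_some (F : Forest S) {U : Set F.V} {x y : U} :
    (F.restrict U).parent x = some y ↔ F.parent x.1 = some y.1 := by
  simp only [restrict, Option.bind_eq_some_iff]
  constructor
  · rintro ⟨w, hw, h⟩
    split_ifs at h with hU
    cases h
    exact hw
  · intro h
    exact ⟨y.1, h, by simp⟩

theorem iso_of_rel {F G : Forest S} (e : F.V ≃ G.V)
    (h : ∀ v w, G.parent (e v) = some (e w) ↔ F.parent v = some w) : F.Iso G := by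
  refine ⟨e, fun v => Option.ext fun y => ?_⟩
  obtain ⟨w, rfl⟩ := e.surjective y
  rw [h]
  simp

/-- A relational form in which the two summands and the two ends of an edge play symmetric roles. -/
theorem isSum_iff {M N B : Forest S} : IsSum M N B ↔ ∃ e : M.V ⊕ N.V ≃ B.V, ∀ x y,
    B.parent (e x) = some (e y) ↔
      Sum.LiftRel (fun v w => M.parent v = some w) (fun v w => N.parent v = some w) x y := by
  constructor
  · rintro ⟨e, h1, h2⟩
    refine ⟨e, ?_⟩
    rintro (v | v) y
    · rw [h1]
      rcases y with w | w <;> simp [Option.map_eq_some_iff]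
    · rw [h2]
      rcases y with w | w <;> simp [Option.map_eq_some_iff]
  · rintro ⟨e, h⟩
    refine ⟨e, fun v => Option.ext fun y => ?_, fun v => Option.ext fun y => ?_⟩ <;>
    · obtain ⟨y, rfl⟩ := e.surjective y
      rw [h]
      rcases y with w | w <;> simp [Option.map_eq_some_iff]

theorem restrict_restrict_iso (F : Forest S) (U : Set F.V) (U' : Set U) {D : Set F.V}
    (hD : ∀ v, v ∈ D ↔ ∃ h : v ∈ U, ⟨v, h⟩ ∈ U') :
    ((F.restrict U).restrict U').Iso (F.restrict D) := by
  refine iso_of_rel (F := (F.restrict U).restrict U') (G := F.restrict D)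
    ⟨fun x => ⟨x.1.1, (hD _).2 ⟨x.1.2, x.2⟩⟩,
      fun x => ⟨⟨x.1, ((hD _).1 x.2).1⟩, ((hD _).1 x.2).2⟩, fun _ => rfl, fun _ => rfl⟩ ?_
  intro v w
  exact (F.restrict_parent_eq_some).trans
    (((F.restrict U).restrict_parent_eq_some).trans F.restrict_parent_eq_some).symm

theorem restrict_iso {F G : Forest S} (e : F.V ≃ G.V)
    (he : ∀ v, G.parent (e v) = (F.parent v).map e) {U : Set F.V} {U' : Set G.V}
    (h : ∀ v, v ∈ U ↔ e v ∈ U') : (F.restrict U).Iso (G.restrict U') := by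
  refine iso_of_rel (F := F.restrict U) (G := G.restrict U') (e.subtypeEquiv h) fun v w => ?_
  refine (G.restrict_parent_eq_some).trans (Iff.trans ?_ F.restrict_parent_eq_some.symm)
  change G.parent (e v.1) = some (e w.1) ↔ _
  simp [he]

theorem iso_univ (F : Forest S) {U : Set F.V} (h : ∀ v, v ∈ U) : (F.restrict U).Iso F :=
  iso_of_rel (F := F.restrict U) (Equiv.subtypeUnivEquiv h) fun _ _ =>
    F.restrict_parent_eq_some.symm

theorem iso_empty_iff (F : Forest S) : F.Iso (empty S) ↔ IsEmpty F.V := by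
  constructor
  · rintro ⟨e, -⟩
    exact ⟨fun v => (e v).elim⟩
  · intro h
    exact ⟨Equiv.equivOfIsEmpty F.V PEmpty, fun v => h.elim v⟩

theorem restrict_isSum {M N B : Forest S} {e : M.V ⊕ N.V ≃ B.V}
    (he : ∀ x y, B.parent (e x) = some (e y) ↔
      Sum.LiftRel (fun v w => M.parent v = some w) (fun v w => N.parent v = some w) x y)
    {U : Set M.V} {U' : Set N.V} {D : Set B.V} (h1 : ∀ v, e (.inl v) ∈ D ↔ v ∈ U)
    (h2 : ∀ v, e (.inr v) ∈ D ↔ v ∈ U') :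
    IsSum (M.restrict U) (N.restrict U') (B.restrict D) := by
  have e1 : ∃ e1 : U ⊕ U' ≃ {x // e x ∈ D}, (∀ x, (e1 (.inl x)).1 = .inl x.1) ∧
      ∀ x, (e1 (.inr x)).1 = .inr x.1 := ⟨ ((Equiv.subtypeEquivRight fun v => (h1 v).symm).sumCongr
    (Equiv.subtypeEquivRight fun v => (h2 v).symm)).trans
      (Equiv.subtypeSum (p := fun x => e x ∈ D)).symm, fun _ => rfl, fun _ => rfl⟩
  obtain ⟨e1, h3, h4⟩ := e1
  refine isSum_iff.2 ⟨e1.trans (e.subtypeEquiv (q := (· ∈ D)) fun _ => Iff.rfl), ?_⟩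
  rintro (x | x) (y | y) <;>
  · refine B.restrict_parent_eq_some.trans ((he _ _).trans ?_)
    first | erw [h3 x] | erw [h4 x]
    first | erw [h3 y] | erw [h4 y]
    simp only [Sum.liftRel_inl_inl, Sum.liftRel_inr_inr, Sum.not_liftRel_inl_inr,
      Sum.not_liftRel_inr_inl]
    try exact (restrict_parent_eq_some _).symm

theorem cls_eq_iff {F G : Forest S} :
    (forestData S).cls F = (forestData S).cls G ↔ F.Iso G := HallData.cls_eq

/-- Isomorphism ignores labels, so the parent function transported to `Fin n` determines the class.
-/
theorem finite_card_eq (n : ℕ) :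
    {E : (forestData S).Cls | Nat.card ((forestData S).rep E : Forest S).V = n}.Finite := by
  have hex : ∀ F : {F : Forest S // Nat.card F.V = n}, Nonempty (F.1.V ≃ Fin n) := fun F =>
    haveI := F.1.fin
    ⟨Finite.equivFinOfCardEq F.2⟩
  let e := fun F => (hex F).some
  let code : {F : Forest S // Nat.card F.V = n} → Fin n → Option (Fin n) :=
    fun F i => (F.1.parent ((e F).symm i)).map (e F)
  have hcode : ∀ F G, code F = code G → F.1.Iso G.1 := by
    intro F G h
    refine ⟨(e F).trans (e G).symm, fun v => ?_⟩
    have h' := congrFun h (e F v)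
    simp only [code, Equiv.symm_apply_apply] at h'
    apply Option.map_injective (e G).injective
    rw [Equiv.trans_apply, ← h', Option.map_map]
    congr 1
    ext w
    simp
  refine Set.finite_coe_iff.1 (Finite.of_injective (fun E => code ⟨_, E.2⟩) fun E E' h => ?_)
  have := cls_eq_iff.2 (hcode _ _ h)
  exact Subtype.ext (by simpa using this)

theorem Cut.card_add {F : Forest S} (c : F.Cut) :
    Nat.card c.P.V + Nat.card c.R.V = Nat.card F.V := by
  have := F.fin
  exact Set.ncard_add_ncard_compl c.below

/-! ### Bijections between sets of cuts. -/

theorem exists_isLower {F : Forest S} {D : Set F.V} (hD : F.IsLower D) :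
    ∃ c : F.Cut, c.below = D := by
  rwa [← Set.mem_range, range_below]

theorem exists_equiv_of_iso {F G : Forest S} (h : F.Iso G) :
    ∃ e : F.Cut ≃ G.Cut, ∀ N, (e N).P.Iso N.P ∧ (e N).R.Iso N.R := by
  obtain ⟨e, he⟩ := h
  have hlow : ∀ D : Set G.V, G.IsLower D ↔ F.IsLower (e ⁻¹' D) := by
    intro D
    refine ⟨fun h v w hvw hw => h (e v) (e w) (by simp [he, hvw]) hw, fun h v w hvw hw => ?_⟩
    have := h (e.symm v) (e.symm w) (by
      have := he (e.symm v)
      rw [Equiv.apply_symm_apply, hvw] at this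
      obtain ⟨x, hx, rfl⟩ := Option.map_eq_some_iff.1 this.symm
      simpa using hx) (by simpa using hw)
    simpa using this
  obtain ⟨e', he'⟩ := exists_equiv_of_range_eq (φ := Cut.below (F := F))
    (ψ := fun c : G.Cut => e ⁻¹' c.below) (Cut.below_injective F)
    ((e.surjective.preimage_injective).comp (Cut.below_injective G)) (by
      rw [range_below]
      ext D
      constructor
      · intro hD
        have : e '' D ∈ Set.range (Cut.below (F := G)) := by
          rw [range_below, Set.mem_ofPred_eq, hlow]
          simpa using hD
        obtain ⟨c, hc⟩ := this
        exact ⟨c, by simp [hc]⟩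
      · rintro ⟨c, rfl⟩
        exact (hlow _).1 c.isLower_below)
  refine ⟨e', fun N => ⟨?_, ?_⟩⟩
  · refine iso_equivalence.symm (restrict_iso e he fun v => ?_)
    rw [← he' N]; rfl
  · refine iso_equivalence.symm (restrict_iso e he fun v => ?_)
    rw [← he' N]; rfl
theorem exists_equiv_of_isSum {M N B : Forest S} (h : IsSum M N B) :
    ∃ e : M.Cut × N.Cut ≃ B.Cut, ∀ x,
      IsSum x.1.P x.2.P (e x).P ∧ IsSum x.1.R x.2.R (e x).R := by
  obtain ⟨e, he⟩ := isSum_iff.1 h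
  have hlow : ∀ D : Set B.V, B.IsLower D ↔ M.IsLower {v | e (.inl v) ∈ D} ∧
      N.IsLower {v | e (.inr v) ∈ D} := by
    intro D
    refine ⟨fun h => ⟨fun v w hvw hw => h _ (e (.inl w)) ((he _ _).2 (.inl hvw)) hw,
      fun v w hvw hw => h _ (e (.inr w)) ((he _ _).2 (.inr hvw)) hw⟩, ?_⟩
    rintro ⟨h1, h2⟩ v w hvw hw
    obtain ⟨v, rfl⟩ := e.surjective v
    obtain ⟨w, rfl⟩ := e.surjective w
    rcases (he _ _).1 hvw with h | h
    · exact h1 _ _ h hw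
    · exact h2 _ _ h hw
  obtain ⟨e', he'⟩ := exists_equiv_of_range_eq
    (φ := fun x : M.Cut × N.Cut => (x.1.below, x.2.below))
    (ψ := fun c : B.Cut => ({v | e (.inl v) ∈ c.below}, {v | e (.inr v) ∈ c.below})) (by
      intro x y h
      exact Prod.ext (Cut.below_injective _ (congrArg Prod.fst h))
        (Cut.below_injective _ (congrArg Prod.snd h))) (by
      intro c d h
      refine Cut.below_injective _ (Set.ext fun v => ?_)
      obtain ⟨v | v, rfl⟩ := e.surjective v
      · exact Set.ext_iff.1 (congrArg Prod.fst h) v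
      · exact Set.ext_iff.1 (congrArg Prod.snd h) v) (by
      ext ⟨D, D'⟩
      constructor
      · rintro ⟨⟨c, c'⟩, h⟩
        obtain ⟨rfl, rfl⟩ := Prod.mk.inj h
        have : {v | Sum.elim (· ∈ c.below) (· ∈ c'.below) (e.symm v)} ∈
            Set.range (Cut.below (F := B)) := by
          rw [range_below, Set.mem_ofPred_eq, hlow]
          simpa using ⟨c.isLower_below, c'.isLower_below⟩
        obtain ⟨d, hd⟩ := this
        exact ⟨d, by simp [hd]⟩
      · rintro ⟨c, h⟩
        obtain ⟨rfl, rfl⟩ := Prod.mk.inj h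
        obtain ⟨h1, h2⟩ := (hlow _).1 c.isLower_below
        obtain ⟨d, hd⟩ := exists_isLower h1
        obtain ⟨d', hd'⟩ := exists_isLower h2
        exact ⟨(d, d'), Prod.ext hd hd'⟩)
  refine ⟨e', fun x => ⟨restrict_isSum he (fun v => ?_) (fun v => ?_),
    restrict_isSum he (fun v => not_congr ?_) (fun v => not_congr ?_)⟩⟩
  · exact Set.ext_iff.1 (congrArg Prod.fst (he' x)) v
  · exact Set.ext_iff.1 (congrArg Prod.snd (he' x)) v
  · exact Set.ext_iff.1 (congrArg Prod.fst (he' x)) v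
  · exact Set.ext_iff.1 (congrArg Prod.snd (he' x)) v
-- Both kinds of flags are pairs `D' ⊂ D` of sets closed under children: `D` is severed by `N`, and
-- `D'` by the inner cut of `P`, equivalently by `K`.
theorem exists_equiv_chain (F : Forest S) :
    ∃ e : (Σ N : F.Cut, N.P.Cut) ≃ Σ K : F.Cut, K.R.Cut, ∀ x,
      (e x).1.P.Iso x.2.P ∧ (e x).2.P.Iso x.2.R ∧ (e x).2.R.Iso x.1.R := by
  have hsub : ∀ (U : Set F.V) (D : Set U), (F.restrict U).IsLower D ↔
      ∀ v w, F.parent v = some w → v ∈ U → w ∈ Subtype.val '' D → v ∈ Subtype.val '' D := by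
    intro U D
    constructor
    · rintro h v w hvw hv ⟨w, hw, rfl⟩
      exact ⟨⟨v, hv⟩, h _ _ (F.restrict_parent_eq_some.2 hvw) hw, rfl⟩
    · rintro h v w hvw hw
      obtain ⟨x, hx, hx'⟩ := h v.1 w.1 (F.restrict_parent_eq_some.1 hvw) v.2 ⟨w, hw, rfl⟩
      rwa [← Subtype.ext hx']
  obtain ⟨e, he⟩ := exists_equiv_of_range_eq
    (φ := fun x : Σ N : F.Cut, N.P.Cut => (x.1.below, Subtype.val '' x.2.below))
    (ψ := fun x : Σ K : F.Cut, K.R.Cut =>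
      (x.1.below ∪ Subtype.val '' x.2.below, x.1.below)) (by
      rintro ⟨N, K⟩ ⟨N', K'⟩ h
      obtain ⟨h1, h2⟩ := Prod.mk.inj h
      obtain rfl := Cut.below_injective _ h1
      obtain rfl := Cut.below_injective _ (Subtype.val_injective.image_injective h2)
      rfl) (by
      rintro ⟨N, K⟩ ⟨N', K'⟩ h
      obtain ⟨h1, h2⟩ := Prod.mk.inj h
      obtain rfl := Cut.below_injective _ h2
      have hd : ∀ L : N.R.Cut, Disjoint N.below (Subtype.val '' L.below) := by
        intro L
        rw [Set.disjoint_right]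
        rintro _ ⟨x, -, rfl⟩
        exact x.2
      -- The second cut lives in the complement of the first, so the union determines it.
      have h3 : Subtype.val '' K.below = Subtype.val '' K'.below := by
        have := congrArg (· \ N.below) h1
        simpa [Set.union_sdiff_left, (hd K).sdiff_eq_right, (hd K').sdiff_eq_right] using this
      obtain rfl := Cut.below_injective _ (Subtype.val_injective.image_injective h3)
      rfl) (by
      ext ⟨D, D'⟩
      constructor
      · rintro ⟨⟨N, K⟩, h⟩
        obtain ⟨rfl, rfl⟩ := Prod.mk.inj h
        have hK := (hsub _ _).1 K.isLower_below
        have hlow : F.IsLower (Subtype.val '' K.below) := by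
          intro v w hvw hw
          refine hK v w hvw (N.isLower_below v w hvw ?_) hw
          obtain ⟨x, -, rfl⟩ := hw
          exact x.2
        obtain ⟨c, hc⟩ := exists_isLower hlow
        have hd : c.R.IsLower {x : c.R.V | x.1 ∈ N.below} := by
          intro v w hvw hw
          exact N.isLower_below _ _ (F.restrict_parent_eq_some.1 hvw) hw
        obtain ⟨d, hd⟩ := exists_isLower hd
        refine ⟨⟨c, d⟩, Prod.ext ?_ hc⟩
        ext v
        simp only [hd]
        constructor
        · rintro (hv | ⟨x, hx, rfl⟩)
          · rw [hc] at hv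
            obtain ⟨x, -, rfl⟩ := hv
            exact x.2
          · exact hx
        · intro hv
          by_cases h : v ∈ c.below
          · exact .inl h
          · exact .inr ⟨⟨v, h⟩, hv, rfl⟩
      · rintro ⟨⟨K, L⟩, h⟩
        obtain ⟨rfl, rfl⟩ := Prod.mk.inj h
        have hL := (hsub _ _).1 L.isLower_below
        have hlow : F.IsLower (K.below ∪ Subtype.val '' L.below) := by
          rintro v w hvw (hw | hw)
          · exact .inl (K.isLower_below v w hvw hw)
          · by_cases h : v ∈ K.below
            · exact .inl h
            · exact .inr (hL v w hvw h hw)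
        obtain ⟨c, hc⟩ := exists_isLower hlow
        have hd : c.P.IsLower {x : c.P.V | x.1 ∈ K.below} := by
          intro v w hvw hw
          exact K.isLower_below _ _ (F.restrict_parent_eq_some.1 hvw) hw
        obtain ⟨d, hd⟩ := exists_isLower hd
        refine ⟨⟨c, d⟩, Prod.ext hc ?_⟩
        ext v
        simp only [hd]
        constructor
        · rintro ⟨x, hx, rfl⟩
          exact hx
        · intro hv
          exact ⟨⟨v, by rw [hc]; exact .inl hv⟩, hv, rfl⟩)
  refine ⟨e, ?_⟩
  intro x
  obtain ⟨h1, h2⟩ := Prod.mk.inj (he x)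
  generalize e x = y at h1 h2 ⊢
  obtain ⟨N, K'⟩ := x
  obtain ⟨K, L⟩ := y
  dsimp only at h1 h2 ⊢
  have h1' : ∀ v, v ∈ N.below ↔ v ∈ K.below ∨ ∃ hv : v ∉ K.below, (⟨v, hv⟩ : K.R.V) ∈ L.below := by
    intro v
    rw [← h1]
    refine or_congr Iff.rfl ⟨?_, fun ⟨hv, h⟩ => ⟨_, h, rfl⟩⟩
    rintro ⟨x, hx, rfl⟩
    exact ⟨x.2, hx⟩
  have h2' : ∀ v, v ∈ K.below ↔ ∃ hv : v ∈ N.below, (⟨v, hv⟩ : N.P.V) ∈ K'.below := by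
    intro v
    rw [h2]
    refine ⟨?_, fun ⟨hv, h⟩ => ⟨_, h, rfl⟩⟩
    rintro ⟨x, hx, rfl⟩
    exact ⟨x.2, hx⟩
  -- The middle subquotient is, on either side, the forest induced on `N.below \ K.below`.
  refine ⟨iso_equivalence.symm (F.restrict_restrict_iso _ _ h2'), iso_equivalence.trans
    (F.restrict_restrict_iso (D := N.below \ K.below) _ _ fun v => ?_)
      (iso_equivalence.symm (F.restrict_restrict_iso _ _ fun v => ?_)),
    F.restrict_restrict_iso _ _ fun v => ?_⟩
  · constructor
    · rintro ⟨hv, hv'⟩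
      obtain h | h := (h1' v).1 hv
      · exact absurd h hv'
      · exact h
    · rintro ⟨hv, h⟩
      exact ⟨(h1' v).2 (.inr ⟨hv, h⟩), hv⟩
  · constructor
    · rintro ⟨hv, hv'⟩
      exact ⟨hv, fun h => hv' ((h2' v).2 ⟨hv, h⟩)⟩
    · rintro ⟨hv, h⟩
      refine ⟨hv, fun hv' => h ?_⟩
      obtain ⟨_, h⟩ := (h2' v).1 hv'
      exact h
  · constructor
    · intro hv
      exact ⟨fun h => hv ((h1' v).2 (.inl h)), fun h => hv ((h1' v).2 (.inr ⟨_, h⟩))⟩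
    · rintro ⟨hv, h⟩ hv'
      obtain h' | ⟨_, h'⟩ := (h1' v).1 hv'
      · exact hv h'
      · exact h h'

theorem exists_bot (F : Forest S) :
    ∃ N : F.Cut, N.R.Iso F ∧ ∀ N' : F.Cut, N'.P.Iso (empty S) ↔ N' = N := by
  obtain ⟨N, hN⟩ : (∅ : Set F.V) ∈ Set.range (Cut.below (F := F)) := by
    rw [range_below]
    exact fun _ _ _ h => h
  refine ⟨N, F.iso_univ fun v => by simp [hN], fun N' => ?_⟩
  refine (iso_empty_iff _).trans ?_
  rw [← (Cut.below_injective F).eq_iff, hN]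
  exact Set.isEmpty_coe_sort
theorem exists_top (F : Forest S) :
    ∃ N : F.Cut, N.P.Iso F ∧ ∀ N' : F.Cut, N'.R.Iso (empty S) ↔ N' = N := by
  obtain ⟨N, hN⟩ : (Set.univ : Set F.V) ∈ Set.range (Cut.below (F := F)) := by
    rw [range_below]
    exact fun _ _ _ h => h
  refine ⟨N, F.iso_univ fun v => by simp [hN], fun N' => ?_⟩
  refine (iso_empty_iff _).trans ?_
  rw [← (Cut.below_injective F).eq_iff, hN]
  exact Set.isEmpty_coe_sort.trans Set.compl_empty_iff

theorem laws (S : Type u) : (forestData S).Laws where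
  finite_ext A B := by
    have hcard : ∀ F G : Forest S, (forestData S).cls F = (forestData S).cls G →
        Nat.card F.V = Nat.card G.V := by
      intro F G h
      obtain ⟨e, -⟩ := cls_eq_iff.1 h
      exact Nat.card_congr e
    refine (finite_card_eq (Nat.card ((forestData S).rep A : Forest S).V +
      Nat.card ((forestData S).rep B : Forest S).V)).subset ?_
    rintro E ⟨N, rfl, rfl⟩
    rw [Set.mem_ofPred_eq, ← Cut.card_add N]
    exact congrArg₂ _ (hcard _ _ (HallData.cls_rep _).symm) (hcard _ _ (HallData.cls_rep _).symm)
  transport F G h := by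
    obtain ⟨e, he⟩ := exists_equiv_of_iso (cls_eq_iff.1 h)
    exact ⟨e, fun N => ⟨cls_eq_iff.2 (he N).1, cls_eq_iff.2 (he N).2⟩⟩
  sum M N B h := exists_equiv_of_isSum h
  chain F := by
    obtain ⟨e, he⟩ := exists_equiv_chain F
    exact ⟨e, fun x => ⟨cls_eq_iff.2 (he x).1, cls_eq_iff.2 (he x).2.1, cls_eq_iff.2 (he x).2.2⟩⟩
  bot F := by
    obtain ⟨N, h, h'⟩ := exists_bot F
    exact ⟨N, cls_eq_iff.2 h, fun N' => cls_eq_iff.trans (h' N')⟩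
  top F := by
    obtain ⟨N, h, h'⟩ := exists_top F
    exact ⟨N, cls_eq_iff.2 h, fun N' => cls_eq_iff.trans (h' N')⟩

end Forest

/-! ### Graphs with half-edges -/

namespace HGraph

variable {G : HGraph.{u}}

/-- The half-edges in internal edges. -/
def internal (G : HGraph.{u}) : Set G.H := {h | ¬ G.External h}

theorem mem_internal {h : G.H} : h ∈ G.internal ↔ ∃ k, G.adj h k := by
  simp [internal, External]

/-- The vertices joined to `v` by edges with both half-edges in `J`. -/
def compOf (G : HGraph.{u}) (J : Set G.H) (v : G.V) : Set G.V :=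
  {w | Relation.ReflTransGen
    (fun a b => ∃ h ∈ J, ∃ k ∈ J, G.adj h k ∧ G.vert h = a ∧ G.vert k = b) v w}

/-- The half-edges outside `J` at the `J`-component of `v`. -/
def extOf (G : HGraph.{u}) (J : Set G.H) (v : G.V) : Set G.H :=
  {h | G.vert h ∈ G.compOf J v ∧ h ∉ J}

/-- The half-edges in `J` whose edge leaves `U`. -/
def boundary (G : HGraph.{u}) (J : Set G.H) (U : Set G.V) : Set G.H :=
  {h | h ∈ J ∧ G.vert h ∈ U ∧ ∃ k ∈ J, G.adj h k ∧ G.vert k ∉ U}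

/-- `J` is the set of half-edges in internal edges of a Feynman subgraph. Irreducibility is
stated in terms of cuts. -/
structure IsGood (G : HGraph.{u}) (J : Set G.H) : Prop where
  closed : ∀ h ∈ J, ∃ k ∈ J, G.adj h k
  ext : ∀ v, (G.extOf J v).ncard = 2 ∨ (G.extOf J v).ncard = 3
  bridgeless : ∀ U h, G.boundary J U ≠ {h}

theorem self_mem_compOf (J : Set G.H) (v : G.V) : v ∈ G.compOf J v := Relation.ReflTransGen.refl

theorem compOf_trans {J : Set G.H} {u v w : G.V} (h : v ∈ G.compOf J u) (h' : w ∈ G.compOf J v) :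
    w ∈ G.compOf J u := Relation.ReflTransGen.trans h h'

theorem vert_mem_compOf {J : Set G.H} {h k : G.H} (hh : h ∈ J) (hk : k ∈ J) (hhk : G.adj h k) :
    G.vert k ∈ G.compOf J (G.vert h) := Relation.ReflTransGen.single ⟨h, hh, k, hk, hhk, rfl, rfl⟩

theorem compOf_mono {J J' : Set G.H} (h : J ⊆ J') (v : G.V) : G.compOf J v ⊆ G.compOf J' v := by
  intro w hw
  refine Relation.ReflTransGen.mono ?_ _ _ hw
  rintro a b ⟨x, hx, y, hy, hxy⟩
  exact ⟨x, h hx, y, h hy, hxy⟩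

theorem mem_of_mem_compOf {J : Set G.H} {v w : G.V} (hw : w ∈ G.compOf J v) {U : Set G.V}
    (hv : v ∈ U) (hU : G.boundary J U = ∅) : w ∈ U := by
  induction hw with
  | refl => exact hv
  | tail _ h ih =>
    obtain ⟨x, hx, y, hy, hxy, rfl, rfl⟩ := h
    by_contra hn
    exact (Set.eq_empty_iff_forall_notMem.1 hU x) ⟨hx, ih, y, hy, hxy, hn⟩

theorem boundary_compOf_self (J : Set G.H) (v : G.V) : G.boundary J (G.compOf J v) = ∅ := by
  refine Set.eq_empty_iff_forall_notMem.2 ?_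
  rintro x ⟨hx, hv, y, hy, hxy, hn⟩
  exact hn (compOf_trans hv (vert_mem_compOf hx hy hxy))

theorem compOf_subset {J : Set G.H} {v : G.V} {U : Set G.V} (hv : v ∈ U)
    (hU : G.boundary J U = ∅) : G.compOf J v ⊆ U := fun _ hw => mem_of_mem_compOf hw hv hU

theorem compOf_eq_singleton {J : Set G.H} {v : G.V} (hv : ∀ h ∈ J, G.vert h ≠ v) :
    G.compOf J v = {v} := by
  refine Set.Subset.antisymm (compOf_subset rfl ?_) (by simpa using self_mem_compOf J v)
  refine Set.eq_empty_iff_forall_notMem.2 ?_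
  rintro x ⟨hx, hx', -⟩
  exact hv x hx hx'

/-- The axioms for the adjacency of half-edges. -/
structure IsBasic (G : HGraph.{u}) : Prop where
  symm : ∀ h k, G.adj h k → G.adj k h
  irrefl : ∀ h, ¬ G.adj h h
  unique : ∀ h k k', G.adj h k → G.adj h k' → k = k'

theorem IsFeynman.isBasic (hG : G.IsFeynman) : G.IsBasic := ⟨hG.symm, hG.irrefl, hG.unique⟩

theorem IsBasic.compOf_symm (hG : G.IsBasic) {J : Set G.H} {v w : G.V} (h : w ∈ G.compOf J v) :
    v ∈ G.compOf J w := by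
  induction h with
  | refl => exact self_mem_compOf _ _
  | tail _ hs ih =>
    obtain ⟨x, hx, y, hy, hxy, rfl, rfl⟩ := hs
    exact compOf_trans (vert_mem_compOf hy hx (hG.symm _ _ hxy)) ih

theorem IsBasic.compOf_eq (hG : G.IsBasic) {J : Set G.H} {v w : G.V} (h : w ∈ G.compOf J v) :
    G.compOf J w = G.compOf J v :=
  Set.Subset.antisymm (fun _ => compOf_trans h) fun _ => compOf_trans (hG.compOf_symm h)

theorem IsBasic.extOf_eq (hG : G.IsBasic) {J : Set G.H} {v w : G.V} (h : w ∈ G.compOf J v) :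
    G.extOf J w = G.extOf J v := by rw [extOf, extOf, hG.compOf_eq h]

theorem IsBasic.unique' (hG : G.IsBasic) {h k l : G.H} (h1 : G.adj h l) (h2 : G.adj k l) : h = k :=
  hG.unique l h k (hG.symm _ _ h1) (hG.symm _ _ h2)

theorem IsBasic.mem_internal_right (hG : G.IsBasic) {h k : G.H} (hk : G.adj h k) :
    k ∈ G.internal := mem_internal.2 ⟨h, hG.symm _ _ hk⟩

theorem IsGood.mem_right (hG : G.IsBasic) {J : Set G.H} (hJ : G.IsGood J) {h k : G.H} (hh : h ∈ J)
    (hk : G.adj h k) : k ∈ J := by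
  obtain ⟨l, hl, hl'⟩ := hJ.closed h hh
  rwa [hG.unique _ _ _ hk hl']

theorem IsGood.subset_internal {J : Set G.H} (hJ : G.IsGood J) : J ⊆ G.internal := fun h hh =>
  have ⟨k, _, hk⟩ := hJ.closed h hh
  mem_internal.2 ⟨k, hk⟩

theorem IsBasic.comp_eq (hG : G.IsBasic) (v : G.V) : G.comp v = G.compOf G.internal v := by
  have h : (fun a b => ∃ h k, h ∉ (∅ : Set G.H) ∧ k ∉ (∅ : Set G.H) ∧ G.adj h k ∧
      G.vert h = a ∧ G.vert k = b) = fun a b => ∃ h ∈ G.internal, ∃ k ∈ G.internal,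
      G.adj h k ∧ G.vert h = a ∧ G.vert k = b := by
    ext a b
    constructor
    · rintro ⟨h, k, -, -, hk, rest⟩
      exact ⟨h, mem_internal.2 ⟨k, hk⟩, k, hG.mem_internal_right hk, hk, rest⟩
    · rintro ⟨h, -, k, -, rest⟩
      exact ⟨h, k, Set.notMem_empty _, Set.notMem_empty _, rest⟩
  rw [comp, compOf]
  unfold ConnAvoiding
  rw [h]

theorem IsBasic.external_eq (hG : G.IsBasic) (v : G.V) :
    {h | G.External h ∧ G.vert h ∈ G.comp v} = G.extOf G.internal v := by
  ext h
  rw [hG.comp_eq]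
  simp [extOf, internal, and_comm]

/-- A bridge is the same as a vertex set with a single outgoing edge. In this form irreducibility
passes to parts and quotients by comparing boundaries, without handling paths. -/
theorem IsBasic.onePI_iff (hG : G.IsBasic) :
    (∀ h k, G.adj h k → G.ConnAvoiding {h, k} (G.vert h) (G.vert k)) ↔
      ∀ U h, G.boundary G.internal U ≠ {h} := by
  constructor
  · intro H U h hU
    obtain ⟨-, hh, k, -, hk, hkU⟩ : h ∈ G.boundary G.internal U := by rw [hU]; rfl
    refine hkU ?_
    have : ∀ w, G.ConnAvoiding {h, k} (G.vert h) w → w ∈ U := by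
      intro w hw
      induction hw with
      | refl => exact hh
      | tail _ hs ih =>
        obtain ⟨x, y, hx, -, hxy, rfl, rfl⟩ := hs
        by_contra hn
        have hx' : x ∈ G.boundary G.internal U :=
          ⟨mem_internal.2 ⟨y, hxy⟩, ih, y, hG.mem_internal_right hxy, hxy, hn⟩
        rw [hU] at hx'
        exact hx (.inl hx')
    exact this _ (H h k hk)
  · intro H h k hk
    by_contra hn
    -- If the edge `h k` is a bridge, the vertices reached from its first end without using it have
    -- `h` as their only boundary half-edge.
    refine H {w | G.ConnAvoiding {h, k} (G.vert h) w} h (Set.Subset.antisymm ?_ ?_)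
    · rintro x ⟨-, hx, y, -, hxy, hy⟩
      by_contra hxh
      refine hy (Relation.ReflTransGen.tail hx ⟨x, y, ?_, ?_, hxy, rfl, rfl⟩)
      · rintro (rfl | rfl)
        · exact hxh rfl
        · exact hn hx
      · rintro (rfl | rfl)
        · exact hy Relation.ReflTransGen.refl
        · exact hxh (hG.unique' hxy hk)
    · rintro _ rfl
      exact ⟨mem_internal.2 ⟨k, hk⟩, Relation.ReflTransGen.refl, k, hG.mem_internal_right hk, hk, hn⟩

theorem ncard_vert_preimage (h3 : ∀ v, {h | G.vert h = v}.ncard = 3) (C : Set G.V) :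
    {h | G.vert h ∈ C}.ncard = 3 * C.ncard := by
  classical
  have := G.finV
  have := G.finH
  let _ := Fintype.ofFinite G.V
  let _ := Fintype.ofFinite G.H
  rw [Set.ncard_eq_toFinset_card' , Set.ncard_eq_toFinset_card' C,
    Finset.card_eq_sum_card_fiberwise (f := G.vert) (t := C.toFinset) (by intro; simp),
    Finset.sum_const_nat (m := 3), mul_comm]
  intro v hv
  rw [← h3 v, Set.ncard_eq_toFinset_card']
  congr 1
  ext h
  simp only [Finset.mem_filter, Set.mem_toFinset, Set.mem_ofPred_eq] at hv ⊢
  exact ⟨fun h => h.2, fun h => ⟨h ▸ hv, h⟩⟩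

/-- Adjacency pairs the half-edges off without fixed points. -/
theorem IsBasic.even_ncard (hG : G.IsBasic) {J : Set G.H} (hJ : ∀ h ∈ J, ∃ k ∈ J, G.adj h k) :
    Even J.ncard := by
  classical
  have := G.finH
  let _ := Fintype.ofFinite G.H
  rw [Set.ncard_eq_toFinset_card', ← ZMod.natCast_eq_zero_iff_even, Finset.cast_card]
  choose! p hp hp' using hJ
  refine Finset.sum_involution (fun h _ => p h) (fun h _ => by decide) ?_ ?_ ?_
  · intro h hh _ he
    have := hp' h (by simpa using hh)
    rw [he] at this
    exact hG.irrefl _ this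
  · intro h hh
    simpa using hp h (by simpa using hh)
  · intro h hh
    have hh : h ∈ J := by simpa using hh
    exact hG.unique _ _ _ (hp' _ (hp _ hh)) (hG.symm _ _ (hp' _ hh))

/-- Given trivalence, two or three external edges per component and parity, the loop condition only
excludes the vertex without internal half-edges. This weaker condition is easy to transport. -/
theorem isFeynman_iff : G.IsFeynman ↔ G.IsBasic ∧ (∀ v, {h | G.vert h = v}.ncard = 3) ∧
    G.IsGood G.internal ∧ ∀ v, ∃ h ∈ G.internal, G.vert h = v := by
  have := G.finV
  have := G.finH
  constructor
  · intro h
    have hG := h.isBasic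
    refine ⟨hG, h.trivalent, ⟨?_, ?_, hG.onePI_iff.1 h.onePI⟩, ?_⟩
    · intro x hx
      obtain ⟨k, hk⟩ := mem_internal.1 hx
      exact ⟨k, hG.mem_internal_right hk, hk⟩
    · intro v
      rw [← hG.external_eq]
      exact h.external v
    · intro v
      by_contra! hv
      have hc := compOf_eq_singleton hv
      have hl := h.loop v
      rw [hG.comp_eq, hc, Set.ncard_singleton] at hl
      have : {h | ¬ G.External h ∧ G.vert h ∈ ({v} : Set G.V)} = ∅ :=
        Set.eq_empty_iff_forall_notMem.2 fun x hx => hv x hx.1 hx.2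
      rw [this] at hl
      simp at hl
  · rintro ⟨hG, h3, hI, hv⟩
    refine ⟨hG.symm, hG.irrefl, hG.unique, h3, ?_, ?_, hG.onePI_iff.2 hI.bridgeless⟩
    · intro v
      rw [hG.external_eq]
      exact hI.ext v
    · intro v
      have h1 := hI.ext v
      have h2 := ncard_vert_preimage h3 (G.compOf G.internal v)
      have h4 : Even {h | ¬ G.External h ∧ G.vert h ∈ G.comp v}.ncard := by
        refine hG.even_ncard ?_
        rintro h ⟨hh, hh'⟩
        obtain ⟨k, hk⟩ := mem_internal.1 hh
        have hk' := hG.mem_internal_right hk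
        refine ⟨k, ⟨hk', ?_⟩, hk⟩
        rw [hG.comp_eq] at hh' ⊢
        exact compOf_trans hh' (vert_mem_compOf hh hk' hk)
      have h5 : {h | G.vert h ∈ G.compOf G.internal v}.ncard = (G.extOf G.internal v).ncard +
          {h | ¬ G.External h ∧ G.vert h ∈ G.comp v}.ncard := by
        rw [← Set.ncard_union_eq]
        · congr 1
          ext h
          rw [hG.comp_eq]
          by_cases hh : G.External h <;> simp [extOf, internal, hh]
        · rw [Set.disjoint_left]
          intro h h1 h2
          exact h1.2 h2.1
      have h6 : 0 < {h | ¬ G.External h ∧ G.vert h ∈ G.comp v}.ncard := by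
        rw [Set.ncard_pos]
        obtain ⟨h, hh, rfl⟩ := hv v
        exact ⟨h, hh, by rw [hG.comp_eq]; exact self_mem_compOf _ _⟩
      rw [hG.comp_eq] at h4 h5 h6 ⊢
      -- With `n` vertices, `e ∈ {2, 3}` external and `2m > 0` internal half-edges, `3n = e + 2m`
      -- forces `n ≤ m`; parity settles the cases `n = 1, 2`.
      obtain ⟨m, hm⟩ := h4
      omega

theorem IsFeynman.isGood_internal (hG : G.IsFeynman) : G.IsGood G.internal :=
  (isFeynman_iff.1 hG).2.2.1

theorem IsFeynman.exists_internal (hG : G.IsFeynman) (v : G.V) : ∃ h ∈ G.internal, G.vert h = v :=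
  (isFeynman_iff.1 hG).2.2.2 v

/-! ### Parts of a graph -/

theorem IsBasic.part (hG : G.IsBasic) (W : Set G.V) (J : Set G.H) : (G.part W J).IsBasic where
  symm _ _ h := ⟨hG.symm _ _ h.1, h.2.2, h.2.1⟩
  irrefl _ h := hG.irrefl _ h.1
  unique _ _ _ h h' := Subtype.ext (hG.unique _ _ _ h.1 h'.1)

/-- The vertices of a part, in the whole graph. -/
def ofPartV {W : Set G.V} {J : Set G.H} (v : (G.part W J).V) : G.V := v.1

/-- The half-edges of a part, in the whole graph. -/
def ofPartH {W : Set G.V} {J : Set G.H} (h : (G.part W J).H) : G.H := h.1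

theorem ofPartV_injective {W : Set G.V} {J : Set G.H} :
    Function.Injective (ofPartV (W := W) (J := J)) := Subtype.val_injective

theorem ofPartH_injective {W : Set G.V} {J : Set G.H} :
    Function.Injective (ofPartH (W := W) (J := J)) := Subtype.val_injective

theorem part_trivalent (h3 : ∀ v, {h | G.vert h = v}.ncard = 3) (W : Set G.V) (J : Set G.H)
    (v : (G.part W J).V) : {h | (G.part W J).vert h = v}.ncard = 3 := by
  rw [← h3 (ofPartV v), ← Set.ncard_image_of_injective _ ofPartH_injective]
  congr 1
  ext h
  constructor
  · rintro ⟨x, rfl, rfl⟩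
    rfl
  · intro hh
    exact ⟨⟨h, by rw [show G.vert h = ofPartV v from hh]; exact v.2⟩, Subtype.ext hh, rfl⟩

section Part

variable {W : Set G.V} {J : Set G.H} {K : Set (G.part W J).H}

theorem image_compOf_part (hK : ∀ h ∈ K, ofPartH h ∈ J) (v : (G.part W J).V) :
    ofPartV '' (G.part W J).compOf K v = G.compOf (ofPartH '' K) (ofPartV v) := by
  ext w
  constructor
  · rintro ⟨w, hw, rfl⟩
    induction hw with
    | refl => exact self_mem_compOf _ _
    | tail _ h ih =>
      obtain ⟨x, hx, y, hy, hxy, rfl, rfl⟩ := h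
      exact compOf_trans ih (vert_mem_compOf ⟨x, hx, rfl⟩ ⟨y, hy, rfl⟩ hxy.1)
  · intro hw
    induction hw with
    | refl => exact ⟨v, self_mem_compOf _ _, rfl⟩
    | tail _ h ih =>
      obtain ⟨_, ⟨x, hx, rfl⟩, _, ⟨y, hy, rfl⟩, hxy, rfl, rfl⟩ := h
      obtain ⟨w, hw, hw'⟩ := ih
      obtain rfl : w = (G.part W J).vert x := Subtype.ext hw'
      exact ⟨(G.part W J).vert y, compOf_trans hw (vert_mem_compOf hx hy ⟨hxy, hK x hx, hK y hy⟩), rfl⟩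

theorem image_extOf_part (hK : ∀ h ∈ K, ofPartH h ∈ J) (v : (G.part W J).V) :
    ofPartH '' (G.part W J).extOf K v = G.extOf (ofPartH '' K) (ofPartV v) := by
  ext h
  change _ ↔ G.vert h ∈ G.compOf (ofPartH '' K) (ofPartV v) ∧ _
  rw [← image_compOf_part hK]
  constructor
  · rintro ⟨h, ⟨h1, h2⟩, rfl⟩
    exact ⟨⟨_, h1, rfl⟩, by rwa [ofPartH_injective.mem_set_image]⟩
  · rintro ⟨⟨w, hw, hw'⟩, h2⟩
    have hh : G.vert h ∈ W := by rw [← hw']; exact w.2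
    refine ⟨⟨h, hh⟩, ⟨?_, fun h' => h2 ⟨_, h', rfl⟩⟩, rfl⟩
    have : (G.part W J).vert ⟨h, hh⟩ = w := Subtype.ext hw'.symm
    rwa [this]

theorem image_boundary_part (hK : ∀ h ∈ K, ofPartH h ∈ J) (U : Set G.V) :
    ofPartH '' (G.part W J).boundary K (ofPartV ⁻¹' U) =
      G.boundary (ofPartH '' K) U := by
  ext h
  constructor
  · rintro ⟨h, ⟨h1, h2, k, h3, h4, h5⟩, rfl⟩
    exact ⟨⟨h, h1, rfl⟩, h2, ofPartH k, ⟨k, h3, rfl⟩, h4.1, h5⟩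
  · rintro ⟨⟨h, h1, rfl⟩, h2, _, ⟨k, h3, rfl⟩, h4, h5⟩
    exact ⟨h, ⟨h1, h2, k, h3, ⟨h4, hK h h1, hK k h3⟩, h5⟩, rfl⟩

/-- Components, external half-edges and boundaries of `K` are the same in the part and in `G`; only
vertices outside `W` need an argument. -/
theorem isGood_part_iff (h3 : ∀ v, {h | G.vert h = v}.ncard = 3) (hK : ∀ h ∈ K, ofPartH h ∈ J) :
    (G.part W J).IsGood K ↔ G.IsGood (ofPartH '' K) := by
  constructor
  · intro h
    refine ⟨?_, ?_, ?_⟩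
    · rintro _ ⟨x, hx, rfl⟩
      obtain ⟨k, hk, hk'⟩ := h.closed x hx
      exact ⟨ofPartH k, ⟨k, hk, rfl⟩, hk'.1⟩
    · intro v
      by_cases hv : v ∈ W
      · obtain ⟨v, rfl⟩ : ∃ v' : (G.part W J).V, ofPartV v' = v := ⟨⟨v, hv⟩, rfl⟩
        have := h.ext v
        rw [← Set.ncard_image_of_injective _ ofPartH_injective, image_extOf_part hK] at this
        exact this
      -- Outside `W` a component is a lone vertex, and its three half-edges are all external.
      · have hv' : ∀ h ∈ ofPartH '' K, G.vert h ≠ v := by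
          rintro _ ⟨x, -, rfl⟩ rfl
          exact hv x.2
        right
        rw [← h3 v, extOf, compOf_eq_singleton hv']
        congr 1
        ext x
        exact ⟨fun hx => hx.1, fun hx => ⟨hx, fun hx' => hv' x hx' hx⟩⟩
    · intro U x hU
      rw [← image_boundary_part hK] at hU
      obtain ⟨y, -, rfl⟩ : x ∈ ofPartH '' (G.part W J).boundary K (ofPartV ⁻¹' U) := by
        rw [hU]; rfl
      refine h.bridgeless (ofPartV ⁻¹' U) y (ofPartH_injective.image_injective ?_)
      rw [hU, Set.image_singleton]
  · intro h
    refine ⟨?_, ?_, ?_⟩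
    · intro x hx
      obtain ⟨_, ⟨k, hk, rfl⟩, hk'⟩ := h.closed (ofPartH x) ⟨x, hx, rfl⟩
      exact ⟨k, hk, hk', hK x hx, hK k hk⟩
    · intro v
      have := h.ext (ofPartV v)
      rwa [← Set.ncard_image_of_injective _ ofPartH_injective, image_extOf_part hK]
    · intro U x hU
      refine h.bridgeless (ofPartV '' U) (ofPartH x) ?_
      rw [← image_boundary_part hK, Set.preimage_image_eq _ ofPartV_injective, hU,
        Set.image_singleton]

theorem internal_part (hJ : ∀ h ∈ J, G.vert h ∈ W ∧ ∃ k ∈ J, G.adj h k) :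
    ofPartH '' (G.part W J).internal = J := by
  ext h
  constructor
  · rintro ⟨x, hx, rfl⟩
    obtain ⟨k, hk⟩ := mem_internal.1 hx
    exact hk.2.1
  · intro hh
    obtain ⟨h1, k, hk, hk'⟩ := hJ h hh
    exact ⟨⟨h, h1⟩, mem_internal.2 ⟨⟨k, (hJ k hk).1⟩, hk', hh, hk⟩, rfl⟩

end Part

/-! ### Feynman subgraphs as good sets of half-edges. -/

namespace Subgraph

/-- The vertex set carries no further information, because each vertex of a Feynman graph has an
internal half-edge. -/
theorem isGood_of_isFeynman_part (h3 : ∀ v, {h | G.vert h = v}.ncard = 3) {W : Set G.V}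
    {J : Set G.H} (hJ : ∀ h ∈ J, G.vert h ∈ W ∧ ∃ k ∈ J, G.adj h k) (h : (G.part W J).IsFeynman) :
    G.IsGood J ∧ W = G.vert '' J := by
  refine ⟨?_, ?_⟩
  · have h' := h.isGood_internal
    rwa [isGood_part_iff h3 (fun h hh => (mem_internal.1 hh).choose_spec.2.1),
      internal_part hJ] at h'
  · ext v
    constructor
    · intro hv
      obtain ⟨x, hx, hx'⟩ := h.exists_internal ⟨v, hv⟩
      obtain ⟨k, hk⟩ := mem_internal.1 hx
      exact ⟨x.1, hk.2.1, congrArg Subtype.val hx'⟩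
    · rintro ⟨x, hx, rfl⟩
      exact (hJ x hx).1

theorem isGood (hG : G.IsFeynman) (γ : G.Subgraph) : G.IsGood γ.J :=
  (isGood_of_isFeynman_part hG.trivalent γ.2.1 γ.2.2).1

theorem W_eq (hG : G.IsFeynman) (γ : G.Subgraph) : γ.W = G.vert '' γ.J :=
  (isGood_of_isFeynman_part hG.trivalent γ.2.1 γ.2.2).2

theorem J_injective (hG : G.IsFeynman) : Function.Injective (J (G := G)) := by
  intro γ γ' h
  refine Subtype.ext (Prod.ext ?_ h)
  exact (γ.W_eq hG).trans ((congrArg _ h).trans (γ'.W_eq hG).symm)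

theorem exists_J_eq (hG : G.IsFeynman) {J : Set G.H} (hJ : G.IsGood J) :
    ∃ γ : G.Subgraph, γ.J = J := by
  have hc : ∀ h ∈ J, G.vert h ∈ G.vert '' J ∧ ∃ k ∈ J, G.adj h k := fun h hh =>
    ⟨⟨h, hh, rfl⟩, hJ.closed h hh⟩
  refine ⟨⟨(G.vert '' J, J), hc, isFeynman_iff.2 ⟨hG.isBasic.part _ _,
    part_trivalent hG.trivalent _ _, ?_, ?_⟩⟩, rfl⟩
  · rwa [isGood_part_iff hG.trivalent (fun h hh => (mem_internal.1 hh).choose_spec.2.1),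
      internal_part hc]
  · rintro ⟨_, x, hx, rfl⟩
    have : x ∈ ofPartH '' (G.part (G.vert '' J) J).internal := by rwa [internal_part hc]
    obtain ⟨y, hy, rfl⟩ := this
    exact ⟨y, hy, rfl⟩

end Subgraph


/-! ### Links -/

namespace Subgraph

variable {G : HGraph.{u}} (hG : G.IsFeynman) {γ : G.Subgraph}
include hG

omit hG in
-- A vertex outside `γ` counts as a component with three external half-edges. This lets `kept_iff`
-- and `through_iff` treat contracted and untouched vertices alike.
theorem extOf_of_notMem {v : G.V} (hv : v ∉ γ.W) : G.extOf γ.J v = {h | G.vert h = v} := by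
  have hv' : ∀ h ∈ γ.J, G.vert h ≠ v := by
    rintro h hh rfl
    exact hv (γ.2.1 h hh).1
  rw [extOf, compOf_eq_singleton hv']
  ext x
  exact ⟨fun hx => hx.1, fun hx => ⟨hx, fun hx' => hv' x hx' hx⟩⟩

/-- The internal half-edge `g` says that the component is not a whole component of `G`. For a vertex
outside `γ` this is automatic. -/
theorem kept_iff {h : G.H} : γ.Kept h ↔ h ∉ γ.J ∧ (G.extOf γ.J (G.vert h)).ncard = 3 ∧
    ∃ g ∈ G.extOf γ.J (G.vert h), g ∈ G.internal := by
  by_cases hv : G.vert h ∈ γ.W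
  · have : γ.Full (G.vert h) ↔ ¬ ∃ g ∈ G.extOf γ.J (G.vert h), g ∈ G.internal := by
      simp only [Full, internal, Set.mem_ofPred_eq, not_exists, not_and, not_not]
      rfl
    rw [Kept, ToVertex, this, not_not]
    simp only [hv, not_true, false_or, true_and]
    rfl
  · have h1 : h ∉ γ.J := fun hh => hv (γ.2.1 h hh).1
    rw [extOf_of_notMem hv]
    obtain ⟨g, hg, hg'⟩ := hG.exists_internal (G.vert h)
    exact ⟨fun _ => ⟨h1, hG.trivalent _, g, hg', hg⟩, fun _ => .inl hv⟩

theorem through_iff {a b : G.H} : γ.Through a b ↔ G.extOf γ.J (G.vert a) = {a, b} ∧ a ≠ b := by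
  refine ⟨fun h => h.2, fun h => ⟨?_, h⟩⟩
  by_contra hv
  have h1 := extOf_of_notMem hv
  rw [h.1] at h1
  have h2 := hG.trivalent (G.vert a)
  rw [← h1, Set.ncard_pair h.2] at h2
  omega

theorem Kept.of_comp {h g : G.H} (hh : γ.Kept h) (hg : G.vert g ∈ G.compOf γ.J (G.vert h))
    (hg' : g ∉ γ.J) : γ.Kept g := by
  rw [kept_iff hG] at hh ⊢
  rw [hG.isBasic.extOf_eq hg]
  exact ⟨hg', hh.2⟩

omit hG in
theorem Through.mem_ext {a b : G.H} (h : γ.Through a b) : b ∈ G.extOf γ.J (G.vert a) := by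
  have : G.extOf γ.J (G.vert a) = {a, b} := h.2.1
  rw [this]
  exact .inr rfl

omit hG in
theorem Through.left_mem_ext {a b : G.H} (h : γ.Through a b) : a ∈ G.extOf γ.J (G.vert a) := by
  have : G.extOf γ.J (G.vert a) = {a, b} := h.2.1
  rw [this]
  exact .inl rfl

theorem Through.symm {a b : G.H} (h : γ.Through a b) : γ.Through b a := by
  have hb := h.mem_ext
  rw [through_iff hG] at h ⊢
  rw [hG.isBasic.extOf_eq hb.1, h.1, Set.pair_comm]
  exact ⟨rfl, h.2.symm⟩

theorem Through.unique {a b b' : G.H} (h : γ.Through a b) (h' : γ.Through a b') : b = b' := by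
  have hb := h.mem_ext
  rw [through_iff hG] at h h'
  rw [h'.1] at hb
  rcases hb with hb | hb
  · exact absurd hb.symm h.2
  · exact hb

theorem Through.not_kept {a b : G.H} (h : γ.Through a b) : ¬ γ.Kept a := by
  rw [through_iff hG] at h
  rw [kept_iff hG, h.1, Set.ncard_pair h.2]
  omega

/-- The alternative is whether the component has three or two external half-edges. -/
theorem kept_or_through {h : G.H} (hJ : h ∉ γ.J) (hI : h ∈ G.internal) :
    γ.Kept h ∨ ∃ b, γ.Through h b := by
  have hh : h ∈ G.extOf γ.J (G.vert h) := ⟨self_mem_compOf _ _, hJ⟩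
  rcases (γ.isGood hG).ext (G.vert h) with h2 | h3
  · right
    obtain ⟨x, y, hxy, he⟩ := Set.ncard_eq_two.1 h2
    rw [he] at hh
    rcases hh with rfl | rfl
    · exact ⟨y, (through_iff hG).2 ⟨he, hxy⟩⟩
    · exact ⟨x, (through_iff hG).2 ⟨he.trans (Set.pair_comm _ _), hxy.symm⟩⟩
  · exact .inl ((kept_iff hG).2 ⟨hJ, h3, h, hh, hI⟩)

/-- The half-edges of a set containing `γ` that is closed under the operations from which the
quotient by `γ` is built. -/
structure Compatible (γ : G.Subgraph) (N : Set G.H) : Prop where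
  subset : γ.J ⊆ N
  closed : ∀ h ∈ N, ∃ k ∈ N, G.adj h k
  through : ∀ a b, γ.Through a b → a ∈ N → b ∈ N

variable {N : Set G.H}

theorem Compatible.mem_right (hN : γ.Compatible N) {h k : G.H} (hh : h ∈ N) (hk : G.adj h k) :
    k ∈ N := by
  obtain ⟨l, hl, hl'⟩ := hN.closed h hh
  rwa [hG.unique _ _ _ hk hl']

omit hG in
theorem Compatible.subset_internal (hN : γ.Compatible N) : N ⊆ G.internal := fun h hh =>
  have ⟨k, _, hk⟩ := hN.closed h hh
  mem_internal.2 ⟨k, hk⟩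

theorem mem_J_iff {h k : G.H} (hk : G.adj h k) : h ∈ γ.J ↔ k ∈ γ.J :=
  ⟨fun hh => (γ.isGood hG).mem_right hG.isBasic hh hk,
    fun hh => (γ.isGood hG).mem_right hG.isBasic hh (hG.symm _ _ hk)⟩

theorem boundary_compOf_subset (v : G.V) :
    G.boundary N (G.compOf γ.J v) ⊆ G.extOf γ.J v ∩ N := by
  rintro x ⟨hx, hv, k, hk, hxk, hkv⟩
  refine ⟨⟨hv, fun hJ => hkv ?_⟩, hx⟩
  exact compOf_trans hv (vert_mem_compOf hJ ((mem_J_iff hG hxk).1 hJ) hxk)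

/-- If just one leg of a two-legged component of `γ` were in `N`, it would be the only boundary
half-edge of that component in `N`, that is, a bridge. -/
theorem compatible_of_isGood (hN : G.IsGood N) (hJ : γ.J ⊆ N) : γ.Compatible N := by
  refine ⟨hJ, hN.closed, fun a b hab ha => ?_⟩
  by_contra hb
  have he := ((through_iff hG).1 hab).1
  refine hN.bridgeless (G.compOf γ.J (G.vert a)) a (Set.Subset.antisymm ?_ ?_)
  · intro x hx
    obtain ⟨hx1, hx2⟩ := boundary_compOf_subset hG _ hx
    rw [he] at hx1
    rcases hx1 with rfl | rfl
    · rfl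
    · exact absurd hx2 hb
  · rw [Set.singleton_subset_iff]
    obtain ⟨k, hk, hak⟩ := hN.closed _ ha
    refine ⟨ha, self_mem_compOf _ _, k, hk, hak, fun hkv => ?_⟩
    have hk' : k ∈ G.extOf γ.J (G.vert a) :=
      ⟨hkv, fun h => hab.left_mem_ext.2 ((mem_J_iff hG hak).2 h)⟩
    rw [he] at hk'
    rcases hk' with rfl | rfl
    · exact hG.irrefl _ hak
    · exact hb hk

theorem compatible_internal : γ.Compatible G.internal :=
  compatible_of_isGood hG hG.isGood_internal (γ.isGood hG).subset_internal

theorem exists_external (v : G.V) : ∃ h, G.vert h ∈ G.compOf G.internal v ∧ h ∉ G.internal := by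
  have : (G.extOf G.internal v).Nonempty := by
    have := G.finH
    rw [← Set.ncard_pos]
    have := hG.isGood_internal.ext v
    omega
  exact this

/-- The passage through a component with two external edges followed by an edge. -/
def Step (γ : G.Subgraph) (a k : G.H) : Prop := ∃ b, γ.Through a b ∧ G.adj b k

omit hG in
-- A link is an edge followed by a path of steps, and steps are deterministic. So of two links from
-- the same half-edge one continues the other.
theorem link_iff {h k : G.H} :
    γ.Link h k ↔ ∃ l, G.adj h l ∧ Relation.ReflTransGen γ.Step l k := by
  constructor
  · intro hk
    induction hk with
    | adj h => exact ⟨_, h, .refl⟩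
    | through _ h1 h2 ih =>
      obtain ⟨l, hl, hl'⟩ := ih
      exact ⟨l, hl, hl'.tail ⟨_, h1, h2⟩⟩
  · rintro ⟨l, hl, hl'⟩
    induction hl' with
    | refl => exact .adj hl
    | tail _ h ih =>
      obtain ⟨b, hb, hb'⟩ := h
      exact .through ih hb hb'

theorem step_rightUnique : Relator.RightUnique γ.Step := by
  rintro a k k' ⟨b, hb, hk⟩ ⟨b', hb', hk'⟩
  rw [hb.unique hG hb'] at hk
  exact hG.unique _ _ _ hk hk'

omit hG in
theorem Link.trans_step {h a b k : G.H} (h1 : γ.Link h a) (h2 : γ.Through a b) (h3 : γ.Link b k) :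
    γ.Link h k := by
  induction h3 with
  | adj h => exact .through h1 h2 h
  | through _ h h' ih => exact .through ih h h'

theorem Link.symm {h k : G.H} (hk : γ.Link h k) : γ.Link k h := by
  induction hk with
  | adj h => exact .adj (hG.symm _ _ h)
  | through _ h1 h2 ih => exact (Link.adj (hG.symm _ _ h2)).trans_step (h1.symm hG) ih

/-- Both links follow one deterministic path; a kept half-edge ends it, so `k` is met at `l` or
before it. -/
theorem Link.eq_or_of_kept {h k l : G.H} (hk : γ.Link h k) (hl : γ.Link h l) (hK : γ.Kept l) :
    k = l ∨ ∃ b, γ.Through k b ∧ γ.Link b l := by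
  rw [link_iff] at hk hl
  obtain ⟨m, hm, hmk⟩ := hk
  obtain ⟨m', hm', hml⟩ := hl
  obtain rfl := hG.unique _ _ _ hm hm'
  rcases hmk.total_of_right_unique (step_rightUnique hG) hml with h1 | h1
  · rcases h1.cases_head with rfl | ⟨n, ⟨b, hb, hb'⟩, hn⟩
    · exact .inl rfl
    · exact .inr ⟨b, hb, link_iff.2 ⟨n, hb', hn⟩⟩
  · rcases h1.cases_head with rfl | ⟨n, ⟨b, hb, hb'⟩, hn⟩
    · exact .inl rfl
    · exact absurd hK (hb.not_kept hG)

theorem Link.unique {h k l : G.H} (hk : γ.Link h k) (hl : γ.Link h l) (hK : γ.Kept k)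
    (hL : γ.Kept l) : k = l := by
  rcases hk.eq_or_of_kept hG hl hL with h | ⟨b, hb, -⟩
  · exact h
  · exact absurd hK (hb.not_kept hG)

theorem Compatible.mem_of_link (hN : γ.Compatible N) {h k : G.H} (hk : γ.Link h k) (hh : h ∈ N) :
    k ∈ N ∧ G.vert k ∈ G.compOf N (G.vert h) := by
  induction hk with
  | adj h =>
    have := hN.mem_right hG hh h
    exact ⟨this, vert_mem_compOf hh this h⟩
  | through h1 h2 h3 ih =>
    obtain ⟨ih1, ih2⟩ := ih
    have hb := hN.through _ _ h2 ih1
    have hk := hN.mem_right hG hb h3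
    exact ⟨hk, compOf_trans ih2 (compOf_trans (compOf_mono hN.subset _ h2.mem_ext.1)
      (vert_mem_compOf hb hk h3))⟩

theorem Compatible.mem_iff_of_link (hN : γ.Compatible N) {h k : G.H} (hk : γ.Link h k) :
    h ∈ N ↔ k ∈ N :=
  ⟨fun hh => (hN.mem_of_link hG hk hh).1, fun hh => (hN.mem_of_link hG (hk.symm hG) hh).1⟩

theorem Link.right_internal {h k : G.H} (hk : γ.Link h k) : k ∈ G.internal := by
  cases hk with
  | adj h => exact hG.isBasic.mem_internal_right h
  | through _ _ h => exact hG.isBasic.mem_internal_right h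

theorem Link.notMem_J {h k : G.H} (hk : γ.Link h k) (hh : h ∉ γ.J) : k ∉ γ.J := by
  induction hk with
  | adj h => exact fun h' => hh ((mem_J_iff hG h).2 h')
  | through _ h2 h3 ih => exact fun h' => h2.mem_ext.2 ((mem_J_iff hG h3).2 h')

/-- A half-edge linked to a component with two external edges lies outside the components that it
reaches, and reaches a different half-edge of the quotient. -/
theorem exists_link_of_link_through {h a b : G.H} (hh : h ∉ γ.J) (ha : γ.Link h a)
    (hab : γ.Through a b) : (∀ c d, γ.Link h c → γ.Through c d →
      G.vert h ∉ G.compOf γ.J (G.vert c)) ∧ ∃ k, k ≠ h ∧ γ.Kept k ∧ γ.Link h k := by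
  -- The union of the two-legged components that are reached from `h`.
  set U : Set G.V := {v | ∃ c d, γ.Link h c ∧ γ.Through c d ∧ v ∈ G.compOf γ.J (G.vert c)} with hU
  have haU : G.vert a ∈ U := ⟨a, b, ha, hab, self_mem_compOf _ _⟩
  have hUI : ∀ x, G.vert x ∈ U → x ∈ G.internal := by
    rintro x ⟨c, d, hc, hcd, hx⟩
    by_cases hJ : x ∈ γ.J
    · exact (γ.isGood hG).subset_internal hJ
    have hx' : x ∈ G.extOf γ.J (G.vert c) := ⟨hx, hJ⟩
    rw [((through_iff hG).1 hcd).1] at hx'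
    rcases hx' with rfl | rfl
    · exact hc.right_internal hG
    · exact (compatible_internal hG).through _ _ hcd (hc.right_internal hG)
  -- Edges between consecutive components stay in `U`. Only the initial edge at `h` and a final edge
  -- to a kept half-edge can leave it.
  have hbd : ∀ x y, x ∈ G.boundary G.internal U → G.adj x y →
      (y = h ∧ G.vert h ∉ U) ∨ (γ.Link h y ∧ γ.Kept y) := by
    rintro x y ⟨-, ⟨c, d, hc, hcd, hx⟩, y', hy', hxy', hyU⟩ hxy
    obtain rfl := hG.unique _ _ _ hxy hxy'
    have hxJ : x ∉ γ.J := fun hJ => hyU ⟨c, d, hc, hcd, compOf_trans hx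
      (vert_mem_compOf hJ ((mem_J_iff hG hxy).1 hJ) hxy)⟩
    have hx' : x ∈ G.extOf γ.J (G.vert c) := ⟨hx, hxJ⟩
    rw [((through_iff hG).1 hcd).1] at hx'
    rcases hx' with rfl | rfl
    · left
      cases hc with
      | adj hc =>
        obtain rfl := hG.unique _ _ _ hxy (hG.symm _ _ hc)
        exact ⟨rfl, hyU⟩
      | through h1 h2 h3 =>
        obtain rfl := hG.unique _ _ _ hxy (hG.symm _ _ h3)
        exact absurd ⟨_, _, h1, h2, h2.mem_ext.1⟩ hyU
    · right
      have hy : γ.Link h y := .through hc hcd hxy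
      refine ⟨hy, (kept_or_through hG (hy.notMem_J hG hh) hy').resolve_right ?_⟩
      rintro ⟨z, hz⟩
      exact hyU ⟨y, z, hy, hz, self_mem_compOf _ _⟩
  -- `U` contains no external half-edge of `G`, whereas every component of `G` has one.
  have hne : (G.boundary G.internal U).Nonempty := by
    rw [Set.nonempty_iff_ne_empty]
    intro h0
    obtain ⟨x, hx, hx'⟩ := exists_external hG (G.vert a)
    exact hx' (hUI x (compOf_subset haU h0 hx))
  obtain ⟨x, hx⟩ := hne
  -- Irreducibility of `G` excludes a single crossing edge.
  obtain ⟨x', hx', hxx'⟩ : ∃ x' ∈ G.boundary G.internal U, x' ≠ x := by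
    by_contra! hc
    exact hG.isGood_internal.bridgeless U x (Set.eq_singleton_iff_unique_mem.2 ⟨hx, hc⟩)
  obtain ⟨y, -, hxy, -⟩ := hx.2.2
  obtain ⟨y', -, hxy', -⟩ := hx'.2.2
  have hyy' : y ≠ y' := by
    rintro rfl
    exact hxx' (hG.isBasic.unique' hxy' hxy)
  -- The kept end is unique by `Link.unique`, so of the two crossing edges one is the initial and
  -- the other the final edge.
  have key : G.vert h ∉ U ∧ ∃ k, k ≠ h ∧ γ.Kept k ∧ γ.Link h k := by
    rcases hbd x y hx hxy with ⟨rfl, h1⟩ | ⟨h1, h2⟩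
    · rcases hbd x' y' hx' hxy' with ⟨rfl, h1'⟩ | ⟨h1', h2'⟩
      · exact absurd rfl hyy'
      · exact ⟨h1, y', hyy'.symm, h2', h1'⟩
    · rcases hbd x' y' hx' hxy' with ⟨rfl, h1'⟩ | ⟨h1', h2'⟩
      · exact ⟨h1', y, hyy', h2, h1⟩
      · exact absurd (h1.unique hG h1' h2 h2') hyy'
  exact ⟨fun c d hc hd hv => key.1 ⟨c, d, hc, hd, hv⟩, key.2⟩

theorem exists_link {h : G.H} (hh : h ∉ γ.J) (hI : h ∈ G.internal) : ∃ k, γ.Kept k ∧ γ.Link h k := by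
  obtain ⟨l, hl⟩ := mem_internal.1 hI
  have hl' : γ.Link h l := .adj hl
  rcases kept_or_through hG (hl'.notMem_J hG hh) (hl'.right_internal hG) with h1 | ⟨b, hb⟩
  · exact ⟨l, h1, hl'⟩
  · obtain ⟨-, k, -, hk⟩ := exists_link_of_link_through hG hh hl' hb
    exact ⟨k, hk⟩

/-- A closed chain would either bring `h` back into a component that it reaches, or make `h` its own
kept end; `exists_link_of_link_through` excludes both. -/
theorem not_link_self {h : G.H} (hh : h ∉ γ.J) : ¬ γ.Link h h := by
  intro hk
  rcases kept_or_through hG hh (hk.right_internal hG) with h1 | ⟨b, hb⟩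
  · obtain ⟨l, hl⟩ := mem_internal.1 (hk.right_internal hG)
    have hl' : γ.Link h l := .adj hl
    rcases kept_or_through hG (hl'.notMem_J hG hh) (hl'.right_internal hG) with h2 | ⟨b, hb⟩
    · rw [hl'.unique hG hk h2 h1] at hl
      exact hG.irrefl _ hl
    · obtain ⟨-, k, hkh, hk', hk''⟩ := exists_link_of_link_through hG hh hl' hb
      exact hkh (hk''.unique hG hk hk' h1)
  · exact (exists_link_of_link_through hG hh hk hb).1 h b hk hb (self_mem_compOf _ _)

end Subgraph


/-! ### Contraction -/

namespace Subgraph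

variable {G : HGraph.{u}} {γ : G.Subgraph}

/-- The half-edges of the quotient, in the original graph. -/
def ofContract (x : γ.contract.H) : G.H := x.1

theorem ofContract_injective : Function.Injective (ofContract (γ := γ)) := Subtype.val_injective

theorem kept_ofContract (x : γ.contract.H) : γ.Kept (ofContract x) := x.2

theorem exists_ofContract {h : G.H} (h' : γ.Kept h) : ∃ x, ofContract (γ := γ) x = h :=
  ⟨⟨h, h'⟩, rfl⟩

theorem adj_contract {x y : γ.contract.H} :
    γ.contract.adj x y ↔ γ.Link (ofContract x) (ofContract y) := Iff.rfl

theorem compOf_subset_W {v : G.V} (hv : v ∈ γ.W) : G.compOf γ.J v ⊆ γ.W := by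
  intro w hw
  induction hw with
  | refl => exact hv
  | tail _ h ih =>
    obtain ⟨x, hx, y, hy, hxy, rfl, rfl⟩ := h
    exact (γ.2.1 y hy).1

variable (hG : G.IsFeynman)
include hG

theorem vert_contract_eq_iff {x y : γ.contract.H} : γ.contract.vert x = γ.contract.vert y ↔
    G.vert (ofContract y) ∈ G.compOf γ.J (G.vert (ofContract x)) := by
  have h1 : ∀ z : γ.contract.H, G.vert (ofContract z) ∉ γ.W →
      G.compOf γ.J (G.vert (ofContract z)) = {G.vert (ofContract z)} := by
    intro z hz
    refine compOf_eq_singleton ?_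
    intro h hh he
    exact hz (he ▸ (γ.2.1 h hh).1)
  by_cases hx : G.vert (ofContract x) ∈ γ.W
  · by_cases hy : G.vert (ofContract y) ∈ γ.W
    · have e1 : γ.contract.vert x = Sum.inr ⟨γ.comp (G.vert x.1), G.vert x.1,
        (x.2.resolve_left (not_not.mpr hx)).2, rfl⟩ := dif_pos hx
      have e2 : γ.contract.vert y = Sum.inr ⟨γ.comp (G.vert y.1), G.vert y.1,
        (y.2.resolve_left (not_not.mpr hy)).2, rfl⟩ := dif_pos hy
      rw [e1, e2]
      constructor
      · intro h
        have h2 : γ.comp (G.vert (ofContract x)) = γ.comp (G.vert (ofContract y)) :=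
          congrArg Subtype.val (Sum.inr.inj h)
        change _ ∈ γ.comp (G.vert (ofContract x))
        rw [h2]
        exact self_mem_compOf _ _
      · intro h
        exact congrArg Sum.inr (Subtype.ext (hG.isBasic.compOf_eq h).symm)
    · have e1 : γ.contract.vert x = Sum.inr ⟨γ.comp (G.vert x.1), G.vert x.1,
        (x.2.resolve_left (not_not.mpr hx)).2, rfl⟩ := dif_pos hx
      have e2 : γ.contract.vert y = Sum.inl ⟨G.vert y.1, hy⟩ := dif_neg hy
      rw [e1, e2]
      exact ⟨fun h => by simp at h, fun h => absurd (compOf_subset_W hx h) hy⟩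
  · have e1 : γ.contract.vert x = Sum.inl ⟨G.vert x.1, hx⟩ := dif_neg hx
    rw [h1 x hx]
    by_cases hy : G.vert (ofContract y) ∈ γ.W
    · have e2 : γ.contract.vert y = Sum.inr ⟨γ.comp (G.vert y.1), G.vert y.1,
        (y.2.resolve_left (not_not.mpr hy)).2, rfl⟩ := dif_pos hy
      rw [e1, e2]
      refine ⟨fun h => by simp at h, fun h => absurd hy ?_⟩
      rw [Set.mem_singleton_iff] at h
      rwa [h]
    · have e2 : γ.contract.vert y = Sum.inl ⟨G.vert y.1, hy⟩ := dif_neg hy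
      rw [e1, e2]
      exact ⟨fun h => (congrArg Subtype.val (Sum.inl.inj h)).symm,
        fun h => congrArg Sum.inl (Subtype.ext (Eq.symm h))⟩

theorem vert_contract_surjective : Function.Surjective γ.contract.vert := by
  have := G.finH
  rintro (⟨v, hv⟩ | ⟨c, v, hv, rfl⟩)
  · have : {h | G.vert h = v}.Nonempty := by
      rw [← Set.ncard_pos, hG.trivalent]
      omega
    obtain ⟨h, rfl⟩ := this
    exact ⟨⟨h, .inl hv⟩, dif_neg hv⟩
  · have : (γ.ext v).Nonempty := by
      rw [← Set.ncard_pos, hv.2.1]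
      omega
    obtain ⟨h, hh, hJ⟩ := this
    have hc : γ.comp (G.vert h) = γ.comp v := hG.isBasic.compOf_eq hh
    have hW : G.vert h ∈ γ.W := compOf_subset_W hv.1 hh
    have he : γ.ext (G.vert h) = γ.ext v := hG.isBasic.extOf_eq hh
    have hk : γ.ToVertex (G.vert h) := ⟨hW, by rw [he]; exact hv.2.1, by
      rw [Full, he]; exact hv.2.2⟩
    refine ⟨⟨h, .inr ⟨hJ, hk⟩⟩, ?_⟩
    have e1 : γ.contract.vert ⟨h, .inr ⟨hJ, hk⟩⟩ = Sum.inr ⟨γ.comp (G.vert h), G.vert h, hk, rfl⟩ :=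
      dif_pos hW
    rw [e1]
    exact congrArg Sum.inr (Subtype.ext hc)

theorem ofContract_notMem_J (x : γ.contract.H) : ofContract x ∉ γ.J :=
  ((kept_iff hG).1 (kept_ofContract x)).1

theorem contract_isBasic : γ.contract.IsBasic where
  symm _ _ h := Link.symm hG h
  irrefl x h := not_link_self hG (ofContract_notMem_J hG x) h
  unique _ y z h h' := ofContract_injective
    (Link.unique hG h h' (kept_ofContract y) (kept_ofContract z))

theorem Through.not_kept_of_comp {a b h : G.H} (hab : γ.Through a b)
    (hh : G.vert h ∈ G.compOf γ.J (G.vert a)) : ¬ γ.Kept h := fun hk =>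
  hab.not_kept hG (hk.of_comp hG (hG.isBasic.compOf_symm hh) hab.left_mem_ext.2)

theorem Through.eq_or_eq {a b h : G.H} (hab : γ.Through a b)
    (hh : G.vert h ∈ G.compOf γ.J (G.vert a)) (hJ : h ∉ γ.J) : h = a ∨ h = b := by
  have : h ∈ G.extOf γ.J (G.vert a) := ⟨hh, hJ⟩
  rw [((through_iff hG).1 hab).1] at this
  exact this

/-! ### Compatible sets of half-edges before and after the contraction. -/

variable {N : Set G.H} (hN : γ.Compatible N)
include hN

/-- Vertices of `U'` are expanded to the components they come from, and a two-legged component is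
added exactly when it lies on a link between members of `U'`. A link that leaves `U'` is then
crossed once, at its first edge. -/
theorem exists_boundary_eq (U' : Set γ.contract.V) : ∃ U : Set G.V,
    (∀ x, G.vert (ofContract x) ∈ U ↔ γ.contract.vert x ∈ U') ∧
    G.boundary N U = ofContract '' γ.contract.boundary (ofContract ⁻¹' N) U' := by
  set U : Set G.V := {u | (∃ x : γ.contract.H, G.vert (ofContract x) ∈ G.compOf γ.J u ∧
      γ.contract.vert x ∈ U') ∨ ∃ (x y : γ.contract.H) (a b : G.H), γ.contract.vert x ∈ U' ∧
      γ.contract.vert y ∈ U' ∧ γ.Link (ofContract x) (ofContract y) ∧ γ.Link (ofContract x) a ∧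
      γ.Through a b ∧ u ∈ G.compOf γ.J (G.vert a)}
  have hU : ∀ x, G.vert (ofContract x) ∈ U ↔ γ.contract.vert x ∈ U' := by
    intro x
    constructor
    · rintro (⟨y, hy, hy'⟩ | ⟨y, z, a, b, -, -, -, -, hab, h⟩)
      · rwa [(vert_contract_eq_iff hG).2 hy]
      · exact absurd (kept_ofContract x) (hab.not_kept_of_comp hG h)
    · intro h
      exact .inl ⟨x, self_mem_compOf _ _, h⟩
  have hsat : ∀ u ∈ U, ∀ w ∈ G.compOf γ.J u, w ∈ U := by
    rintro u (⟨y, hy, hy'⟩ | ⟨y, z, a, b, h1, h2, h3, h4, h5, h⟩) w hw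
    · exact .inl ⟨y, compOf_trans (hG.isBasic.compOf_symm hw) hy, hy'⟩
    · exact .inr ⟨y, z, a, b, h1, h2, h3, h4, h5, compOf_trans h hw⟩
  have hlink : ∀ (x y : γ.contract.H) (z : G.H), γ.contract.vert x ∈ U' → γ.contract.vert y ∈ U' →
      γ.Link (ofContract x) (ofContract y) → γ.Link (ofContract x) z → G.vert z ∈ U := by
    intro x y z hx hy hxy hz
    rcases kept_or_through hG (hz.notMem_J hG (ofContract_notMem_J hG x)) (hz.right_internal hG)
      with h | ⟨b, hb⟩
    · rw [hz.unique hG hxy h (kept_ofContract y)]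
      exact (hU y).2 hy
    · exact .inr ⟨x, y, z, b, hx, hy, hxy, hz, hb, self_mem_compOf _ _⟩
  refine ⟨U, hU, ?_⟩
  ext g
  constructor
  · rintro ⟨hgN, hgU, p, hpN, hgp, hpU⟩
    have hgJ : g ∉ γ.J := fun h =>
      hpU (hsat _ hgU _ (vert_mem_compOf h ((mem_J_iff hG hgp).1 h) hgp))
    rcases hgU with ⟨x, hx, hx'⟩ | ⟨x, y, a, b, hx, hy, hxy, hxa, hab, hga⟩
    · obtain ⟨g, rfl⟩ := exists_ofContract
        ((kept_ofContract x).of_comp hG (hG.isBasic.compOf_symm hx) hgJ)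
      have hg' : γ.contract.vert g ∈ U' := by rwa [(vert_contract_eq_iff hG).2 hx]
      obtain ⟨k, hk, hgk⟩ := exists_link hG hgJ (hN.subset_internal hgN)
      obtain ⟨k, rfl⟩ := exists_ofContract hk
      exact ⟨g, ⟨hgN, hg', k, (hN.mem_of_link hG hgk hgN).1, hgk, fun hkU =>
        hpU (hlink g k p hg' hkU hgk (.adj hgp))⟩, rfl⟩
    -- The link through this component joins two members of `U'`, so the edges at both of its legs
    -- stay in `U`.
    · exfalso
      rcases hab.eq_or_eq hG hga hgJ with rfl | rfl
      · cases hxa with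
        | adj h =>
          obtain rfl := hG.unique _ _ _ hgp (hG.symm _ _ h)
          exact hpU ((hU x).2 hx)
        | through h1 h2 h3 =>
          obtain rfl := hG.unique _ _ _ hgp (hG.symm _ _ h3)
          exact hpU (.inr ⟨x, y, _, _, hx, hy, hxy, h1, h2, h2.mem_ext.1⟩)
      · exact hpU (hlink x y p hx hy hxy (.through hxa hab hgp))
  · rintro ⟨g, ⟨hgN, hgU, k, hk, hgk, hkU⟩, rfl⟩
    obtain ⟨p, hp, hgp⟩ := hN.closed _ hgN
    refine ⟨hgN, (hU g).2 hgU, p, hp, hgp, fun hpU => ?_⟩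
    have hgp' : γ.Link (ofContract g) p := .adj hgp
    have hpJ := hgp'.notMem_J hG (ofContract_notMem_J hG g)
    rcases kept_or_through hG hpJ (hN.subset_internal hp) with h | ⟨c, hc⟩
    · rw [hgp'.unique hG hgk h (kept_ofContract k)] at hpU
      exact hkU ((hU k).1 hpU)
    -- If `p` lay in an added component, its link would join two members of `U'`; but the ends of
    -- that link are `g` and `k`, and `k` is outside.
    · rcases hpU with ⟨x, hx, hx'⟩ | ⟨x, y, a, b, hx, hy, hxy, hxa, hab, hpa⟩
      · exact hc.not_kept_of_comp hG hx (kept_ofContract x)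
      · rcases hab.eq_or_eq hG hpa hpJ with rfl | rfl
        · have h1 := (hxa.symm hG).unique hG (hgp'.symm hG) (kept_ofContract x) (kept_ofContract g)
          rw [h1] at hxy
          obtain rfl := ofContract_injective
            (hxy.unique hG hgk (kept_ofContract y) (kept_ofContract k))
          exact hkU hy
        · have hxg : γ.Link (ofContract x) (ofContract g) := .through hxa hab (hG.symm _ _ hgp)
          obtain rfl := ofContract_injective
            ((hxg.symm hG).unique hG hgk (kept_ofContract x) (kept_ofContract k))
          exact hkU hx

/-- Downwards, a link in `N` stays in one `N`-component. Upwards, a component of the quotient has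
empty boundary, and so has its lift by `exists_boundary_eq`. -/
theorem mem_compOf_contract_iff {x y : γ.contract.H} :
    γ.contract.vert y ∈ γ.contract.compOf (ofContract ⁻¹' N) (γ.contract.vert x) ↔
      G.vert (ofContract y) ∈ G.compOf N (G.vert (ofContract x)) := by
  constructor
  · intro h
    have : γ.contract.vert y ∈ {w | ∃ z : γ.contract.H, γ.contract.vert z = w ∧
        G.vert (ofContract z) ∈ G.compOf N (G.vert (ofContract x))} := by
      refine mem_of_mem_compOf h ⟨x, rfl, self_mem_compOf _ _⟩ ?_
      refine Set.eq_empty_iff_forall_notMem.2 ?_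
      rintro z ⟨hz, ⟨z', hz', hx'⟩, w, hw, hzw, hwn⟩
      refine hwn ⟨w, rfl, ?_⟩
      rw [vert_contract_eq_iff hG] at hz'
      exact compOf_trans hx' (compOf_trans (compOf_mono hN.subset _ hz')
        (hN.mem_of_link hG hzw hz).2)
    obtain ⟨z, hz, hz'⟩ := this
    rw [vert_contract_eq_iff hG] at hz
    exact compOf_trans hz' (compOf_mono hN.subset _ hz)
  · intro h
    obtain ⟨U, hU, hb⟩ := exists_boundary_eq hG hN
      (γ.contract.compOf (ofContract ⁻¹' N) (γ.contract.vert x))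
    rw [boundary_compOf_self, Set.image_empty] at hb
    rw [← hU]
    exact mem_of_mem_compOf h ((hU x).2 (self_mem_compOf _ _)) hb

/-- If a leg of this component of `γ` were in `N`, it would be kept, making `h` kept, or paired with
`h`, putting `h` into `N`. So the component does not grow in `N`. -/
theorem Compatible.compOf_eq {h : G.H} (hh : h ∉ N) (hk : ¬ γ.Kept h) :
    G.compOf N (G.vert h) = G.compOf γ.J (G.vert h) := by
  refine Set.Subset.antisymm (compOf_subset (self_mem_compOf _ _) ?_) (compOf_mono hN.subset _)
  refine Set.eq_empty_iff_forall_notMem.2 fun g hg => ?_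
  obtain ⟨hg1, hg2⟩ := boundary_compOf_subset hG _ hg
  rcases kept_or_through hG hg1.2 (hN.subset_internal hg2) with h1 | ⟨b, hb⟩
  · exact hk (h1.of_comp hG (hG.isBasic.compOf_symm hg1.1) fun h => hh (hN.subset h))
  · rcases hb.eq_or_eq hG (hG.isBasic.compOf_symm hg1.1) fun h => hh (hN.subset h) with rfl | rfl
    · exact hh hg2
    · exact hh (hN.through _ _ hb hg2)

theorem Compatible.kept_of_comp (x : γ.contract.H) {h : G.H} (hh : h ∉ N)
    (hx : G.vert h ∈ G.compOf N (G.vert (ofContract x))) : γ.Kept h := by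
  by_contra hk
  have h1 := hG.isBasic.compOf_symm hx
  rw [hN.compOf_eq hG hh hk] at h1
  exact hk ((kept_ofContract x).of_comp hG (hG.isBasic.compOf_symm h1) fun h => hh (hN.subset h))

theorem image_extOf_contract (x : γ.contract.H) :
    ofContract '' γ.contract.extOf (ofContract ⁻¹' N) (γ.contract.vert x) =
      G.extOf N (G.vert (ofContract x)) := by
  ext h
  constructor
  · rintro ⟨y, ⟨hy, hy'⟩, rfl⟩
    exact ⟨(mem_compOf_contract_iff hG hN).1 hy, hy'⟩
  · rintro ⟨hh, hh'⟩
    obtain ⟨y, rfl⟩ := exists_ofContract (hN.kept_of_comp hG x hh' hh)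
    exact ⟨y, ⟨(mem_compOf_contract_iff hG hN).2 hh, hh'⟩, rfl⟩

theorem isGood_contract (h : G.IsGood N) : γ.contract.IsGood (ofContract ⁻¹' N) := by
  refine ⟨fun x hx => ?_, fun v => ?_, fun U' x hU' => ?_⟩
  · obtain ⟨k, hk, hxk⟩ := exists_link hG (ofContract_notMem_J hG x) (hN.subset_internal hx)
    obtain ⟨k, rfl⟩ := exists_ofContract hk
    exact ⟨k, (hN.mem_of_link hG hxk hx).1, hxk⟩
  · obtain ⟨x, rfl⟩ := vert_contract_surjective hG v
    rw [← Set.ncard_image_of_injective _ ofContract_injective, image_extOf_contract hG hN]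
    exact h.ext _
  · obtain ⟨U, -, hU⟩ := exists_boundary_eq hG hN U'
    rw [hU', Set.image_singleton] at hU
    exact h.bridgeless _ _ hU

/-- A bridge of `N` in `G` lies on exactly one link, and that link is a bridge in the quotient.
Components of `N` that vanish in the quotient are components of `γ`, which are good already. -/
theorem isGood_of_contract (h : γ.contract.IsGood (ofContract ⁻¹' N)) : G.IsGood N := by
  refine ⟨hN.closed, fun v => ?_, fun U g hU => ?_⟩
  · by_cases hx : ∃ x : γ.contract.H, G.vert (ofContract x) ∈ G.compOf N v
    · obtain ⟨x, hx⟩ := hx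
      rw [← hG.isBasic.extOf_eq hx, ← image_extOf_contract hG hN,
        Set.ncard_image_of_injective _ ofContract_injective]
      exact h.ext _
    -- A leg in `N` would be linked to a kept half-edge in the same `N`-component. As there is none,
    -- the `N`-component of `v` is its component in `γ`.
    · have hnk : ∀ g, G.vert g ∈ G.compOf γ.J v → ¬ γ.Kept g := by
        intro g hg hk
        obtain ⟨x, rfl⟩ := exists_ofContract hk
        exact hx ⟨x, compOf_mono hN.subset _ hg⟩
      have hnN : ∀ g ∈ G.extOf γ.J v, g ∉ N := by
        intro g hg hgN
        obtain ⟨k, hk, hgk⟩ := exists_link hG hg.2 (hN.subset_internal hgN)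
        obtain ⟨x, rfl⟩ := exists_ofContract hk
        exact hx ⟨x, compOf_trans (compOf_mono hN.subset _ hg.1) (hN.mem_of_link hG hgk hgN).2⟩
      have hc : G.compOf N v = G.compOf γ.J v := by
        refine Set.Subset.antisymm (compOf_subset (self_mem_compOf _ _) ?_)
          (compOf_mono hN.subset _)
        refine Set.eq_empty_iff_forall_notMem.2 fun g hg => ?_
        obtain ⟨hg1, hg2⟩ := boundary_compOf_subset hG _ hg
        exact hnN g hg1 hg2
      have he : G.extOf N v = G.extOf γ.J v := by
        ext g
        refine ⟨fun hg => ⟨hc ▸ hg.1, fun h => hg.2 (hN.subset h)⟩, fun hg => ⟨?_, hnN g hg⟩⟩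
        rw [hc]
        exact hg.1
      rw [he]
      exact (γ.isGood hG).ext v
  · have hgJ : g ∉ γ.J := by
      intro hJ
      refine (γ.isGood hG).bridgeless U g (Set.Subset.antisymm ?_ ?_)
      · rintro x ⟨hx, hx', k, hk, rest⟩
        rw [← hU]
        exact ⟨hN.subset hx, hx', k, hN.subset hk, rest⟩
      · have : g ∈ G.boundary N U := by rw [hU]; rfl
        obtain ⟨-, hx', k, hk, hgk, hkU⟩ := this
        rw [Set.singleton_subset_iff]
        exact ⟨hJ, hx', k, (mem_J_iff hG hgk).1 hJ, hgk, hkU⟩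
    obtain ⟨hgN, hgU, p, hpN, hgp, hpU⟩ : g ∈ G.boundary N U := by rw [hU]; rfl
    have huniq : ∀ x y, x ∈ N → G.adj x y → G.vert x ∈ U → G.vert y ∉ U → x = g := by
      intro x y hx hxy hxU hyU
      have : x ∈ G.boundary N U := ⟨hx, hxU, y, hN.mem_right hG hx hxy, hxy, hyU⟩
      rwa [hU] at this
    have hsat : ∀ v ∈ U, G.compOf γ.J v ⊆ U := by
      intro v hv
      refine compOf_subset hv (Set.eq_empty_iff_forall_notMem.2 ?_)
      rintro x ⟨hx, hx', k, hk, hxk, hkU⟩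
      rw [huniq x k (hN.subset hx) hxk hx' hkU] at hx
      exact hgJ hx
    have hthr : ∀ a b, γ.Through a b → (G.vert a ∈ U ↔ G.vert b ∈ U) := fun a b hab =>
      ⟨fun h => hsat _ h hab.mem_ext.1, fun h => hsat _ h (hab.symm hG).mem_ext.1⟩
    -- Coming back into `U` is possible only across `g`, and then `g` would be linked to itself.
    have hfwd : ∀ k, γ.Link g k → G.vert k ∉ U := by
      intro k hk
      induction hk with
      | adj h =>
        rwa [hG.unique _ _ _ h hgp]
      | through h1 h2 h3 ih =>
        intro hkU
        rw [hthr _ _ h2] at ih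
        have hb := hN.through _ _ h2 (hN.mem_of_link hG h1 hgN).1
        have := huniq _ _ (hN.mem_right hG hb h3) (hG.symm _ _ h3) hkU ih
        rw [this] at h3
        exact not_link_self hG hgJ (.through h1 h2 h3)
    -- In the other direction the link stays in `U`: leaving again would use `g`, and `b` would be
    -- linked to itself.
    have hbwd : ∀ b, γ.Through g b → ∀ k, γ.Link b k → G.vert k ∈ U := by
      intro b hb k hk
      have hbN := hN.through _ _ hb hgN
      have hbU := (hthr _ _ hb).1 hgU
      have hgb : g ≠ b := ((through_iff hG).1 hb).2
      induction hk with
      | adj h =>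
        by_contra hkU
        exact hgb (huniq _ _ hbN h hbU hkU).symm
      | through h1 h2 h3 ih =>
        by_contra hkU
        have hd := huniq _ _ (hN.through _ _ h2 (hN.mem_of_link hG h1 hbN).1) h3
          ((hthr _ _ h2).1 ih) hkU
        rw [hd] at h2
        have := (h2.symm hG).unique hG hb
        rw [this] at h1
        exact not_link_self hG hb.mem_ext.2 h1
    obtain ⟨y, hy, hgy⟩ := exists_link hG hgJ (hN.subset_internal hgN)
    -- The kept end on the side of `U` of the link that contains `g`.
    obtain ⟨x, hx, hxg⟩ : ∃ x, γ.Kept x ∧ (x = g ∨ ∃ b, γ.Through g b ∧ γ.Link b x) := by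
      rcases kept_or_through hG hgJ (hN.subset_internal hgN) with h1 | ⟨b, hb⟩
      · exact ⟨g, h1, .inl rfl⟩
      · obtain ⟨x, hx, hx'⟩ := exists_link hG hb.mem_ext.2
          (hN.subset_internal (hN.through _ _ hb hgN))
        exact ⟨x, hx, .inr ⟨b, hb, hx'⟩⟩
    have hxU : G.vert x ∈ U ∧ x ∈ N ∧ γ.Link x y := by
      rcases hxg with rfl | ⟨b, hb, hbx⟩
      · exact ⟨hgU, hgN, hgy⟩
      · exact ⟨hbwd b hb x hbx, (hN.mem_of_link hG hbx (hN.through _ _ hb hgN)).1,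
          (hbx.symm hG).trans_step (hb.symm hG) hgy⟩
    -- A link that leaves `U` leaves it across `g`, and tracing it back from there leads to `x`.
    have hcross : ∀ z k, z ∈ N → γ.Kept z → G.vert z ∈ U → γ.Link z k →
        G.vert k ∈ U ∨ z = x := by
      intro z k hzN hz hzU hk
      induction hk with
      | adj h =>
        by_contra! hc
        have := huniq _ _ hzN h hzU hc.1
        rcases hxg with rfl | ⟨b, hb, -⟩
        · exact hc.2 this
        · rw [this] at hz
          exact hb.not_kept hG hz
      | through h1 h2 h3 ih =>
        rcases ih with ih | ih
        · by_contra! hc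
          have hd := huniq _ _ (hN.through _ _ h2 (hN.mem_of_link hG h1 hzN).1) h3
            ((hthr _ _ h2).1 ih) hc.1
          rw [hd] at h2
          rcases hxg with rfl | ⟨b, hb, hbx⟩
          · exact (h2.symm hG).not_kept hG hx
          · rw [(h2.symm hG).unique hG hb] at h1
            exact hc.2 ((h1.symm hG).unique hG hbx hz hx)
        · exact .inr ih
    obtain ⟨x, rfl⟩ := exists_ofContract hx
    obtain ⟨y, rfl⟩ := exists_ofContract hy
    set U' : Set γ.contract.V := {w | ∃ z : γ.contract.H, γ.contract.vert z = w ∧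
      G.vert (ofContract z) ∈ U}
    have hU' : ∀ z : γ.contract.H, γ.contract.vert z ∈ U' ↔ G.vert (ofContract z) ∈ U := by
      refine fun z => ⟨?_, fun h => ⟨z, rfl, h⟩⟩
      rintro ⟨w, hw, hw'⟩
      exact hsat _ hw' ((vert_contract_eq_iff hG).1 hw)
    refine h.bridgeless U' x (Set.Subset.antisymm ?_ ?_)
    · rintro z ⟨hz, hzU, k, -, hzk, hkU⟩
      rw [hU'] at hzU hkU
      exact ofContract_injective
        ((hcross _ _ hz (kept_ofContract z) hzU hzk).resolve_left hkU)
    · rw [Set.singleton_subset_iff]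
      exact ⟨hxU.2.1, (hU' x).2 hxU.1, y, (hN.mem_of_link hG hgy hgN).1, hxU.2.2, fun h =>
        hfwd _ hgy ((hU' y).1 h)⟩

omit hN

/-- This makes the Feynman property of the quotient an instance of `isGood_contract`. -/
theorem preimage_internal : ofContract ⁻¹' G.internal = γ.contract.internal := by
  ext x
  rw [mem_internal]
  constructor
  · intro hx
    obtain ⟨k, hk, hxk⟩ := exists_link hG (ofContract_notMem_J hG x) hx
    exact ⟨⟨k, hk⟩, hxk⟩
  · rintro ⟨k, hk⟩
    exact (hk.symm hG).right_internal hG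

theorem contract_trivalent (v : γ.contract.V) : {x | γ.contract.vert x = v}.ncard = 3 := by
  obtain ⟨x, rfl⟩ := vert_contract_surjective hG v
  rw [← Set.ncard_image_of_injective _ ofContract_injective,
    ← ((kept_iff hG).1 (kept_ofContract x)).2.1]
  congr 1
  ext h
  constructor
  · rintro ⟨y, hy, rfl⟩
    exact ⟨(vert_contract_eq_iff hG).1 (Eq.symm hy), ofContract_notMem_J hG y⟩
  · rintro ⟨h1, h2⟩
    obtain ⟨y, rfl⟩ := exists_ofContract ((kept_ofContract x).of_comp hG h1 h2)
    exact ⟨y, ((vert_contract_eq_iff hG).2 h1).symm, rfl⟩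

variable (γ) in
theorem isFeynman_contract : γ.contract.IsFeynman := by
  refine isFeynman_iff.2 ⟨contract_isBasic hG, contract_trivalent hG, ?_, fun v => ?_⟩
  · rw [← preimage_internal hG]
    exact isGood_contract hG (compatible_internal hG) hG.isGood_internal
  · obtain ⟨x, rfl⟩ := vert_contract_surjective hG v
    have hx := kept_ofContract x
    obtain ⟨g, hg, hg'⟩ := ((kept_iff hG).1 hx).2.2
    obtain ⟨y, rfl⟩ := exists_ofContract (hx.of_comp hG hg.1 hg.2)
    refine ⟨y, ?_, ((vert_contract_eq_iff hG).2 hg.1).symm⟩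
    rw [← preimage_internal hG]
    exact hg'

/-- The half-edges of the subgraph containing `γ` with a given image in the quotient by `γ`. -/
def lift (γ : G.Subgraph) (L : Set γ.contract.H) : Set G.H :=
  γ.J ∪ {h | ∃ x ∈ L, γ.Link (ofContract x) h}

/-- A link from `x ∈ L` runs towards the partner `y ∈ L` of `x`. The far leg of any component on the
way is reached from `y`. -/
theorem compatible_lift {L : Set γ.contract.H} (hL : ∀ x ∈ L, ∃ y ∈ L, γ.contract.adj x y) :
    γ.Compatible (γ.lift L) := by
  have hthr : ∀ x ∈ L, ∀ a b, γ.Link (ofContract x) a → γ.Through a b →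
      ∃ y ∈ L, γ.Link (ofContract y) b := by
    intro x hx a b hxa hab
    obtain ⟨y, hy, hxy⟩ := hL x hx
    rcases hxa.eq_or_of_kept hG hxy (kept_ofContract y) with rfl | ⟨b', hb', hb'y⟩
    · exact absurd (kept_ofContract y) (hab.not_kept hG)
    · rw [hb'.unique hG hab] at hb'y
      exact ⟨y, hy, hb'y.symm hG⟩
  refine ⟨Set.subset_union_left, ?_, ?_⟩
  · rintro h (hh | ⟨x, hx, hxh⟩)
    · obtain ⟨k, hk, hk'⟩ := (γ.isGood hG).closed h hh
      exact ⟨k, .inl hk, hk'⟩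
    · cases hxh with
      | adj h =>
        obtain ⟨y, hy, hxy⟩ := hL x hx
        exact ⟨_, .inr ⟨y, hy, Link.symm hG hxy⟩, hG.symm _ _ h⟩
      | through h1 h2 h3 =>
        exact ⟨_, .inr (hthr x hx _ _ h1 h2), hG.symm _ _ h3⟩
  · rintro a b hab (ha | ⟨x, hx, hxa⟩)
    · exact absurd ha hab.left_mem_ext.2
    · exact .inr (hthr x hx a b hxa hab)

theorem preimage_lift {L : Set γ.contract.H} (hL : ∀ x ∈ L, ∃ y ∈ L, γ.contract.adj x y) :
    ofContract ⁻¹' γ.lift L = L := by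
  ext x
  constructor
  · rintro (hx | ⟨y, hy, hyx⟩)
    · exact absurd hx (ofContract_notMem_J hG x)
    · obtain ⟨z, hz, hyz⟩ := hL y hy
      rwa [← (contract_isBasic hG).unique _ _ _ hyz hyx]
  · intro hx
    obtain ⟨y, hy, hxy⟩ := hL x hx
    exact .inr ⟨y, hy, Link.symm hG hxy⟩

include hN in
-- With `preimage_lift` this matches subsets of the quotient closed under adjacency with the
-- compatible sets of `G`.
theorem lift_preimage : γ.lift (ofContract ⁻¹' N) = N := by
  ext h
  constructor
  · rintro (hh | ⟨x, hx, hxh⟩)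
    · exact hN.subset hh
    · exact (hN.mem_of_link hG hxh hx).1
  · intro hh
    by_cases hJ : h ∈ γ.J
    · exact .inl hJ
    · obtain ⟨k, hk, hhk⟩ := exists_link hG hJ (hN.subset_internal hh)
      obtain ⟨x, rfl⟩ := exists_ofContract hk
      exact .inr ⟨x, (hN.mem_of_link hG hhk hh).1, hhk.symm hG⟩

theorem isGood_lift {L : Set γ.contract.H} (hL : γ.contract.IsGood L) : G.IsGood (γ.lift L) := by
  refine isGood_of_contract hG (compatible_lift hG hL.closed) ?_
  rwa [preimage_lift hG hL.closed]

end Subgraph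


/-! ### Subgraphs of subgraphs and of quotients -/

/-- When every vertex carries a half-edge, a graph is determined by its half-edges, the relation of
sharing a vertex, and adjacency. For iterated parts and contractions all three can be read off in
the half-edges of `G`. -/
theorem iso_of_halfEdges {A B : HGraph.{u}} {Z : Type*} {f : A.H → Z} {g : B.H → Z}
    (hf : Function.Injective f) (hg : Function.Injective g) (hfg : Set.range f = Set.range g)
    (hA : Function.Surjective A.vert) (hB : Function.Surjective B.vert) (R S : Z → Z → Prop)
    (hRA : ∀ x y, A.vert x = A.vert y ↔ R (f x) (f y))
    (hRB : ∀ x y, B.vert x = B.vert y ↔ R (g x) (g y))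
    (hSA : ∀ x y, A.adj x y ↔ S (f x) (f y)) (hSB : ∀ x y, B.adj x y ↔ S (g x) (g y)) :
    A.Iso B := by
  obtain ⟨e, he⟩ := exists_equiv_of_range_eq hf hg hfg
  have hv : ∀ x y, B.vert (e x) = B.vert (e y) ↔ A.vert x = A.vert y := by
    intro x y
    rw [hRA, hRB, he, he]
  let s := Function.surjInv hA
  have hs : ∀ v, A.vert (s v) = v := Function.surjInv_eq hA
  refine ⟨Equiv.ofBijective (fun v => B.vert (e (s v))) ⟨?_, ?_⟩, e, ?_, ?_⟩
  · intro v w h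
    have := (hv _ _).1 h
    rwa [hs, hs] at this
  · intro w
    obtain ⟨y, rfl⟩ := hB w
    obtain ⟨x, rfl⟩ := e.surjective y
    exact ⟨A.vert x, (hv _ _).2 (hs _)⟩
  · intro h
    exact (hv _ _).2 (hs _).symm
  · intro h k
    rw [hSA, hSB, he, he]

theorem IsFeynman.vert_surjective {G : HGraph.{u}} (hG : G.IsFeynman) :
    Function.Surjective G.vert := fun v => by
  obtain ⟨h, -, hh⟩ := hG.exists_internal v
  exact ⟨h, hh⟩

namespace Subgraph

variable {G : HGraph.{u}} (hG : G.IsFeynman) {N κ : G.Subgraph}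
  {K : (G.part N.W N.J).Subgraph} {L : κ.contract.Subgraph}

theorem exists_ofPartH {h : G.H} (h' : G.vert h ∈ N.W) :
    ∃ x : (G.part N.W N.J).H, ofPartH x = h := ⟨⟨h, h'⟩, rfl⟩

theorem isFeynman_part (N : G.Subgraph) : (G.part N.W N.J).IsFeynman := N.2.2

theorem mem_W_iff (hG : G.IsFeynman) {v : G.V} : v ∈ N.W ↔ ∃ h ∈ N.J, G.vert h = v := by
  rw [N.W_eq hG]
  rfl

theorem vert_mem_W {h : G.H} (hh : h ∈ N.J) : G.vert h ∈ N.W := (N.2.1 h hh).1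

theorem ofPartH_mem (K : (G.part N.W N.J).Subgraph) : ∀ h ∈ K.J, ofPartH h ∈ N.J := by
  intro h hh
  obtain ⟨-, k, -, hk⟩ := K.2.1 h hh
  exact hk.2.1

theorem vert_part_eq_iff {W : Set G.V} {J : Set G.H} {x y : (G.part W J).H} :
    (G.part W J).vert x = (G.part W J).vert y ↔ G.vert (ofPartH x) = G.vert (ofPartH y) :=
  Subtype.ext_iff

include hG

theorem part_part_iso (hK : ofPartH '' K.J = κ.J) :
    ((G.part N.W N.J).part K.W K.J).Iso (G.part κ.W κ.J) := by
  have hmem : ∀ x, x ∈ K.J ↔ ofPartH x ∈ κ.J := fun x => by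
    rw [← hK, ofPartH_injective.mem_set_image]
  refine iso_of_halfEdges (f := fun x => ofPartH (ofPartH x)) (g := ofPartH)
    (ofPartH_injective.comp ofPartH_injective) ofPartH_injective ?_ K.isFeynman_part.vert_surjective
    κ.isFeynman_part.vert_surjective (fun h k => G.vert h = G.vert k)
    (fun h k => G.adj h k ∧ h ∈ κ.J ∧ k ∈ κ.J)
    (fun x y => vert_part_eq_iff.trans vert_part_eq_iff) (fun x y => vert_part_eq_iff) ?_
    fun x y => Iff.rfl
  · ext h
    constructor
    · rintro ⟨x, rfl⟩
      have hx : (G.part N.W N.J).vert (ofPartH x) ∈ K.W := x.2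
      obtain ⟨y, hy, hxy⟩ := (mem_W_iff N.isFeynman_part).1 hx
      refine exists_ofPartH ?_
      have : G.vert (ofPartH (ofPartH x)) = G.vert (ofPartH y) :=
        vert_part_eq_iff.1 (Eq.symm hxy)
      rw [this]
      exact vert_mem_W ((hmem y).1 hy)
    · rintro ⟨x, rfl⟩
      have hx : G.vert (ofPartH x) ∈ κ.W := x.2
      obtain ⟨y, hy, hxy⟩ := (mem_W_iff hG).1 hx
      rw [← hK] at hy
      obtain ⟨y, hy, rfl⟩ := hy
      have hN : G.vert (ofPartH x) ∈ N.W := by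
        rw [← hxy]
        exact vert_mem_W (ofPartH_mem K y hy)
      obtain ⟨z, hz⟩ := exists_ofPartH hN
      have hzK : (G.part N.W N.J).vert z ∈ K.W := by
        have : (G.part N.W N.J).vert z = (G.part N.W N.J).vert y := by
          rw [vert_part_eq_iff, hz, hxy]
        rw [this]
        exact vert_mem_W hy
      obtain ⟨z, rfl⟩ := exists_ofPartH hzK
      exact ⟨z, hz⟩
  · intro x y
    constructor
    · rintro ⟨h1, h2, h3⟩
      exact ⟨h1.1, (hmem _).1 h2, (hmem _).1 h3⟩
    · rintro ⟨h1, h2, h3⟩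
      have h2' := (hmem _).2 h2
      have h3' := (hmem _).2 h3
      exact ⟨⟨h1, ofPartH_mem K _ h2', ofPartH_mem K _ h3'⟩, h2', h3'⟩

/-! ### Contracting inside a subgraph: `N / κ` as a subgraph of `G / κ`. -/

section PartContract

variable (hK : ofPartH '' K.J = κ.J)
include hK

omit hG in
theorem subset_of_part : κ.J ⊆ N.J := by
  rw [← hK]
  rintro _ ⟨x, hx, rfl⟩
  exact ofPartH_mem K x hx

theorem compatible_of_part : κ.Compatible N.J :=
  compatible_of_isGood hG (N.isGood hG) (subset_of_part hK)

omit hG in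
theorem image_extOf_sub (x : (G.part N.W N.J).H) :
    ofPartH '' (G.part N.W N.J).extOf K.J ((G.part N.W N.J).vert x) =
      G.extOf κ.J (G.vert (ofPartH x)) := by
  rw [image_extOf_part (ofPartH_mem K), hK]
  rfl

/-- A component of `κ` may be a whole component of `N` without being one of `G`, whence the second
clause. -/
theorem kept_part_iff (x : (G.part N.W N.J).H) : K.Kept x ↔ κ.Kept (ofPartH x) ∧
    ∃ g ∈ G.extOf κ.J (G.vert (ofPartH x)), g ∈ N.J := by
  have h1 : ∀ y, y ∈ (G.part N.W N.J).internal ↔ ofPartH y ∈ N.J := by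
    intro y
    have : ofPartH '' (G.part N.W N.J).internal = N.J := internal_part N.2.1
    rw [← ofPartH_injective.mem_set_image, this]
  have h2 : ∀ y, y ∈ K.J ↔ ofPartH y ∈ κ.J := by
    intro y
    rw [← hK, ofPartH_injective.mem_set_image]
  rw [kept_iff N.isFeynman_part, kept_iff hG, ← image_extOf_sub hK,
    Set.ncard_image_of_injective _ ofPartH_injective, h2]
  simp only [Set.exists_mem_image, h1]
  constructor
  · rintro ⟨h3, h4, g, h5, h6⟩
    exact ⟨⟨h3, h4, g, h5, (N.isGood hG).subset_internal h6⟩, g, h5, h6⟩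
  · rintro ⟨⟨h3, h4, -⟩, h5⟩
    exact ⟨h3, h4, h5⟩

theorem through_part_iff (x y : (G.part N.W N.J).H) :
    K.Through x y ↔ κ.Through (ofPartH x) (ofPartH y) := by
  rw [through_iff N.isFeynman_part, through_iff hG, ← image_extOf_sub hK, ← Set.image_pair,
    ofPartH_injective.image_injective.eq_iff, ofPartH_injective.ne_iff]

/-- `N.J` is compatible with `κ`, so a link that starts in it never leaves it. -/
theorem link_part_iff (x y : (G.part N.W N.J).H) : K.Link x y ↔
    κ.Link (ofPartH x) (ofPartH y) ∧ ofPartH x ∈ N.J ∧ ofPartH y ∈ N.J := by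
  have hC := compatible_of_part hG hK
  constructor
  · intro h
    suffices h' : κ.Link (ofPartH x) (ofPartH y) ∧ ofPartH x ∈ N.J from
      ⟨h'.1, h'.2, (hC.mem_of_link hG h'.1 h'.2).1⟩
    induction h with
    | adj h => exact ⟨.adj h.1, h.2.1⟩
    | through _ h2 h3 ih => exact ⟨.through ih.1 ((through_part_iff hG hK _ _).1 h2) h3.1, ih.2⟩
  · rintro ⟨h, hx, -⟩
    have : ∀ k, κ.Link (ofPartH x) k → ∃ y : (G.part N.W N.J).H, ofPartH y = k ∧ K.Link x y := by
      intro k hk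
      induction hk with
      | adj h =>
        have hk := hC.mem_right hG hx h
        obtain ⟨y, rfl⟩ := exists_ofPartH (vert_mem_W hk)
        exact ⟨y, rfl, .adj ⟨h, hx, hk⟩⟩
      | through h1 h2 h3 ih =>
        obtain ⟨a, rfl, ha⟩ := ih
        have hb := hC.through _ _ h2 (hC.mem_of_link hG h1 hx).1
        have hk := hC.mem_right hG hb h3
        obtain ⟨b, rfl⟩ := exists_ofPartH (vert_mem_W hb)
        obtain ⟨y, rfl⟩ := exists_ofPartH (vert_mem_W hk)
        exact ⟨y, rfl, .through ha ((through_part_iff hG hK _ _).2 h2) ⟨h3, hb, hk⟩⟩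
    obtain ⟨z, hz, hz'⟩ := this _ h
    rwa [← ofPartH_injective hz]

theorem contract_part_iso (hL : L.J = ofContract ⁻¹' N.J) :
    K.contract.Iso (κ.contract.part L.W L.J) := by
  have hC := compatible_of_part hG hK
  have hmem : ∀ x, x ∈ L.J ↔ ofContract x ∈ N.J := fun x => by rw [hL]; rfl
  refine iso_of_halfEdges (f := fun x => ofPartH (ofContract x))
    (g := fun x => ofContract (ofPartH x))
    (ofPartH_injective.comp ofContract_injective) (ofContract_injective.comp ofPartH_injective) ?_
    (vert_contract_surjective N.isFeynman_part) L.isFeynman_part.vert_surjective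
    (fun h k => G.vert k ∈ G.compOf κ.J (G.vert h))
    (fun h k => κ.Link h k ∧ h ∈ N.J ∧ k ∈ N.J) ?_ ?_ ?_ ?_
  · ext h
    trans κ.Kept h ∧ ∃ g ∈ G.extOf κ.J (G.vert h), g ∈ N.J
    · constructor
      · rintro ⟨x, rfl⟩
        exact (kept_part_iff hG hK _).1 (kept_ofContract x)
      · rintro ⟨hh, g, hg, hgN⟩
        have hW : G.vert h ∈ N.W := by
          refine compOf_subset_W (vert_mem_W hgN) ?_
          exact compOf_mono hC.subset _ (hG.isBasic.compOf_symm hg.1)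
        obtain ⟨x, rfl⟩ := exists_ofPartH hW
        obtain ⟨x, rfl⟩ := exists_ofContract ((kept_part_iff hG hK x).2 ⟨hh, g, hg, hgN⟩)
        exact ⟨x, rfl⟩
    · constructor
      · rintro ⟨hh, g, hg, hgN⟩
        obtain ⟨x, rfl⟩ := exists_ofContract hh
        obtain ⟨y, rfl⟩ := exists_ofContract (hh.of_comp hG hg.1 hg.2)
        have hx : κ.contract.vert x ∈ L.W := by
          rw [(vert_contract_eq_iff hG).2 hg.1]
          exact vert_mem_W ((hmem y).2 hgN)
        obtain ⟨x, rfl⟩ := exists_ofPartH hx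
        exact ⟨x, rfl⟩
      · rintro ⟨x, rfl⟩
        refine ⟨kept_ofContract _, ?_⟩
        have hx : κ.contract.vert (ofPartH x) ∈ L.W := x.2
        obtain ⟨y, hy, hxy⟩ := (mem_W_iff (isFeynman_contract κ hG)).1 hx
        exact ⟨ofContract y, ⟨(vert_contract_eq_iff hG).1 (Eq.symm hxy),
          ofContract_notMem_J hG y⟩, (hmem y).1 hy⟩
  · intro x y
    rw [vert_contract_eq_iff N.isFeynman_part, ← ofPartV_injective.mem_set_image,
      image_compOf_part (ofPartH_mem K), hK]
    rfl
  · intro x y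
    rw [vert_part_eq_iff, vert_contract_eq_iff hG]
  · intro x y
    exact link_part_iff hG hK _ _
  · intro x y
    rw [← hmem, ← hmem]
    rfl

end PartContract

/-! ### Contracting in two stages: `(G / κ) / (N / κ)`. -/

section ContractContract

variable (hN : κ.J ⊆ N.J)
include hN

/-- Otherwise the component of `h` in `κ` is two-legged and is also its component in `N`, which has
three legs. -/
theorem kept_of_kept_of_subset {h : G.H} (h' : N.Kept h) : κ.Kept h := by
  have hC := compatible_of_isGood hG (N.isGood hG) hN
  obtain ⟨h1, h2, g, hg, hgI⟩ := (kept_iff hG).1 h'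
  by_contra hk
  have hc := hC.compOf_eq hG h1 hk
  have hsub : G.extOf N.J (G.vert h) ⊆ G.extOf κ.J (G.vert h) := fun x hx =>
    ⟨hc ▸ hx.1, fun hJ => hx.2 (hN hJ)⟩
  have hg' := hsub hg
  rcases kept_or_through hG hg'.2 hgI with h3 | ⟨b, hb⟩
  · exact hk (h3.of_comp hG (hG.isBasic.compOf_symm hg'.1) fun hJ => h1 (hN hJ))
  · rw [← hG.isBasic.extOf_eq hg'.1, ((through_iff hG).1 hb).1] at hsub
    have := Set.ncard_le_ncard hsub (Set.toFinite _)
    have h4 := Set.ncard_pair ((through_iff hG).1 hb).2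
    omega

theorem Through.of_subset {a b : G.H} (hab : κ.Through a b) (ha : a ∉ N.J) : N.Through a b := by
  have hC := compatible_of_isGood hG (N.isGood hG) hN
  have hc := hC.compOf_eq hG ha (hab.not_kept hG)
  have h1 := (through_iff hG).1 hab
  refine (through_iff hG).2 ⟨?_, h1.2⟩
  rw [← h1.1]
  ext x
  constructor
  · exact fun hx => ⟨hc ▸ hx.1, fun hJ => hx.2 (hN hJ)⟩
  · intro hx
    refine ⟨hc ▸ hx.1, fun hJ => ?_⟩
    rcases hab.eq_or_eq hG hx.1 hx.2 with rfl | rfl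
    · exact ha hJ
    · exact ha (hC.through _ _ (hab.symm hG) hJ)

theorem Link.of_subset {h k : G.H} (hk : κ.Link h k) (hh : h ∉ N.J) : N.Link h k := by
  have hC := compatible_of_isGood hG (N.isGood hG) hN
  induction hk with
  | adj h => exact .adj h
  | through h1 h2 h3 ih =>
    exact .through ih (h2.of_subset hG hN fun ha => hh ((hC.mem_iff_of_link hG h1).2 ha)) h3

variable (hL : L.J = ofContract ⁻¹' N.J)
include hL

theorem kept_contract_iff (x : κ.contract.H) : L.Kept x ↔ N.Kept (ofContract x) := by
  have hC := compatible_of_isGood hG (N.isGood hG) hN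
  rw [kept_iff (isFeynman_contract κ hG), kept_iff hG, ← image_extOf_contract hG hC,
    Set.ncard_image_of_injective _ ofContract_injective, hL, ← preimage_internal hG]
  simp only [Set.exists_mem_image]
  rfl

theorem through_contract_iff (x y : κ.contract.H) :
    L.Through x y ↔ N.Through (ofContract x) (ofContract y) := by
  have hC := compatible_of_isGood hG (N.isGood hG) hN
  rw [through_iff (isFeynman_contract κ hG), through_iff hG, ← image_extOf_contract hG hC,
    ← Set.image_pair, ofContract_injective.image_injective.eq_iff, ofContract_injective.ne_iff, hL]

/-- A two-legged component of `N` on the chain either is a two-legged component of `κ`, absorbed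
into an edge of `G/κ`, or survives as a two-legged component of `L`. -/
theorem link_contract_iff {x y : κ.contract.H} (hx : ofContract x ∉ N.J) :
    L.Link x y ↔ N.Link (ofContract x) (ofContract y) := by
  have hC := compatible_of_isGood hG (N.isGood hG) hN
  constructor
  · intro h
    induction h with
    | adj h => exact Link.of_subset hG hN h hx
    | through _ h2 h3 ih =>
      have hb := (through_contract_iff hG hN hL _ _).1 h2
      exact ih.trans_step hb (Link.of_subset hG hN h3 hb.mem_ext.2)
  · intro h
    -- Here `z` is the start of the current link of `κ`: the half-edge `x`, or the far leg of the
    -- last component of `L` traversed.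
    have : ∀ k, N.Link (ofContract x) k → ∃ z, (z = x ∨ ∃ a, L.Link x a ∧ L.Through a z) ∧
        κ.Link (ofContract z) k := by
      intro k hk
      induction hk with
      | adj h => exact ⟨x, .inl rfl, .adj h⟩
      | through h1 h2 h3 ih =>
        obtain ⟨z, hz, hza⟩ := ih
        have ha := h2.left_mem_ext.2
        rcases kept_or_through hG (fun h => ha (hN h)) (hza.right_internal hG) with h4 | ⟨c, hc⟩
        · obtain ⟨a, rfl⟩ := exists_ofContract h4
          obtain ⟨b, rfl⟩ := exists_ofContract
            (hC.kept_of_comp hG a h2.mem_ext.2 h2.mem_ext.1)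
          refine ⟨b, .inr ⟨a, ?_, (through_contract_iff hG hN hL _ _).2 h2⟩, .adj h3⟩
          rcases hz with rfl | ⟨d, hd, hd'⟩
          · exact .adj hza
          · exact .through hd hd' hza
        · have := (hc.of_subset hG hN ha).unique hG h2
          rw [this] at hc
          exact ⟨z, hz, .through hza hc h3⟩
    obtain ⟨z, rfl | ⟨d, hd, hd'⟩, hz'⟩ := this _ h
    · exact .adj hz'
    · exact .through hd hd' hz'

theorem contract_contract_iso : L.contract.Iso N.contract := by
  have hC := compatible_of_isGood hG (N.isGood hG) hN
  refine iso_of_halfEdges (f := fun x => ofContract (ofContract x)) (g := ofContract)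
    (ofContract_injective.comp ofContract_injective) ofContract_injective ?_
    (vert_contract_surjective (isFeynman_contract κ hG)) (vert_contract_surjective hG)
    (fun h k => G.vert k ∈ G.compOf N.J (G.vert h)) N.Link ?_ (fun x y => vert_contract_eq_iff hG)
    ?_ fun x y => Iff.rfl
  · ext h
    constructor
    · rintro ⟨x, rfl⟩
      exact exists_ofContract ((kept_contract_iff hG hN hL _).1 (kept_ofContract x))
    · rintro ⟨x, rfl⟩
      obtain ⟨y, hy⟩ := exists_ofContract (kept_of_kept_of_subset hG hN (kept_ofContract x))
      have := kept_ofContract x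
      rw [← hy, ← kept_contract_iff hG hN hL] at this
      obtain ⟨y, rfl⟩ := exists_ofContract this
      exact ⟨y, hy⟩
  · intro x y
    rw [vert_contract_eq_iff (isFeynman_contract κ hG), hL, mem_compOf_contract_iff hG hC]
  · intro x y
    refine link_contract_iff hG hN hL ?_
    exact ((kept_iff hG).1 ((kept_contract_iff hG hN hL _).1 (kept_ofContract x))).1

end ContractContract

omit hG in
theorem isGood_image_iff (hG : G.IsFeynman) {J : Set (G.part N.W N.J).H}
    (hJ : ∀ h ∈ J, ofPartH h ∈ N.J) : (G.part N.W N.J).IsGood J ↔ G.IsGood (ofPartH '' J) :=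
  isGood_part_iff hG.trivalent hJ

/-- Both kinds of flags are encoded by pairs `B ⊂ A` of good sets of half-edges of `G`. -/
theorem exists_equiv_chain :
    ∃ e : (Σ N : G.Subgraph, (G.part N.W N.J).Subgraph) ≃ Σ κ : G.Subgraph, κ.contract.Subgraph,
      ∀ x, (G.part (e x).1.W (e x).1.J).Iso ((G.part x.1.W x.1.J).part x.2.W x.2.J) ∧
        ((e x).1.contract.part (e x).2.W (e x).2.J).Iso x.2.contract ∧
        (e x).2.contract.Iso x.1.contract := by
  obtain ⟨e, he⟩ := exists_equiv_of_range_eq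
    (φ := fun x : Σ N : G.Subgraph, (G.part N.W N.J).Subgraph => (x.1.J, ofPartH '' x.2.J))
    (ψ := fun x : Σ κ : G.Subgraph, κ.contract.Subgraph => (x.1.lift x.2.J, x.1.J)) (by
      rintro ⟨N, K⟩ ⟨N', K'⟩ h
      obtain ⟨h1, h2⟩ := Prod.mk.inj h
      obtain rfl := J_injective hG h1
      obtain rfl := J_injective N.isFeynman_part (ofPartH_injective.image_injective h2)
      rfl) (by
      rintro ⟨κ, L⟩ ⟨κ', L'⟩ h
      obtain ⟨h1, h2⟩ := Prod.mk.inj h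
      obtain rfl := J_injective hG h2
      have hF := isFeynman_contract κ hG
      have h3 : L.J = L'.J := by
        rw [← preimage_lift hG (L.isGood hF).closed, ← preimage_lift hG (L'.isGood hF).closed]
        exact congrArg _ h1
      obtain rfl := J_injective hF h3
      rfl) (by
      ext ⟨A, B⟩
      trans G.IsGood A ∧ G.IsGood B ∧ B ⊆ A
      · constructor
        · rintro ⟨⟨N, K⟩, h⟩
          obtain ⟨rfl, rfl⟩ := Prod.mk.inj h
          refine ⟨N.isGood hG, (isGood_image_iff hG (ofPartH_mem K)).1 (K.isGood N.isFeynman_part), ?_⟩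
          rintro _ ⟨x, hx, rfl⟩
          exact ofPartH_mem K x hx
        · rintro ⟨hA, hB, hBA⟩
          obtain ⟨N, rfl⟩ := exists_J_eq hG hA
          have hB' : ofPartH '' (ofPartH (W := N.W) (J := N.J) ⁻¹' B) = B := by
            refine Set.image_preimage_eq_of_subset fun h hh => ?_
            exact exists_ofPartH (vert_mem_W (hBA hh))
          rw [← hB'] at hB
          replace hB := (isGood_image_iff hG fun h hh => hBA hh).2 hB
          obtain ⟨K, hK⟩ := exists_J_eq N.isFeynman_part hB
          exact ⟨⟨N, K⟩, Prod.ext rfl ((congrArg _ hK).trans hB')⟩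
      · constructor
        · rintro ⟨hA, hB, hBA⟩
          obtain ⟨κ, rfl⟩ := exists_J_eq hG hB
          have hC := compatible_of_isGood hG hA hBA
          obtain ⟨L, hL⟩ := exists_J_eq (isFeynman_contract κ hG) (isGood_contract hG hC hA)
          exact ⟨⟨κ, L⟩, Prod.ext ((congrArg _ hL).trans (lift_preimage hG hC)) rfl⟩
        · rintro ⟨⟨κ, L⟩, h⟩
          obtain ⟨rfl, rfl⟩ := Prod.mk.inj h
          have hL := L.isGood (isFeynman_contract κ hG)
          exact ⟨isGood_lift hG hL, κ.isGood hG, Set.subset_union_left⟩)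
  refine ⟨e, ?_⟩
  intro x
  obtain ⟨h1, h2⟩ := Prod.mk.inj (he x)
  generalize e x = y at h1 h2 ⊢
  obtain ⟨N, K⟩ := x
  obtain ⟨κ, L⟩ := y
  dsimp only at h1 h2 ⊢
  have hL : L.J = ofContract ⁻¹' N.J := by
    rw [← h1, preimage_lift hG (L.isGood (isFeynman_contract κ hG)).closed]
  exact ⟨iso_equivalence.symm (part_part_iso hG h2.symm),
    iso_equivalence.symm (contract_part_iso hG h2.symm hL),
    contract_contract_iso hG (subset_of_part h2.symm) hL⟩

/-! ### The trivial subgraphs -/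

omit hG in
theorem iso_empty_iff {A : HGraph.{u}} (hA : Function.Surjective A.vert) :
    A.Iso empty ↔ IsEmpty A.H := by
  constructor
  · rintro ⟨-, e, -⟩
    exact ⟨fun h => (e h).elim⟩
  · intro h
    have : IsEmpty A.V := ⟨fun v => h.elim (hA v).choose⟩
    exact ⟨Equiv.equivOfIsEmpty A.V PEmpty, Equiv.equivOfIsEmpty A.H PEmpty, fun x => h.elim x,
      fun x => h.elim x⟩

theorem exists_bot : ∃ N : G.Subgraph, N.contract.Iso G ∧
    ∀ N' : G.Subgraph, (G.part N'.W N'.J).Iso empty ↔ N' = N := by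
  have hJ : ∀ v, G.compOf ∅ v = {v} := fun v => compOf_eq_singleton fun h hh => hh.elim
  have hE : ∀ v, G.extOf ∅ v = {h | G.vert h = v} := fun v => by
    ext h
    simp [extOf, hJ]
  have hgood : G.IsGood ∅ := by
    refine ⟨fun h hh => hh.elim, fun v => .inr ?_, fun U h hU => ?_⟩
    · rw [hE, hG.trivalent]
    · have : h ∈ G.boundary ∅ U := by rw [hU]; rfl
      exact this.1
  obtain ⟨N, hN⟩ := exists_J_eq hG hgood
  have hkept : ∀ h, N.Kept h := by
    intro h
    rw [kept_iff hG, hN, hE, hG.trivalent]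
    obtain ⟨g, hg, hg'⟩ := hG.exists_internal (G.vert h)
    exact ⟨Set.notMem_empty _, rfl, g, hg', hg⟩
  refine ⟨N, ?_, fun N' => ?_⟩
  · refine iso_of_halfEdges (f := ofContract) (g := id) ofContract_injective Function.injective_id
      ?_ (vert_contract_surjective hG) hG.vert_surjective (fun h k => G.vert h = G.vert k) G.adj
      (fun x y => ?_) (fun _ _ => Iff.rfl) (fun x y => ?_) fun _ _ => Iff.rfl
    · ext h
      simpa using exists_ofContract (hkept h)
    · rw [vert_contract_eq_iff hG, hN, hJ]
      exact eq_comm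
    · refine adj_contract.trans ⟨fun h => ?_, fun h => .adj h⟩
      cases h with
      | adj h => exact h
      | through _ h _ => exact absurd (hkept _) (h.not_kept hG)
  · rw [iso_empty_iff N'.isFeynman_part.vert_surjective, ← (J_injective hG).eq_iff, hN]
    constructor
    · intro h
      refine Set.eq_empty_iff_forall_notMem.2 fun x hx => ?_
      exact h.elim ⟨x, vert_mem_W hx⟩
    · intro h
      refine ⟨fun x => ?_⟩
      obtain ⟨y, hy, -⟩ := (mem_W_iff hG).1 x.2
      rw [h] at hy
      exact hy

/-- An internal half-edge missing from a subgraph is linked to a kept one, so only the full subgraph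
has an empty quotient. -/
theorem exists_top : ∃ N : G.Subgraph, (G.part N.W N.J).Iso G ∧
    ∀ N' : G.Subgraph, N'.contract.Iso empty ↔ N' = N := by
  obtain ⟨N, hN⟩ := exists_J_eq hG hG.isGood_internal
  have hW : ∀ v, v ∈ N.W := by
    intro v
    obtain ⟨h, hh, rfl⟩ := hG.exists_internal v
    exact vert_mem_W (by rwa [hN])
  refine ⟨N, ?_, fun N' => ?_⟩
  · refine iso_of_halfEdges (f := ofPartH) (g := id) ofPartH_injective Function.injective_id
      ?_ N.isFeynman_part.vert_surjective hG.vert_surjective (fun h k => G.vert h = G.vert k) G.adj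
      (fun x y => vert_part_eq_iff) (fun _ _ => Iff.rfl) (fun x y => ?_) fun _ _ => Iff.rfl
    · ext h
      simpa using exists_ofPartH (hW (G.vert h))
    · refine ⟨fun h => h.1, fun h => ⟨h, ?_, ?_⟩⟩
      · rw [hN]
        exact mem_internal.2 ⟨_, h⟩
      · rw [hN]
        exact hG.isBasic.mem_internal_right h
  · rw [iso_empty_iff (vert_contract_surjective hG), ← (J_injective hG).eq_iff, hN]
    constructor
    · intro h
      refine Set.Subset.antisymm (N'.isGood hG).subset_internal fun x hx => ?_
      by_contra hJ
      obtain ⟨k, hk, -⟩ := exists_link hG hJ hx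
      exact h.elim ⟨k, hk⟩
    · intro h
      refine ⟨fun x => ?_⟩
      obtain ⟨-, -, g, hg, hg'⟩ := (kept_iff hG).1 (kept_ofContract x)
      rw [h] at hg
      exact hg.2 hg'

end Subgraph


/-! ### Disjoint unions -/

/-- `A` is embedded in `B` as a union of connected components. -/
structure Summand (A B : HGraph.{u}) where
  fV : A.V → B.V
  fH : A.H → B.H
  injV : Function.Injective fV
  injH : Function.Injective fH
  vert : ∀ h, B.vert (fH h) = fV (A.vert h)
  adj : ∀ h k, B.adj (fH h) (fH k) ↔ A.adj h k
  closed : ∀ h k, B.adj (fH h) k → ∃ l, fH l = k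
  full : ∀ h v, B.vert h = fV v → ∃ l, fH l = h

namespace Summand

variable {A B : HGraph.{u}} (f : Summand A B)

theorem exists_fH {h : B.H} {v : A.V} (hh : B.vert h = f.fV v) :
    ∃ l, f.fH l = h ∧ A.vert l = v := by
  obtain ⟨l, rfl⟩ := f.full h v hh
  exact ⟨l, rfl, f.injV ((f.vert l).symm.trans hh)⟩

theorem exists_adj {h : A.H} {k : B.H} (hk : B.adj (f.fH h) k) : ∃ l, f.fH l = k ∧ A.adj h l := by
  obtain ⟨l, rfl⟩ := f.closed h k hk
  exact ⟨l, rfl, (f.adj _ _).1 hk⟩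

theorem image_compOf (J : Set B.H) (v : A.V) :
    f.fV '' A.compOf (f.fH ⁻¹' J) v = B.compOf J (f.fV v) := by
  ext w
  constructor
  · rintro ⟨w, hw, rfl⟩
    induction hw with
    | refl => exact self_mem_compOf _ _
    | tail _ h ih =>
      obtain ⟨x, hx, y, hy, hxy, rfl, rfl⟩ := h
      rw [← f.vert] at ih ⊢
      exact compOf_trans ih (vert_mem_compOf hx hy ((f.adj _ _).2 hxy))
  · intro hw
    induction hw with
    | refl => exact ⟨v, self_mem_compOf _ _, rfl⟩
    | tail _ h ih =>
      obtain ⟨x, hx, y, hy, hxy, rfl, rfl⟩ := h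
      obtain ⟨w, hw, hw'⟩ := ih
      obtain ⟨x, rfl, rfl⟩ := f.exists_fH hw'.symm
      obtain ⟨y, rfl, hxy'⟩ := f.exists_adj hxy
      exact ⟨A.vert y, compOf_trans hw (vert_mem_compOf hx hy hxy'), (f.vert y).symm⟩

theorem image_extOf (J : Set B.H) (v : A.V) :
    f.fH '' A.extOf (f.fH ⁻¹' J) v = B.extOf J (f.fV v) := by
  ext h
  constructor
  · rintro ⟨h, ⟨h1, h2⟩, rfl⟩
    refine ⟨?_, h2⟩
    rw [← image_compOf, f.vert]
    exact ⟨_, h1, rfl⟩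
  · rintro ⟨h1, h2⟩
    rw [← image_compOf] at h1
    obtain ⟨w, hw, hw'⟩ := h1
    obtain ⟨x, rfl, rfl⟩ := f.exists_fH hw'.symm
    exact ⟨x, ⟨hw, h2⟩, rfl⟩

theorem fH_mem_boundary {J : Set B.H} {U : Set B.V} {h : A.H} :
    f.fH h ∈ B.boundary J U ↔ h ∈ A.boundary (f.fH ⁻¹' J) (f.fV ⁻¹' U) := by
  constructor
  · rintro ⟨h1, h2, k, hk, hhk, hkU⟩
    obtain ⟨k, rfl, hhk'⟩ := f.exists_adj hhk
    rw [f.vert] at h2 hkU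
    exact ⟨h1, h2, k, hk, hhk', hkU⟩
  · rintro ⟨h1, h2, k, hk, hhk, hkU⟩
    refine ⟨h1, ?_, f.fH k, hk, (f.adj _ _).2 hhk, ?_⟩
    · rw [f.vert]
      exact h2
    · rw [f.vert]
      exact hkU

theorem isGood_preimage {J : Set B.H} (hJ : B.IsGood J) : A.IsGood (f.fH ⁻¹' J) := by
  refine ⟨fun h hh => ?_, fun v => ?_, fun U h hU => ?_⟩
  · obtain ⟨k, hk, hhk⟩ := hJ.closed _ hh
    obtain ⟨k, rfl, hhk'⟩ := f.exists_adj hhk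
    exact ⟨k, hk, hhk'⟩
  · rw [← Set.ncard_image_of_injective _ f.injH, f.image_extOf]
    exact hJ.ext _
  · refine hJ.bridgeless (f.fV '' U) (f.fH h) ?_
    rw [← Set.preimage_image_eq U f.injV] at hU
    refine Set.Subset.antisymm (fun x hx => ?_) ?_
    · obtain ⟨v, -, hv⟩ := hx.2.1
      obtain ⟨x, rfl, rfl⟩ := f.exists_fH hv.symm
      rw [f.fH_mem_boundary, hU] at hx
      exact congrArg f.fH hx
    · rw [Set.singleton_subset_iff, f.fH_mem_boundary, hU]
      rfl

theorem fH_mem_internal {h : A.H} : f.fH h ∈ B.internal ↔ h ∈ A.internal := by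
  rw [mem_internal, mem_internal]
  constructor
  · rintro ⟨k, hk⟩
    obtain ⟨k, -, hk'⟩ := f.exists_adj hk
    exact ⟨k, hk'⟩
  · rintro ⟨k, hk⟩
    exact ⟨_, (f.adj _ _).2 hk⟩

variable (hA : A.IsFeynman) (hB : B.IsFeynman) {α : A.Subgraph} {β : B.Subgraph}
  (hJ : α.J = f.fH ⁻¹' β.J)
include hA hB hJ

theorem mem_W_iff {v : A.V} : v ∈ α.W ↔ f.fV v ∈ β.W := by
  rw [Subgraph.mem_W_iff hA, Subgraph.mem_W_iff hB, hJ]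
  constructor
  · rintro ⟨h, hh, rfl⟩
    exact ⟨f.fH h, hh, f.vert h⟩
  · rintro ⟨h, hh, hv⟩
    obtain ⟨h, rfl, rfl⟩ := f.exists_fH hv
    exact ⟨h, hh, rfl⟩

theorem kept_iff {h : A.H} : α.Kept h ↔ β.Kept (f.fH h) := by
  rw [Subgraph.kept_iff hA, Subgraph.kept_iff hB, f.vert, ← f.image_extOf, ← hJ,
    Set.ncard_image_of_injective _ f.injH, Set.exists_mem_image, hJ]
  simp only [f.fH_mem_internal]
  rfl

theorem through_iff {a b : A.H} : α.Through a b ↔ β.Through (f.fH a) (f.fH b) := by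
  rw [Subgraph.through_iff hA, Subgraph.through_iff hB, f.vert, ← f.image_extOf, ← hJ,
    ← Set.image_pair, f.injH.image_injective.eq_iff, f.injH.ne_iff]

/-- Edges and components that meet a summand lie in it, so links cannot leave it. -/
theorem exists_link {h : A.H} {k : B.H} (hk : β.Link (f.fH h) k) :
    ∃ l, f.fH l = k ∧ α.Link h l := by
  induction hk with
  | adj h =>
    obtain ⟨l, rfl, hl⟩ := f.exists_adj h
    exact ⟨l, rfl, .adj hl⟩
  | through _ h2 h3 ih =>
    obtain ⟨a, rfl, ha⟩ := ih
    have hb := h2.mem_ext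
    rw [f.vert, ← f.image_extOf] at hb
    obtain ⟨b, -, rfl⟩ := hb
    obtain ⟨l, rfl, hl⟩ := f.exists_adj h3
    exact ⟨l, rfl, .through ha ((f.through_iff hA hB hJ).2 h2) hl⟩

theorem link_iff {h k : A.H} : α.Link h k ↔ β.Link (f.fH h) (f.fH k) := by
  constructor
  · intro hk
    induction hk with
    | adj h => exact .adj ((f.adj _ _).2 h)
    | through _ h2 h3 ih => exact .through ih ((f.through_iff hA hB hJ).1 h2) ((f.adj _ _).2 h3)
  · intro hk
    obtain ⟨l, hl, hl'⟩ := f.exists_link hA hB hJ hk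
    rwa [← f.injH hl]

end Summand

theorem disjUnion_iso_of_halfEdges {A A' B : HGraph.{u}} {Z : Type*} {p : A.H → Z} {p' : A'.H → Z}
    {q : B.H → Z} (hp : Function.Injective p) (hp' : Function.Injective p')
    (hd : ∀ x y, p x ≠ p' y) (hq : Function.Injective q)
    (hr : ∀ z, (∃ x, q x = z) ↔ (∃ x, p x = z) ∨ ∃ x, p' x = z)
    (hA : Function.Surjective A.vert) (hA' : Function.Surjective A'.vert)
    (hB : Function.Surjective B.vert) (R S : Z → Z → Prop)
    (hRA : ∀ x y, A.vert x = A.vert y ↔ R (p x) (p y))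
    (hRA' : ∀ x y, A'.vert x = A'.vert y ↔ R (p' x) (p' y))
    (hR : ∀ x y, ¬ R (p x) (p' y)) (hR' : ∀ x y, ¬ R (p' x) (p y))
    (hRB : ∀ x y, B.vert x = B.vert y ↔ R (q x) (q y))
    (hSA : ∀ x y, A.adj x y ↔ S (p x) (p y)) (hSA' : ∀ x y, A'.adj x y ↔ S (p' x) (p' y))
    (hS : ∀ x y, ¬ S (p x) (p' y)) (hS' : ∀ x y, ¬ S (p' x) (p y))
    (hSB : ∀ x y, B.adj x y ↔ S (q x) (q y)) : (A.disjUnion A').Iso B := by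
  refine iso_of_halfEdges (A := A.disjUnion A') (f := Sum.elim p p') (g := q)
    (hp.sumElim hp' hd) hq ?_ (hA.sumMap hA') hB R S ?_ hRB ?_ hSB
  · ext z
    exact Sum.exists.trans (hr z).symm
  · rintro (x | x) (y | y)
    · exact Sum.inl_injective.eq_iff.trans (hRA x y)
    · exact ⟨fun h => absurd h Sum.inl_ne_inr, fun h => absurd h (hR x y)⟩
    · exact ⟨fun h => absurd h Sum.inr_ne_inl, fun h => absurd h (hR' x y)⟩
    · exact Sum.inr_injective.eq_iff.trans (hRA' x y)
  · rintro (x | x) (y | y)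
    · exact Sum.liftRel_inl_inl.trans (hSA x y)
    · exact ⟨fun h => absurd h Sum.not_liftRel_inl_inr, fun h => absurd h (hS x y)⟩
    · exact ⟨fun h => absurd h Sum.not_liftRel_inr_inl, fun h => absurd h (hS' x y)⟩
    · exact Sum.liftRel_inr_inr.trans (hSA' x y)

theorem exists_summands {A A' B : HGraph.{u}} (h : (A.disjUnion A').Iso B) :
    ∃ (f : Summand A B) (g : Summand A' B), (∀ v, (∃ w, f.fV w = v) ∨ ∃ w, g.fV w = v) ∧
      (∀ v w, f.fV v ≠ g.fV w) := by
  obtain ⟨eV, eH, h1, h2⟩ := h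
  have hl : ∀ h, B.vert (eH (.inl h)) = eV (.inl (A.vert h)) := fun h => h1 (.inl h)
  have hr : ∀ h, B.vert (eH (.inr h)) = eV (.inr (A'.vert h)) := fun h => h1 (.inr h)
  refine ⟨⟨fun v => eV (.inl v), fun h => eH (.inl h), eV.injective.comp Sum.inl_injective,
    eH.injective.comp Sum.inl_injective, hl, fun h k => (h2 _ _).trans Sum.liftRel_inl_inl,
    ?_, ?_⟩, ⟨fun v => eV (.inr v), fun h => eH (.inr h), eV.injective.comp Sum.inr_injective,
    eH.injective.comp Sum.inr_injective, hr, fun h k => (h2 _ _).trans Sum.liftRel_inr_inr,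
    ?_, ?_⟩, ?_, ?_⟩
  · intro h k hk
    obtain ⟨k | k, rfl⟩ := eH.surjective k
    · exact ⟨k, rfl⟩
    · exact absurd ((h2 _ _).1 hk) Sum.not_liftRel_inl_inr
  · intro h v hv
    obtain ⟨h | h, rfl⟩ := eH.surjective h
    · exact ⟨h, rfl⟩
    · rw [hr] at hv
      exact absurd (eV.injective hv) Sum.inr_ne_inl
  · intro h k hk
    obtain ⟨k | k, rfl⟩ := eH.surjective k
    · exact absurd ((h2 _ _).1 hk) Sum.not_liftRel_inr_inl
    · exact ⟨k, rfl⟩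
  · intro h v hv
    obtain ⟨h | h, rfl⟩ := eH.surjective h
    · rw [hl] at hv
      exact absurd (eV.injective hv) Sum.inl_ne_inr
    · exact ⟨h, rfl⟩
  · intro v
    obtain ⟨v | v, rfl⟩ := eV.surjective v
    · exact .inl ⟨v, rfl⟩
    · exact .inr ⟨v, rfl⟩
  · intro v w h
    exact Sum.inl_ne_inr (eV.injective h)

/-! ### Subgraphs and quotients of a disjoint union. -/

section DisjointUnion

variable {A A' B : HGraph.{u}} (f : Summand A B) (g : Summand A' B)
  (hfg : ∀ v, (∃ w, f.fV w = v) ∨ ∃ w, g.fV w = v) (hd : ∀ v w, f.fV v ≠ g.fV w)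
include hfg

theorem exists_fH_or (h : B.H) : (∃ x, f.fH x = h) ∨ ∃ x, g.fH x = h := by
  rcases hfg (B.vert h) with ⟨w, hw⟩ | ⟨w, hw⟩
  · exact .inl (f.full h w hw.symm)
  · exact .inr (g.full h w hw.symm)

/-- A single boundary half-edge belongs to one of the summands and is already a bridge there. -/
theorem isGood_of_summands {J : Set B.H} (hA : A.IsGood (f.fH ⁻¹' J))
    (hA' : A'.IsGood (g.fH ⁻¹' J)) : B.IsGood J := by
  have hbr : ∀ {A : HGraph.{u}} (f : Summand A B), A.IsGood (f.fH ⁻¹' J) → ∀ U h,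
      B.boundary J U ≠ {f.fH h} := by
    intro A f hA U h hU
    refine hA.bridgeless (f.fV ⁻¹' U) h ?_
    ext x
    rw [← f.fH_mem_boundary, hU]
    exact f.injH.eq_iff
  refine ⟨fun h hh => ?_, fun v => ?_, fun U h => ?_⟩
  · rcases exists_fH_or f g hfg h with ⟨h, rfl⟩ | ⟨h, rfl⟩
    · obtain ⟨k, hk, hhk⟩ := hA.closed h hh
      exact ⟨_, hk, (f.adj _ _).2 hhk⟩
    · obtain ⟨k, hk, hhk⟩ := hA'.closed h hh
      exact ⟨_, hk, (g.adj _ _).2 hhk⟩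
  · rcases hfg v with ⟨v, rfl⟩ | ⟨v, rfl⟩
    · rw [← f.image_extOf, Set.ncard_image_of_injective _ f.injH]
      exact hA.ext v
    · rw [← g.image_extOf, Set.ncard_image_of_injective _ g.injH]
      exact hA'.ext v
  · rcases exists_fH_or f g hfg h with ⟨h, rfl⟩ | ⟨h, rfl⟩
    · exact hbr f hA U h
    · exact hbr g hA' U h

variable (hA : A.IsFeynman) (hA' : A'.IsFeynman) (hB : B.IsFeynman)
  {α : A.Subgraph} {α' : A'.Subgraph} {β : B.Subgraph}
  (hJ : α.J = f.fH ⁻¹' β.J) (hJ' : α'.J = g.fH ⁻¹' β.J)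
include hd hA hA' hB hJ hJ'

theorem part_disjUnion_iso :
    ((A.part α.W α.J).disjUnion (A'.part α'.W α'.J)).Iso (B.part β.W β.J) := by
  have hv : ∀ x y, B.vert (f.fH x) ≠ B.vert (g.fH y) := fun x y => by
    rw [f.vert, g.vert]
    exact hd _ _
  have hadj : ∀ x y, ¬ B.adj (f.fH x) (g.fH y) := fun x y h => by
    obtain ⟨z, hz⟩ := f.closed _ _ h
    exact hv z y (by rw [hz])
  refine disjUnion_iso_of_halfEdges (p := fun x => f.fH (ofPartH x)) (p' := fun x => g.fH (ofPartH x))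
    (q := ofPartH) (f.injH.comp ofPartH_injective) (g.injH.comp ofPartH_injective)
    (fun x y h => hv _ _ (congrArg _ h)) ofPartH_injective (fun z => ?_)
    α.isFeynman_part.vert_surjective α'.isFeynman_part.vert_surjective
    β.isFeynman_part.vert_surjective (fun h k => B.vert h = B.vert k)
    (fun h k => B.adj h k ∧ h ∈ β.J ∧ k ∈ β.J) (fun x y => ?_) (fun x y => ?_)
    (fun x y => hv _ _) (fun x y h => hv _ _ (Eq.symm h)) (fun x y => Subgraph.vert_part_eq_iff)
    (fun x y => ?_) (fun x y => ?_) (fun x y h => hadj _ _ h.1)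
    (fun x y h => hadj _ _ (hB.symm _ _ h.1)) fun x y => Iff.rfl
  · constructor
    · rintro ⟨x, rfl⟩
      have hx : B.vert (ofPartH x) ∈ β.W := x.2
      rcases exists_fH_or f g hfg (ofPartH x) with ⟨y, hy⟩ | ⟨y, hy⟩
      · rw [← hy, f.vert, ← f.mem_W_iff hA hB hJ] at hx
        exact .inl ⟨⟨y, hx⟩, hy⟩
      · rw [← hy, g.vert, ← g.mem_W_iff hA' hB hJ'] at hx
        exact .inr ⟨⟨y, hx⟩, hy⟩
    · rintro (⟨x, rfl⟩ | ⟨x, rfl⟩)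
      · refine Subgraph.exists_ofPartH ?_
        rw [f.vert, ← f.mem_W_iff hA hB hJ]
        exact x.2
      · refine Subgraph.exists_ofPartH ?_
        rw [g.vert, ← g.mem_W_iff hA' hB hJ']
        exact x.2
  · rw [Subgraph.vert_part_eq_iff, f.vert, f.vert, f.injV.eq_iff]
  · rw [Subgraph.vert_part_eq_iff, g.vert, g.vert, g.injV.eq_iff]
  · rw [f.adj]
    change A.adj _ _ ∧ _ ∈ α.J ∧ _ ∈ α.J ↔ _
    rw [hJ]
    rfl
  · rw [g.adj]
    change A'.adj _ _ ∧ _ ∈ α'.J ∧ _ ∈ α'.J ↔ _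
    rw [hJ']
    rfl

theorem contract_disjUnion_iso : (α.contract.disjUnion α'.contract).Iso β.contract := by
  have hv : ∀ x y, B.vert (f.fH x) ≠ B.vert (g.fH y) := fun x y => by
    rw [f.vert, g.vert]
    exact hd _ _
  have hR : ∀ x y, ¬ B.vert (g.fH y) ∈ B.compOf β.J (B.vert (f.fH x)) := fun x y h => by
    rw [f.vert, g.vert, ← f.image_compOf] at h
    obtain ⟨w, -, hw⟩ := h
    exact hd _ _ hw
  have hS : ∀ x y, ¬ β.Link (f.fH x) (g.fH y) := fun x y h => by
    obtain ⟨z, hz, -⟩ := f.exists_link hA hB hJ h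
    exact hv z y (by rw [hz])
  refine disjUnion_iso_of_halfEdges (p := fun x => f.fH (Subgraph.ofContract x))
    (p' := fun x => g.fH (Subgraph.ofContract x)) (q := Subgraph.ofContract)
    (f.injH.comp Subgraph.ofContract_injective) (g.injH.comp Subgraph.ofContract_injective)
    (fun x y h => hv _ _ (congrArg _ h)) Subgraph.ofContract_injective (fun z => ?_)
    (Subgraph.vert_contract_surjective hA) (Subgraph.vert_contract_surjective hA')
    (Subgraph.vert_contract_surjective hB) (fun h k => B.vert k ∈ B.compOf β.J (B.vert h)) β.Link
    (fun x y => ?_) (fun x y => ?_) (fun x y => hR _ _)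
    (fun x y h => hR _ _ (hB.isBasic.compOf_symm h))
    (fun x y => Subgraph.vert_contract_eq_iff hB)
    (fun x y => f.link_iff hA hB hJ) (fun x y => g.link_iff hA' hB hJ') (fun x y => hS _ _)
    (fun x y h => hS _ _ (h.symm hB)) fun x y => Iff.rfl
  · constructor
    · rintro ⟨x, rfl⟩
      have hx := Subgraph.kept_ofContract x
      rcases exists_fH_or f g hfg (Subgraph.ofContract x) with ⟨y, hy⟩ | ⟨y, hy⟩
      · rw [← hy, ← f.kept_iff hA hB hJ] at hx
        exact .inl ⟨⟨y, hx⟩, hy⟩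
      · rw [← hy, ← g.kept_iff hA' hB hJ'] at hx
        exact .inr ⟨⟨y, hx⟩, hy⟩
    · rintro (⟨x, rfl⟩ | ⟨x, rfl⟩)
      · exact Subgraph.exists_ofContract
          ((f.kept_iff hA hB hJ).1 (Subgraph.kept_ofContract x))
      · exact Subgraph.exists_ofContract
          ((g.kept_iff hA' hB hJ').1 (Subgraph.kept_ofContract x))
  · rw [Subgraph.vert_contract_eq_iff hA, f.vert, f.vert, ← f.image_compOf,
      f.injV.mem_set_image, hJ]
  · rw [Subgraph.vert_contract_eq_iff hA', g.vert, g.vert, ← g.image_compOf,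
      g.injV.mem_set_image, hJ']

end DisjointUnion

namespace Subgraph

theorem exists_equiv_of_isSum {A A' B : HGraph.{u}} (hA : A.IsFeynman) (hA' : A'.IsFeynman)
    (hB : B.IsFeynman) (h : (A.disjUnion A').Iso B) :
    ∃ e : A.Subgraph × A'.Subgraph ≃ B.Subgraph, ∀ x,
      ((A.part x.1.W x.1.J).disjUnion (A'.part x.2.W x.2.J)).Iso (B.part (e x).W (e x).J) ∧
      (x.1.contract.disjUnion x.2.contract).Iso (e x).contract := by
  obtain ⟨f, g, hfg, hd⟩ := exists_summands h
  have hv : ∀ x y, f.fH x ≠ g.fH y := fun x y h => by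
    have := congrArg B.vert h
    rw [f.vert, g.vert] at this
    exact hd _ _ this
  obtain ⟨e, he⟩ := exists_equiv_of_range_eq
    (φ := fun x : A.Subgraph × A'.Subgraph => (x.1.J, x.2.J))
    (ψ := fun β : B.Subgraph => (f.fH ⁻¹' β.J, g.fH ⁻¹' β.J)) (by
      rintro ⟨α, α'⟩ ⟨ρ, ρ'⟩ h
      obtain ⟨h1, h2⟩ := Prod.mk.inj h
      obtain rfl : α = ρ := J_injective hA h1
      obtain rfl : α' = ρ' := J_injective hA' h2
      rfl) (by
      intro β β' h
      refine J_injective hB (Set.ext fun x => ?_)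
      rcases exists_fH_or f g hfg x with ⟨x, rfl⟩ | ⟨x, rfl⟩
      · exact Set.ext_iff.1 (congrArg Prod.fst h) x
      · exact Set.ext_iff.1 (congrArg Prod.snd h) x) (by
      ext ⟨D, D'⟩
      constructor
      · rintro ⟨⟨α, α'⟩, h⟩
        obtain ⟨rfl, rfl⟩ := Prod.mk.inj h
        have h1 : f.fH ⁻¹' (f.fH '' α.J ∪ g.fH '' α'.J) = α.J := by
          ext x
          simp only [Set.preimage_union, Set.preimage_image_eq _ f.injH, Set.mem_union,
            Set.mem_preimage, Set.mem_image, or_iff_left_iff_imp]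
          rintro ⟨y, -, hy⟩
          exact absurd hy.symm (hv _ _)
        have h2 : g.fH ⁻¹' (f.fH '' α.J ∪ g.fH '' α'.J) = α'.J := by
          ext x
          simp only [Set.preimage_union, Set.preimage_image_eq _ g.injH, Set.mem_union,
            Set.mem_preimage, Set.mem_image, or_iff_right_iff_imp]
          rintro ⟨y, -, hy⟩
          exact absurd hy (hv _ _)
        obtain ⟨β, hβ⟩ := exists_J_eq hB (isGood_of_summands f g hfg
          (by rw [h1]; exact α.isGood hA) (by rw [h2]; exact α'.isGood hA'))
        exact ⟨β, Prod.ext ((congrArg _ hβ).trans h1) ((congrArg _ hβ).trans h2)⟩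
      · rintro ⟨β, h⟩
        obtain ⟨rfl, rfl⟩ := Prod.mk.inj h
        obtain ⟨α, hα⟩ := exists_J_eq hA (f.isGood_preimage (β.isGood hB))
        obtain ⟨α', hα'⟩ := exists_J_eq hA' (g.isGood_preimage (β.isGood hB))
        exact ⟨(α, α'), Prod.ext hα hα'⟩)
  refine ⟨e, fun x => ?_⟩
  have h1 : x.1.J = f.fH ⁻¹' (e x).J := (congrArg Prod.fst (he x)).symm
  have h2 : x.2.J = g.fH ⁻¹' (e x).J := (congrArg Prod.snd (he x)).symm
  exact ⟨part_disjUnion_iso f g hfg hd hA hA' hB h1 h2,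
    contract_disjUnion_iso f g hfg hd hA hA' hB h1 h2⟩

theorem disjUnion_iso_self (A : HGraph.{u}) {E : HGraph.{u}} (hE : Function.Surjective E.vert)
    [IsEmpty E.H] : (A.disjUnion E).Iso A := by
  have : IsEmpty E.V := ⟨fun v => isEmptyElim (hE v).choose⟩
  refine ⟨Equiv.sumEmpty A.V E.V, Equiv.sumEmpty A.H E.H, ?_, ?_⟩
  · rintro (h | h)
    · rfl
    · exact isEmptyElim h
  · rintro (h | h) (k | k)
    · exact Sum.liftRel_inl_inl.symm
    · exact isEmptyElim k
    · exact isEmptyElim h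
    · exact isEmptyElim h

/-- Invariance under isomorphism is the case of a sum with the empty graph. -/
theorem exists_equiv_of_iso {A B : HGraph.{u}} (hA : A.IsFeynman) (hB : B.IsFeynman)
    (h : A.Iso B) : ∃ e : A.Subgraph ≃ B.Subgraph, ∀ N,
      (B.part (e N).W (e N).J).Iso (A.part N.W N.J) ∧ (e N).contract.Iso N.contract := by
  have h0 : IsEmpty empty.{u}.H := inferInstanceAs (IsEmpty PEmpty)
  obtain ⟨e, he⟩ := exists_equiv_of_isSum hA isFeynman_empty hB
    (iso_equivalence.trans (disjUnion_iso_self A isFeynman_empty.vert_surjective) h)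
  obtain ⟨E, -⟩ := exists_bot isFeynman_empty.{u}
  have : Subsingleton empty.{u}.Subgraph :=
    ⟨fun γ γ' => J_injective isFeynman_empty (Subsingleton.elim _ _)⟩
  let _ : Unique empty.{u}.Subgraph := ⟨⟨E⟩, fun _ => Subsingleton.elim _ _⟩
  refine ⟨(Equiv.prodUnique _ _).symm.trans e, fun N => ?_⟩
  have h1 : IsEmpty (empty.{u}.part E.W E.J).H := ⟨fun x => h0.elim (ofPartH x)⟩
  have h2 : IsEmpty E.contract.H := ⟨fun x => h0.elim (ofContract x)⟩
  exact ⟨iso_equivalence.trans (iso_equivalence.symm (he (N, E)).1)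
    (disjUnion_iso_self _ E.isFeynman_part.vert_surjective),
    iso_equivalence.trans (iso_equivalence.symm (he (N, E)).2)
    (disjUnion_iso_self _ (vert_contract_surjective isFeynman_empty))⟩

/-- A vertex outside `γ` survives in the quotient. This bounds the size of extensions; only an
inequality holds, since contracted components add vertices. -/
theorem card_le {G : HGraph.{u}} (γ : G.Subgraph) :
    Nat.card G.V ≤ Nat.card (G.part γ.W γ.J).V + Nat.card γ.contract.V := by
  have := G.finV
  have : Finite γ.contract.V := γ.contract.finV
  have h := Set.ncard_add_ncard_compl γ.W
  have h1 : Nat.card {v : G.V // v ∉ γ.W} ≤ Nat.card γ.contract.V :=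
    Nat.card_le_card_of_injective (fun v => (Sum.inl v : γ.contract.V)) Sum.inl_injective
  rw [← h]
  exact Nat.add_le_add_left h1 _

end Subgraph

end HGraph

/-! ### The category of Feynman graphs -/

namespace FeynmanGraph

theorem cls_eq_iff {Γ Δ : FeynmanGraph.{u}} :
    graphData.cls Γ = graphData.cls Δ ↔ Γ.1.Iso Δ.1 := HallData.cls_eq

theorem mk_eq {G : HGraph.{u}} (hG : G.IsFeynman) : FeynmanGraph.mk G = ⟨G, hG⟩ := dif_pos hG

theorem quo_eq {Γ : FeynmanGraph.{u}} (γ : Γ.1.Subgraph) :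
    (graphData.quo (B := Γ) γ : FeynmanGraph) = ⟨γ.contract, γ.isFeynman_contract Γ.2⟩ :=
  mk_eq _

/-- Trivalence fixes the number of half-edges at `3n`, so incidence and adjacency on standard finite
sets leave finitely many classes. -/
theorem finite_card_eq (n : ℕ) :
    {E : graphData.Cls | Nat.card (graphData.rep E : FeynmanGraph.{u}).1.V = n}.Finite := by
  have hV : ∀ Γ : {Γ : FeynmanGraph.{u} // Nat.card Γ.1.V = n}, Nonempty (Γ.1.1.V ≃ Fin n) :=
    fun Γ =>
      haveI := Γ.1.1.finV
      ⟨Finite.equivFinOfCardEq Γ.2⟩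
  have hH : ∀ Γ : {Γ : FeynmanGraph.{u} // Nat.card Γ.1.V = n},
      Nonempty (Γ.1.1.H ≃ Fin (3 * n)) := fun Γ => by
    have := Γ.1.1.finH
    refine ⟨Finite.equivFinOfCardEq ?_⟩
    have h := HGraph.ncard_vert_preimage Γ.1.2.trivalent Set.univ
    rw [Set.ncard_univ, Γ.2] at h
    rw [← h, ← Set.ncard_univ]
    congr 1
  let eV := fun Γ => (hV Γ).some
  let eH := fun Γ => (hH Γ).some
  let code : {Γ : FeynmanGraph.{u} // Nat.card Γ.1.V = n} →
      (Fin (3 * n) → Fin n) × (Fin (3 * n) → Fin (3 * n) → Prop) := fun Γ =>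
    (fun i => eV Γ (Γ.1.1.vert ((eH Γ).symm i)),
      fun i j => Γ.1.1.adj ((eH Γ).symm i) ((eH Γ).symm j))
  have hcode : ∀ Γ Δ, code Γ = code Δ → Γ.1.1.Iso Δ.1.1 := by
    intro Γ Δ h
    obtain ⟨h1, h2⟩ := Prod.mk.inj h
    refine ⟨(eV Γ).trans (eV Δ).symm, (eH Γ).trans (eH Δ).symm, fun x => ?_, fun x y => ?_⟩
    · have := congrFun h1 (eH Γ x)
      simp only [Equiv.symm_apply_apply] at this
      rw [Equiv.trans_apply, Equiv.trans_apply, this, Equiv.symm_apply_apply]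
    · have := congrFun (congrFun h2 (eH Γ x)) (eH Γ y)
      simp only [Equiv.symm_apply_apply] at this
      rw [Equiv.trans_apply, Equiv.trans_apply, this]
  refine Set.finite_coe_iff.1 (Finite.of_injective (fun E => code ⟨_, E.2⟩) fun E E' h => ?_)
  have := cls_eq_iff.2 (hcode _ _ h)
  exact Subtype.ext (by simpa using this)

theorem cls_quo_eq_iff {Γ Δ : FeynmanGraph.{u}} {γ : Γ.1.Subgraph} :
    graphData.cls (graphData.quo (B := Γ) γ) = graphData.cls Δ ↔ γ.contract.Iso Δ.1 := by
  have h : graphData.cls (graphData.quo (B := Γ) γ) =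
      graphData.cls (⟨γ.contract, γ.isFeynman_contract Γ.2⟩ : FeynmanGraph.{u}) :=
    congrArg graphData.cls (quo_eq γ)
  rw [h]
  exact cls_eq_iff

theorem cls_quo_eq_cls_quo_iff {Γ Δ : FeynmanGraph.{u}} {γ : Γ.1.Subgraph} {δ : Δ.1.Subgraph} :
    graphData.cls (graphData.quo (B := Γ) γ) = graphData.cls (graphData.quo (B := Δ) δ) ↔
      γ.contract.Iso δ.contract := by
  have h : graphData.cls (graphData.quo (B := Δ) δ) =
      graphData.cls (⟨δ.contract, δ.isFeynman_contract Δ.2⟩ : FeynmanGraph.{u}) :=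
    congrArg graphData.cls (quo_eq δ)
  rw [h]
  exact cls_quo_eq_iff

theorem isSum_quo {Γ Δ Λ : FeynmanGraph.{u}} {γ : Γ.1.Subgraph} {δ : Δ.1.Subgraph}
    {ε : Λ.1.Subgraph} (h : (γ.contract.disjUnion δ.contract).Iso ε.contract) :
    graphData.IsSum (graphData.quo (B := Γ) γ) (graphData.quo (B := Δ) δ)
      (graphData.quo (B := Λ) ε) := by
  have h1 : (graphData.quo (B := Γ) γ : FeynmanGraph.{u}).1 = γ.contract :=
    congrArg Subtype.val (quo_eq γ)
  have h2 : (graphData.quo (B := Δ) δ : FeynmanGraph.{u}).1 = δ.contract :=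
    congrArg Subtype.val (quo_eq δ)
  have h3 : (graphData.quo (B := Λ) ε : FeynmanGraph.{u}).1 = ε.contract :=
    congrArg Subtype.val (quo_eq ε)
  have := h
  rw [← h1, ← h2, ← h3] at this
  exact this

/-- The type of subgraphs of a quotient depends on the quotient, which `FeynmanGraph.mk` gives only
up to a propositional equality. A variable `q` can be replaced by the contraction throughout. -/
theorem exists_equiv_chain (Γ : FeynmanGraph.{u}) {q : Γ.1.Subgraph → FeynmanGraph.{u}}
    (hq : ∀ K, q K = ⟨K.contract, K.isFeynman_contract Γ.2⟩) :
    ∃ e : (Σ N : Γ.1.Subgraph, (Γ.1.part N.W N.J).Subgraph) ≃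
        Σ K : Γ.1.Subgraph, (q K).1.Subgraph, ∀ x,
      (Γ.1.part (e x).1.W (e x).1.J).Iso ((Γ.1.part x.1.W x.1.J).part x.2.W x.2.J) ∧
      ((q (e x).1).1.part (e x).2.W (e x).2.J).Iso x.2.contract ∧
      (e x).2.contract.Iso x.1.contract := by
  obtain rfl : q = fun K => ⟨K.contract, K.isFeynman_contract Γ.2⟩ := funext hq
  exact HGraph.Subgraph.exists_equiv_chain Γ.2

theorem laws : graphData.{u}.Laws where
  finite_ext A B := by
    refine ((Set.finite_le_nat (Nat.card (graphData.rep A : FeynmanGraph).1.V +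
      Nat.card (graphData.rep B : FeynmanGraph).1.V)).biUnion
        fun n _ => finite_card_eq n).subset ?_
    rintro E ⟨N, hA, hB⟩
    simp only [Set.mem_iUnion]
    refine ⟨_, ?_, rfl⟩
    obtain ⟨e, -⟩ := cls_eq_iff.1 (hA.trans (HallData.cls_rep A).symm)
    obtain ⟨e', -⟩ := cls_quo_eq_iff.1 (hB.trans (HallData.cls_rep B).symm)
    exact (HGraph.Subgraph.card_le N).trans
      (Nat.add_le_add (Nat.card_congr e).le (Nat.card_congr e').le)
  transport Γ Δ h := by
    obtain ⟨e, he⟩ := HGraph.Subgraph.exists_equiv_of_iso Γ.2 Δ.2 (cls_eq_iff.1 h)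
    exact ⟨e, fun N => ⟨cls_eq_iff.2 (he N).1, cls_quo_eq_cls_quo_iff.2 (he N).2⟩⟩
  sum M N B h := by
    obtain ⟨e, he⟩ := HGraph.Subgraph.exists_equiv_of_isSum M.2 N.2 B.2 h
    exact ⟨e, fun x => ⟨(he x).1, isSum_quo (he x).2⟩⟩
  chain Γ := by
    obtain ⟨e, he⟩ := exists_equiv_chain Γ quo_eq
    refine ⟨e, fun x => ⟨cls_eq_iff.2 (he x).1, ?_, cls_quo_eq_cls_quo_iff.2 (he x).2.2⟩⟩
    exact (cls_quo_eq_iff.2 (HGraph.iso_equivalence.symm (he x).2.1)).symm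
  bot Γ := by
    obtain ⟨N, h, h'⟩ := HGraph.Subgraph.exists_bot Γ.2
    exact ⟨N, cls_quo_eq_iff.2 h, fun N' => cls_eq_iff.trans (h' N')⟩
  top Γ := by
    obtain ⟨N, h, h'⟩ := HGraph.Subgraph.exists_top Γ.2
    exact ⟨N, cls_eq_iff.2 h, fun N' => cls_quo_eq_iff.trans (h' N')⟩

end FeynmanGraph

end CK

end

/-! ### The theorem for both categories. -/

theorem mainTheorem5 (𝒞 : CK.CKCategory.{u}) :
    -- quotients of Feynman graphs by Feynman subgraphs are Feynman graphs
    (∀ (Γ : CK.HGraph.{u}) (γ : Γ.Subgraph), Γ.IsFeynman → γ.contract.IsFeynman) ∧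
    ∃ mul conv₁ conv₂ conv₃ : 𝒞.data.Hall →ₗ[ℚ] 𝒞.data.Hall →ₗ[ℚ] 𝒞.data.Hall,
      -- the Hall algebra and its Lie algebra of primitive elements
      (∀ f g M, mul f g M = 𝒞.data.hallProduct f g M) ∧
      (∀ f g h, mul (mul f g) h = mul f (mul g h)) ∧
      (∀ f, mul 𝒞.data.one f = f ∧ mul f 𝒞.data.one = f) ∧
      (∀ X ∈ 𝒞.data.primitives, ∀ Y ∈ 𝒞.data.primitives,
        mul X Y - mul Y X ∈ 𝒞.data.primitives) ∧
      -- `κ` identifies `H_C` with its restricted dual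
      Function.Injective 𝒞.data.kappa ∧
      LinearMap.range 𝒞.data.kappa = 𝒞.data.restrictedDual ∧
      -- first convolution, `g • f = π_q⁎ (π₁^* f · π₂^* g)`
      (∀ f g : 𝒞.data.Hall,
        (CK.pull CK.HallData.pi1 f * CK.pull CK.HallData.pi2 g).support.Finite ∧
        ⇑(conv₁ f g) =
          CK.push CK.HallData.piq (CK.pull CK.HallData.pi1 f * CK.pull CK.HallData.pi2 g)) ∧
      (∀ A B, conv₁ (𝒞.data.delta A) (𝒞.data.delta B) =
        ∑ᶠ N : {N : 𝒞.data.Sub (𝒞.data.rep B) // 𝒞.data.cls (𝒞.data.sub N) = A},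
          𝒞.data.delta (𝒞.data.cls (𝒞.data.quo N.1))) ∧
      CK.HallData.IsRightAction mul conv₁.flip ∧
      (∀ X ∈ 𝒞.data.primitives, ∀ g,
        𝒞.data.kappa (conv₁ (-X) g) = CK.HallData.elimination mul X (𝒞.data.kappa g)) ∧
      -- second convolution, `g □ f = π₂⁎ (π_q^* f · π₁^* g)`
      (∀ f g : 𝒞.data.Hall,
        (CK.pull CK.HallData.piq f * CK.pull CK.HallData.pi1 g).support.Finite ∧
        ⇑(conv₂ f g) =
          CK.push CK.HallData.pi2 (CK.pull CK.HallData.piq f * CK.pull CK.HallData.pi1 g)) ∧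
      (∀ A B E, conv₂ (𝒞.data.delta A) (𝒞.data.delta B) E =
        (Nat.card {N : 𝒞.data.Sub (𝒞.data.rep E) //
          𝒞.data.cls (𝒞.data.sub N) = B ∧ 𝒞.data.cls (𝒞.data.quo N) = A} : ℚ)) ∧
      CK.HallData.IsRightAction mul conv₂.flip ∧
      (∀ f g, conv₂ f g = CK.HallData.topInsertion mul g f) ∧
      CK.HallData.IsLeftAction mul conv₂.flip ∧
      (∀ f g, conv₂ f g = CK.HallData.insertion mul g f) ∧
      -- third convolution, `f ⋆ g = π₁⁎ (π_q^* f · π₂^* g)`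
      (∀ f g : 𝒞.data.Hall,
        (CK.pull CK.HallData.piq f * CK.pull CK.HallData.pi2 g).support.Finite ∧
        ⇑(conv₃ f g) =
          CK.push CK.HallData.pi1 (CK.pull CK.HallData.piq f * CK.pull CK.HallData.pi2 g)) ∧
      (∀ A B, conv₃ (𝒞.data.delta A) (𝒞.data.delta B) =
        ∑ᶠ N : {N : 𝒞.data.Sub (𝒞.data.rep B) // 𝒞.data.cls (𝒞.data.quo N) = A},
          𝒞.data.delta (𝒞.data.cls (𝒞.data.sub N.1))) ∧
      CK.HallData.IsLeftAction mul conv₃ ∧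
      (∀ X ∈ 𝒞.data.primitives, ∀ g,
        𝒞.data.kappa (conv₃ X g) = CK.HallData.topElimination mul (𝒞.data.kappa g) (-X)) ∧
      -- truncated correspondences
      ∀ M : 𝒞.data.Cls,
        FiniteDimensional ℚ (𝒞.data.HallLe M) ∧
        (𝒞.data.HallLe M).map 𝒞.data.kappa = 𝒞.data.dualLe M ∧
        Function.Bijective (𝒞.data.kappaLe M) ∧
        ∃ (star : 𝒞.data.Hall →ₗ[ℚ] 𝒞.data.HallLe M →ₗ[ℚ] 𝒞.data.HallLe M)
          (box : 𝒞.data.HallLe M →ₗ[ℚ] 𝒞.data.Hall →ₗ[ℚ] 𝒞.data.HallLe M),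
          (∀ (f : 𝒞.data.Hall) (g : 𝒞.data.HallLe M),
            (CK.pull (fun x : 𝒞.data.HeckLe M => CK.HallData.piq x.1) f *
              CK.pull (fun x : 𝒞.data.HeckLe M => CK.HallData.pi2 x.1) g.1).support.Finite ∧
            ⇑(star f g).1 = CK.push (fun x : 𝒞.data.HeckLe M => CK.HallData.pi1 x.1)
              (CK.pull (fun x : 𝒞.data.HeckLe M => CK.HallData.piq x.1) f *
                CK.pull (fun x : 𝒞.data.HeckLe M => CK.HallData.pi2 x.1) g.1)) ∧
          (∀ (g : 𝒞.data.HallLe M) (f : 𝒞.data.Hall),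
            (CK.pull (fun x : 𝒞.data.HeckLe M => CK.HallData.piq x.1) f *
              CK.pull (fun x : 𝒞.data.HeckLe M => CK.HallData.pi1 x.1) g.1).support.Finite ∧
            ⇑(box g f).1 = CK.push (fun x : 𝒞.data.HeckLe M => CK.HallData.pi2 x.1)
              (CK.pull (fun x : 𝒞.data.HeckLe M => CK.HallData.piq x.1) f *
                CK.pull (fun x : 𝒞.data.HeckLe M => CK.HallData.pi1 x.1) g.1)) ∧
          CK.HallData.IsLeftAction mul star ∧
          CK.HallData.IsRightAction mul box ∧
          -- `⋆` is the opposite of the top elimination representation on `H_{≤ M}`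
          (∀ X ∈ 𝒞.data.primitives, ∀ g : 𝒞.data.HallLe M,
            𝒞.data.kappa (star X g).1 =
              CK.HallData.topElimination mul (𝒞.data.kappa g.1) (-X)) ∧
          -- `□` is the opposite of the dual representation `(X · ψ)(v) = - ψ (X ⋆ v)`
          (∀ X ∈ 𝒞.data.primitives, ∀ g : 𝒞.data.HallLe M,
            𝒞.data.kappaLe M (box g (-X)) = -(𝒞.data.kappaLe M g ∘ₗ star X)) := by
  have hC : 𝒞.data.Laws := by
    cases 𝒞
    · exact CK.Forest.laws _
    · exact CK.FeynmanGraph.laws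
  have hcomm : ∀ f g : 𝒞.data.Hall,
      CK.pull CK.HallData.piq f * CK.pull CK.HallData.pi1 g =
        (CK.pull CK.HallData.pi1 g * CK.pull CK.HallData.piq f : 𝒞.data.Heck → ℚ) :=
    fun f g => mul_comm _ _
  have hfin : ∀ f g : 𝒞.data.Hall,
      (CK.pull CK.HallData.piq f * CK.pull CK.HallData.pi1 g :
        𝒞.data.Heck → ℚ).support.Finite := fun f g => by
    rw [hcomm]
    exact CK.finite_support_pull_mul_pull hC.finite_pi1_piq g f
  -- The two signs cancel, so top elimination by `-X` is the adjoint of right multiplication by `X`.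
  -- The truncated `⋆` reuses this.
  have htop : ∀ X g : 𝒞.data.Hall, 𝒞.data.kappa (CK.HallData.Laws.convSub 𝒞.data X g) =
      CK.HallData.topElimination hC.mul (𝒞.data.kappa g) (-X) := fun X g => by
    refine LinearMap.ext fun h => (hC.kappa_convSub X g h).trans ?_
    simp [CK.HallData.topElimination]
  -- `□` is `hC.mul.flip`, so both of its action statements are about the regular representations.
  refine ⟨fun Γ γ hΓ => γ.isFeynman_contract hΓ, hC.mul, CK.HallData.Laws.convQuo _, hC.mul.flip,
    CK.HallData.Laws.convSub _, hC.mul_apply, hC.mul_assoc, fun f => ⟨hC.one_mul f, hC.mul_one f⟩,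
    fun X hX Y hY => hC.commutator_mem hX hY, CK.HallData.kappa_injective,
    CK.HallData.range_kappa, fun f g =>
      ⟨CK.finite_support_pull_mul_pull CK.HallData.Laws.finite_pi2 f g, CK.corr_apply _ _ f g⟩,
    CK.HallData.Laws.corr_pi2_delta, hC.isRightAction_convQuo, fun X _ g => ?_,
    fun f g => ⟨hfin f g, (hC.mul_apply_eq_push g f).trans (by rw [hcomm])⟩,
    fun A B E => hC.mul_delta_apply B A E,
    ⟨hC.mul_one, fun f g x => (hC.mul_assoc x f g).symm⟩, fun _ _ => rfl,
    ⟨hC.one_mul, hC.mul_assoc⟩, fun _ _ => rfl, fun f g =>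
      ⟨CK.finite_support_pull_mul_pull CK.HallData.Laws.finite_pi2 f g, CK.corr_apply _ _ f g⟩,
    CK.HallData.Laws.corr_pi2_delta, hC.isLeftAction_convSub, fun X _ g => htop X g,
    fun M => ⟨CK.HallData.Laws.finiteDimensional_hallLe M, CK.HallData.Laws.map_kappa_hallLe M,
      CK.HallData.Laws.kappaLe_bijective M, hC.star M, hC.box M,
      fun f g => ⟨CK.HallData.Laws.finite_support_heckLe
        (CK.finite_support_pull_mul_pull CK.HallData.Laws.finite_pi2 f g.1),
        hC.star_eq_push M f g⟩,
      fun g f => ⟨CK.HallData.Laws.finite_support_heckLe (hfin f g.1), hC.box_eq_push M g f⟩,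
      hC.isLeftAction_star M, hC.isRightAction_box M, fun X _ g => htop X g.1,
      fun X _ g => hC.kappaLe_box M X g⟩⟩
  refine LinearMap.ext fun h => (hC.kappa_convQuo (-X) g h).trans ?_
  simp [CK.HallData.elimination]
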